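/- Let $n\ge 1$ and let $\gamma:S^n\to\mathbb R_{>0}$ be of class $C^2$, with Cahn-Hoffman map $\xi_\gamma(\nu)=D\gamma|_\nu+\gamma(\nu)\nu\in\mathbb R^{n+1}$, where $D\gamma$ is the gradient of $\gamma$ on $S^n$. Let $M_0$ be an oriented compact connected $n$-dimensional $C^\infty$ manifold with smooth (possibly empty) boundary $\partial M_0$ and interior $M_0^o$. Let $\epsilon_0>0$, $J=[-\epsilon_0,\epsilon_0]$, and let $X_\epsilon:M_0\to\mathbb R^{n+1}$ $(\epsilon\in J)$ be a variation of $X:=X_0$ such that $(\epsilon,p)\mapsto X_\epsilon(p)$ is of class $C^2$ on $J\times M_0$. Assume that for every $\epsilon\in J$: (a) the restriction of $X_\epsilon$ to $M_0^o$ is an immersion ($X_\epsilon$ may be singular on $\partial M_0$); (b) the unit normal $\nu_\epsilon:M_0^o\to S^n$ of $X_\epsilon$ for which $(\nu_\epsilon,dX_\epsilon(e_1),\dots,dX_\epsilon(e_n))$ is positively oriented in $\mathbb R^{n+1}$ whenever $(e_1,\dots,e_n)$ is a positively oriented basis of $T_pM_0$ extends to a $C^1$ map $\nu_\epsilon:M_0\to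 S^n$; (c) the anisotropic mean curvature $\Lambda_\epsilon=\frac1n\operatorname{trace}(-d(\xi_\gamma\circ\nu_\epsilon))$ of $X_\epsilon$ (where $T_pM_0$ is identified with $dX_\epsilon(T_pM_0)$) is bounded on $M_0^o$. Write $\nu=\nu_0$, $\Lambda=\Lambda_0$, $\tilde\xi=\xi_\gamma\circ\nu$, $\delta X=\frac{\partial X_\epsilon}{\partial\epsilon}\big|_{\epsilon=0}$, $\psi=\langle\delta X,\nu\rangle$. Let $dA_\epsilon$ be the $n$-dimensional volume of $M_0$ induced by $X_\epsilon$, $dA=dA_0$, and let $d\tilde s$ be the $(n-1)$-dimensional volume of $\partial M_0$ induced by $X$ (the counting measure if $n=1$). Let $N$ be the outward-pointing unit conormal along $\partial M_0$, that is, the unit vector orthogonal to $\nu$ and to $dX(T_p\partial M_0)$ such that $(\nu,N,dX(e_1),\dots,dX(e_{n-1}))$ is positively oriented in $\mathbb R^{n+1}$ exactly when $(w,e_1,\dots,e_{n-1})$ is positively oriented in $T_pM_0$, for $w$ outward-pointing and $(e_i)$ a basis of $T_p\partial M_0$; it is defined wherever $dX$ is injective on $T_p\partial M_0$, and elsewhere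 $d\tilde s$ has density zero. Let $p$ be the orthogonal projection of $\mathbb R^{n+1}$ onto the $(N,\nu)$-plane and $R$ the rotation by $\pi/2$ of that plane with $R(N)=\nu$, $R(\nu)=-N$. Then the energies $\mathcal F_\gamma(X_\epsilon)=\int_{M_0}\gamma(\nu_\epsilon)\,dA_\epsilon$ are finite for all $\epsilon\in J$, the functions $n\Lambda\psi$ and $\langle\delta X,R(p(\tilde\xi))\rangle$ are integrable with respect to $dA$ and $d\tilde s$, the function $\epsilon\mapsto\mathcal F_\gamma(X_\epsilon)$ is differentiable at $\epsilon=0$, and $$\delta\mathcal F_\gamma=\frac{d\mathcal F_\gamma(X_\epsilon)}{d\epsilon}\Big|_{\epsilon=0}=-\int_{M_0}n\Lambda\psi\,dA-\oint_{\partial M_0}\langle\delta X,R(p(\tilde\xi))\rangle\,d\tilde s .$$ -/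

import Mathlib

open Set Filter Topology MeasureTheory Metric
open scoped Manifold ContDiff RealInnerProductSpace

noncomputable section

namespace AnisotropicEnergy

/-- The Euclidean space `ℝᵏ`. -/
abbrev Euc (k : ℕ) : Type := EuclideanSpace ℝ (Fin k)

/-- The unit sphere `Sⁿ ⊂ ℝⁿ⁺¹`. -/
abbrev Sph (n : ℕ) : Type := sphere (0 : Euc (n + 1)) 1

/-! ### The Cahn-Hoffman map -/

open Classical in
/-- The extension of `γ : Sⁿ → ℝ` to `ℝⁿ⁺¹ ∖ {0}` that is constant along rays from the origin
(value `0` at the origin). -/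
def radialExtension {n : ℕ} (γ : Sph n → ℝ) (x : Euc (n + 1)) : ℝ :=
  if h : x = 0 then 0
  else γ ⟨‖x‖⁻¹ • x, by
    rw [mem_sphere_zero_iff_norm, norm_smul, norm_inv, norm_norm,
      inv_mul_cancel₀ (norm_ne_zero_iff.mpr h)]⟩

/-- The gradient `Dγ` of `γ` on the sphere `Sⁿ` at `ν`, as a vector of `T_ν Sⁿ = ν^⊥ ⊂ ℝⁿ⁺¹`.
It is the Euclidean gradient at `ν` of the extension of `γ` which is constant along rays: that
extension has the differential of `γ` along `T_ν Sⁿ` and derivative zero in the direction `ν`. -/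
def sphereGradient {n : ℕ} (γ : Sph n → ℝ) (ν : Sph n) : Euc (n + 1) :=
  gradient (radialExtension γ) (ν : Euc (n + 1))

/-- The Cahn-Hoffman map `ξ_γ(ν) = Dγ(ν) + γ(ν) ν`. -/
def cahnHoffman {n : ℕ} (γ : Sph n → ℝ) (ν : Sph n) : Euc (n + 1) :=
  sphereGradient γ ν + γ ν • (ν : Euc (n + 1))

/-- The determinant of `n + 1` vectors `w, v₁, …, vₙ` of `ℝⁿ⁺¹`; it is positive
iff they form a basis with the canonical orientation of `ℝⁿ⁺¹`. -/
def frameDet {n : ℕ} (w : Euc (n + 1)) (v : Fin n → Euc (n + 1)) : ℝ :=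
  Matrix.det (Matrix.of fun i j : Fin (n + 1) =>
    (Fin.cons w v : Fin (n + 1) → Euc (n + 1)) i j)

/-! ### Manifolds with boundary

The dimension of the manifold `M` is `n = m + 1 ≥ 1`; `M` is modelled on the half-space
`{u ∈ ℝⁿ | 0 ≤ u 0}`. -/

section Manifold

variable {m : ℕ} {M : Type*} [TopologicalSpace M] [ChartedSpace (EuclideanHalfSpace (m + 1)) M]

/-- An orientation of a manifold with boundary: an orientation of every tangent space, which is
locally constant when it is read in the local trivializations of the tangent bundle (those given
by the charts). -/
structure ManifoldOrientation (m : ℕ) (M : Type*) [TopologicalSpace M]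
    [ChartedSpace (EuclideanHalfSpace (m + 1)) M] [IsManifold (𝓡∂ (m + 1)) ∞ M] where
  /-- the orientation of the tangent space at `p` -/
  at_point : ∀ p : M, Orientation ℝ (TangentSpace (𝓡∂ (m + 1)) p) (Fin (m + 1))
  locally_constant : ∀ p₀ : M, ∃ o₀ : Orientation ℝ (Euc (m + 1)) (Fin (m + 1)),
    ∀ᶠ p in 𝓝 p₀,
      ∀ hp : p ∈ (trivializationAt (Euc (m + 1)) (TangentSpace (𝓡∂ (m + 1))) p₀).baseSet,
        Orientation.map (Fin (m + 1))
          ((trivializationAt (Euc (m + 1)) (TangentSpace (𝓡∂ (m + 1))) p₀).continuousLinearEquivAt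
            ℝ p hp).toLinearEquiv (at_point p) = o₀

/-- The differential `dX_p : T_p M → ℝⁿ⁺¹` of a map `X : M → ℝⁿ⁺¹`. -/
def dmap (X : M → Euc (m + 1 + 1)) (p : M) :
    TangentSpace (𝓡∂ (m + 1)) p →ₗ[ℝ] Euc (m + 1 + 1) :=
  (mvfderiv (𝓡∂ (m + 1)) X p).toLinearMap

/-- The component of a tangent vector at `p` along the coordinate which defines the boundary in
the preferred chart at `p`. For a boundary point `p`, the tangent vectors of the boundary are
those where it vanishes, and the outward-pointing vectors are those where it is negative. -/
def boundaryComponent (p : M) (v : TangentSpace (𝓡∂ (m + 1)) p) : ℝ :=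
  (show Euc (m + 1) from v) 0

/-- `X : M → ℝⁿ⁺¹` is a weak immersion of class `C²` with unit normal `ν : M → Sⁿ`: `X` is `C²` up
to the boundary and an immersion on the interior, and `ν` is a `C¹` map on `M` which on the
interior is the unit normal of `X` that is compatible with the orientations of `M` and `ℝⁿ⁺¹`. -/
structure IsWeakImmersion [IsManifold (𝓡∂ (m + 1)) ∞ M] (o : ManifoldOrientation m M)
    (X : M → Euc (m + 1 + 1)) (ν : M → Sph (m + 1)) : Prop where
  contMDiff_map : ContMDiff (𝓡∂ (m + 1)) 𝓘(ℝ, Euc (m + 1 + 1)) 2 X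
  immersion : ∀ p ∈ (𝓡∂ (m + 1)).interior M, Function.Injective (dmap X p)
  contMDiff_normal : ContMDiff (𝓡∂ (m + 1)) (𝓡 (m + 1)) 1 ν
  normal : ∀ p ∈ (𝓡∂ (m + 1)).interior M, ∀ v : TangentSpace (𝓡∂ (m + 1)) p,
    ⟪(ν p : Euc (m + 1 + 1)), dmap X p v⟫ = 0
  oriented : ∀ p ∈ (𝓡∂ (m + 1)).interior M,
    ∀ b : Module.Basis (Fin (m + 1)) ℝ (TangentSpace (𝓡∂ (m + 1)) p),
      b.orientation = o.at_point p ↔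
        0 < frameDet (ν p : Euc (m + 1 + 1)) (fun i => dmap X p (b i))

/-! ### Anisotropic mean curvature -/

/-- The Cahn-Hoffman field `ξ̃ = ξ_γ ∘ ν` along a map with unit normal `ν`. -/
def cahnHoffmanField (γ : Sph (m + 1) → ℝ) (ν : M → Sph (m + 1)) (p : M) : Euc (m + 1 + 1) :=
  cahnHoffman γ (ν p)

open Classical in
/-- The anisotropic shape operator `S = -dξ̃ : T_p M → T_p M`, where `T_p M` is identified with its
image under `dX_p`: the linear map with `dX_p ∘ S = -dξ̃_p`. It is unique if `dX_p` is injective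
(the value is only meant at such points `p`). -/
def shapeOperator (γ : Sph (m + 1) → ℝ) (X : M → Euc (m + 1 + 1)) (ν : M → Sph (m + 1)) (p : M) :
    TangentSpace (𝓡∂ (m + 1)) p →ₗ[ℝ] TangentSpace (𝓡∂ (m + 1)) p :=
  if h : ∃ S : TangentSpace (𝓡∂ (m + 1)) p →ₗ[ℝ] TangentSpace (𝓡∂ (m + 1)) p,
      ∀ v, dmap X p (S v) = -dmap (cahnHoffmanField γ ν) p v
  then h.choose else 0

/-- The anisotropic mean curvature `Λ = (1/n) trace S`, with `n = m + 1`. -/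
def anisotropicMeanCurvature (γ : Sph (m + 1) → ℝ) (X : M → Euc (m + 1 + 1))
    (ν : M → Sph (m + 1)) (p : M) : ℝ :=
  (1 / ((m + 1 : ℕ) : ℝ)) *
    LinearMap.trace ℝ (TangentSpace (𝓡∂ (m + 1)) p) (shapeOperator γ X ν p)

/-! ### The boundary term -/

/-- `N` is the outward-pointing unit conormal of `X` at the boundary point `p`: the unit vector
orthogonal to `ν` and to `dX(T_p ∂M)` such that `(ν, N, dX e₁, …, dX eₘ)` is positively oriented in
`ℝⁿ⁺¹` exactly when `(w, e₁, …, eₘ)` is positively oriented in `T_p M`, for `w` outward-pointing and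
`e₁, …, eₘ` tangent to the boundary. Where `X` is an immersion at `p`, this says that `N` is tangent
to `X` and points in the direction of `dX w`. The condition determines `N` also where `X` is
singular at `p`, provided that `dX` is injective on `T_p ∂M`, that is, where the density of the
boundary measure does not vanish. -/
structure IsOutwardConormal [IsManifold (𝓡∂ (m + 1)) ∞ M] (o : ManifoldOrientation m M)
    (X : M → Euc (m + 1 + 1)) (ν : M → Sph (m + 1)) (p : M) (N : Euc (m + 1 + 1)) : Prop where
  norm_eq_one : ‖N‖ = 1
  orthogonal_normal : ⟪N, (ν p : Euc (m + 1 + 1))⟫ = 0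
  orthogonal_boundary : ∀ v : TangentSpace (𝓡∂ (m + 1)) p, boundaryComponent p v = 0 →
    ⟪N, dmap X p v⟫ = 0
  outward : ∀ b : Module.Basis (Fin (m + 1)) ℝ (TangentSpace (𝓡∂ (m + 1)) p),
    boundaryComponent p (b 0) < 0 →
    (∀ j : Fin m, boundaryComponent p (b j.succ) = 0) →
      (b.orientation = o.at_point p ↔
        0 < frameDet (ν p : Euc (m + 1 + 1))
          (Fin.cons N (fun j : Fin m => dmap X p (b j.succ))))

open Classical in
/-- The outward-pointing unit conormal `N` along the boundary (`0` where it is not defined, which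
along the boundary happens only where the boundary measure has density zero). -/
def conormal [IsManifold (𝓡∂ (m + 1)) ∞ M] (o : ManifoldOrientation m M)
    (X : M → Euc (m + 1 + 1)) (ν : M → Sph (m + 1)) (p : M) : Euc (m + 1 + 1) :=
  if h : ∃ N, IsOutwardConormal o X ν p N then h.choose else 0

/-- The orthogonal projection of `ℝᵏ` onto the `(N, ν)`-plane. -/
def planeProjection {k : ℕ} (N ν w : Euc k) : Euc k :=
  (Submodule.span ℝ {N, ν}).starProjection w

/-- The rotation by `π/2` of the `(N, ν)`-plane (for orthonormal `N`, `ν`), with `R(N) = ν` and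
`R(ν) = -N`. -/
def planeRotation {k : ℕ} (N ν w : Euc k) : Euc k :=
  ⟪w, N⟫ • ν - ⟪w, ν⟫ • N

/-- The vector `R(p(ξ̃))` along the boundary. -/
def boundaryField [IsManifold (𝓡∂ (m + 1)) ∞ M] (o : ManifoldOrientation m M)
    (γ : Sph (m + 1) → ℝ) (X : M → Euc (m + 1 + 1)) (ν : M → Sph (m + 1)) (p : M) :
    Euc (m + 1 + 1) :=
  planeRotation (conormal o X ν p) (ν p : Euc (m + 1 + 1))
    (planeProjection (conormal o X ν p) (ν p : Euc (m + 1 + 1)) (cahnHoffmanField γ ν p))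

/-! ### The induced volume measures -/

/-- The `i`-th coordinate vector field `∂ᵢX = dX(∂/∂uᵢ)` in the chart at `c`, at the point of the
half-space with coordinates `u`. -/
def coordDeriv (X : M → Euc (m + 1 + 1)) (c : M) (u : Euc (m + 1)) (i : Fin (m + 1)) :
    Euc (m + 1 + 1) :=
  fderivWithin ℝ (X ∘ (extChartAt (𝓡∂ (m + 1)) c).symm) (range (𝓡∂ (m + 1))) u
    (EuclideanSpace.single i 1)

/-- The volume density `√det(⟨∂ᵢX, ∂ⱼX⟩)_{i,j}` in the chart at `c`. -/
def volumeDensity (X : M → Euc (m + 1 + 1)) (c : M) (u : Euc (m + 1)) : ℝ :=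
  √(Matrix.det (Matrix.of fun i j : Fin (m + 1) =>
    ⟪coordDeriv X c u i, coordDeriv X c u j⟫))

/-- The volume density `√det(⟨∂ᵢX, ∂ⱼX⟩)_{i,j ≥ 1}` of the boundary `{u 0 = 0}` in the chart
at `c` (it equals `1` when the boundary is zero-dimensional). -/
def boundaryDensity (X : M → Euc (m + 1 + 1)) (c : M) (u : Euc (m + 1)) : ℝ :=
  √(Matrix.det (Matrix.of fun i j : Fin m =>
    ⟪coordDeriv X c u i.succ, coordDeriv X c u j.succ⟫))

/-- The point `(0, v)` of the boundary hyperplane of the half-space. -/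
def boundaryPoint (v : Euc m) : Euc (m + 1) :=
  WithLp.toLp 2 (Fin.cons 0 (fun i => v i))

variable [MeasurableSpace M]

/-- The volume measure induced by `X` on the domain of the chart at `c`:
`√det(⟨∂ᵢX, ∂ⱼX⟩) du₀ … duₘ`. -/
def chartVolume (X : M → Euc (m + 1 + 1)) (c : M) : Measure M :=
  Measure.map (extChartAt (𝓡∂ (m + 1)) c).symm
    ((volume.restrict (extChartAt (𝓡∂ (m + 1)) c).target).withDensity
      (fun u => ENNReal.ofReal (volumeDensity X c u)))

/-- The volume measure `dA` on `M` of the (possibly degenerate) metric induced by `X`. It is the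
measure which on the domain of every chart is the one given by the coordinate formula, that is, the
supremum of these measures. -/
def volumeMeasure (X : M → Euc (m + 1 + 1)) : Measure M :=
  ⨆ c : M, chartVolume X c

/-- The `m`-dimensional volume measure induced by `X` on the part of the boundary in the domain of
the chart at `c`: `√det(⟨∂ᵢX, ∂ⱼX⟩)_{i,j ≥ 1} du₁ … duₘ` (the counting measure for `m = 0`). -/
def chartBoundaryVolume (X : M → Euc (m + 1 + 1)) (c : M) : Measure M :=
  Measure.map (fun v => (extChartAt (𝓡∂ (m + 1)) c).symm (boundaryPoint v))
    ((volume.restrict {v : Euc m | boundaryPoint v ∈ (extChartAt (𝓡∂ (m + 1)) c).target}).withDensity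
      (fun v => ENNReal.ofReal (boundaryDensity X c (boundaryPoint v))))

/-- The `m`-dimensional volume measure `ds̃` of `∂M` induced by `X`, as a measure on `M` which is
carried by `∂M`. -/
def boundaryMeasure (X : M → Euc (m + 1 + 1)) : Measure M :=
  ⨆ c : M, chartBoundaryVolume X c

/-- The anisotropic energy `F_γ(X) = ∫_M γ(ν) dA`. -/
def energy (γ : Sph (m + 1) → ℝ) (X : M → Euc (m + 1 + 1)) (ν : M → Sph (m + 1)) : ℝ :=
  ∫ p, γ (ν p) ∂(volumeMeasure X)

end Manifold

end AnisotropicEnergy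

end

/-! Extend `γ` to a function `Γ` that is positively homogeneous of degree one. Its gradient is
homogeneous of degree zero and equals the Cahn-Hoffman map on the sphere. In a chart with
orientation sign `s`, let `Z` be the cross product of the coordinate vectors `∂ᵢX`, so that `⟪w, Z⟫
= det (w, ∂₀X, …, ∂ₘX)`. Then `s Z` is the volume density times `ν`, and the energy density is `Γ(s
Z)`. In this form `ν_ε` never has to be differentiated in `ε`: by the chain rule the derivative of
the density at `ε = 0` is `s ∑ᵢ det (ξ̃, ∂₀X, …, ∂ᵢδX, …, ∂ₘX)`, and domination on compact supports
allows differentiation under the integral (`hasDerivAt_localizedEnergy`).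

The rest is integration by parts (`integral_variationDensity`). The vector field with components
`det (ξ̃, ∂₀X, …, δX, …, ∂ₘX)`, with `δX` in slot `i`, has divergence `∑ det (ξ̃, …, ∂ᵢδX, …) - ∑
det (δX, …, ∂ᵢξ̃, …)`, because the second derivatives of `X` cancel by antisymmetry
(`sum_partialDeriv_frameDet`). Differentiating Euler's relation shows that `∂ᵢξ̃` is orthogonal to
`ν`. Hence `∂ᵢξ̃ = -dX(S eᵢ)` with the shape operator `S`, and the second sum is a trace: up to sign
it is `nΛψ` times the volume density (`sum_frameDet_cahnHoffmanField`). On the boundary only the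
zeroth component of the field counts. It is `det (ξ̃, δX, ∂₁X, …, ∂ₘX)`, and expanding `ξ̃` and `δX`
along `ν` and `N` gives `⟪δX, R(p(ξ̃))⟫` times the boundary density
(`frameDet_cons_cahnHoffmanField`).

Singularities of `X` on the boundary do no harm. Each integrand, multiplied by its density, is a
determinant that is continuous up to the boundary and compactly supported in the chart, which also
gives integrability. The boundary is null for the volume integrals, and where the boundary density
vanishes, so does the boundary determinant.

To globalize, the chart measures agree on overlaps, so their supremum restricts to each of them
(`iSup_measure_restrict`), and a partition of unity subordinate to oriented charts splits the energy
and the variation field. -/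

set_option linter.unusedSectionVars false

open Set Filter Topology MeasureTheory Metric
open scoped Manifold ContDiff RealInnerProductSpace

noncomputable section

namespace AnisotropicEnergy

/-! ### The determinant of a frame -/

section FrameDet

variable {n : ℕ}

/-- The determinant as an alternating form on `ℝⁿ⁺¹`. -/
def detForm (n : ℕ) : Euc (n + 1) [⋀^Fin (n + 1)]→ₗ[ℝ] ℝ :=
  (Matrix.detRowAlternating (n := Fin (n + 1)) (R := ℝ)).compLinearMap
    (WithLp.linearEquiv 2 ℝ (Fin (n + 1) → ℝ)).toLinearMap

lemma detForm_apply (v : Fin (n + 1) → Euc (n + 1)) :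
    detForm n v = Matrix.det (Matrix.of fun i j => v i j) := rfl

/-- The alternating form `v ↦ det (w, v₁, …, vₙ)`. -/
def frameForm (w : Euc (n + 1)) : Euc (n + 1) [⋀^Fin n]→ₗ[ℝ] ℝ := (detForm n).curryLeft w

lemma frameForm_apply (w : Euc (n + 1)) (v : Fin n → Euc (n + 1)) :
    frameForm w v = frameDet w v := rfl

lemma frameDet_eq_detForm (w : Euc (n + 1)) (v : Fin n → Euc (n + 1)) :
    frameDet w v = detForm n (Fin.cons w v) := rfl

lemma frameDet_add_left (w w' : Euc (n + 1)) (v : Fin n → Euc (n + 1)) :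
    frameDet (w + w') v = frameDet w v + frameDet w' v := by
  simp only [← frameForm_apply, frameForm, map_add, AlternatingMap.add_apply]

lemma frameDet_smul_left (c : ℝ) (w : Euc (n + 1)) (v : Fin n → Euc (n + 1)) :
    frameDet (c • w) v = c * frameDet w v := by
  simp only [← frameForm_apply, frameForm, map_smul, AlternatingMap.smul_apply, smul_eq_mul]

lemma frameDet_neg_left (w : Euc (n + 1)) (v : Fin n → Euc (n + 1)) :
    frameDet (-w) v = -frameDet w v := by
  simp only [← frameForm_apply, frameForm, map_neg, AlternatingMap.neg_apply]

/-- The two frames differ by the transposition of positions `0` and `i + 1`. Linearity and vanishing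
in the first argument thereby become available in every slot. -/
lemma frameDet_update_swap (w z : Euc (n + 1)) (v : Fin n → Euc (n + 1)) (i : Fin n) :
    frameDet w (Function.update v i z) = -frameDet z (Function.update v i w) := by
  rw [frameDet_eq_detForm, frameDet_eq_detForm,
    ← (detForm n).map_swap (Fin.cons z (Function.update v i w)) (Fin.succ_ne_zero i).symm]
  congr 1
  ext j : 1
  refine Fin.cases ?_ (fun j => ?_) j
  · simp
  · by_cases h : j = i
    · subst h
      simp [Function.update_of_ne (Fin.succ_ne_zero j).symm]
    · have : (Fin.succ j) ≠ Fin.succ i := fun e => h (Fin.succ_injective _ e)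
      simp [Equiv.swap_apply_of_ne_of_ne (Fin.succ_ne_zero j) this, h]

/-- The coordinates of `z` form a nonzero kernel vector of the matrix with rows `w, v₁, …, vₙ`. -/
lemma frameDet_eq_zero_of_inner_eq_zero {z w : Euc (n + 1)} {v : Fin n → Euc (n + 1)}
    (hz : z ≠ 0) (hw : ⟪z, w⟫ = 0) (hv : ∀ i, ⟪z, v i⟫ = 0) : frameDet w v = 0 := by
  refine Matrix.exists_mulVec_eq_zero_iff.mp ⟨fun j => z j, ?_, ?_⟩
  · intro h
    apply hz
    ext j
    exact congrFun h j
  · ext i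
    simp only [Matrix.mulVec, dotProduct, Matrix.of_apply, Pi.zero_apply]
    refine Fin.cases ?_ (fun i => ?_) i
    · simpa [PiLp.inner_apply] using hw
    · simpa [PiLp.inner_apply] using hv i

/-- After its component along `ν` is removed, `w` is orthogonal to `ν`, like all the `v i`, and
contributes nothing. This is how the normal component `ψ` of the variation enters. -/
lemma frameDet_eq_inner_mul {ν : Euc (n + 1)} (hν : ‖ν‖ = 1) {v : Fin n → Euc (n + 1)}
    (hv : ∀ i, ⟪ν, v i⟫ = 0) (w : Euc (n + 1)) :
    frameDet w v = ⟪w, ν⟫ * frameDet ν v := by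
  have h0 : ν ≠ 0 := by
    rintro rfl
    simp at hν
  have h1 : ⟪ν, ν⟫ = 1 := by
    rw [real_inner_self_eq_norm_sq, hν, one_pow]
  have h := frameDet_eq_zero_of_inner_eq_zero (w := w - ⟪w, ν⟫ • ν) h0
    (by rw [inner_sub_right, real_inner_smul_right, h1, real_inner_comm]; ring) hv
  rw [sub_eq_add_neg, frameDet_add_left, frameDet_neg_left, frameDet_smul_left] at h
  linarith

/-- The Gram determinant of a family of vectors. -/
def gramDet {k l : ℕ} (v : Fin l → Euc k) : ℝ :=
  Matrix.det (Matrix.of fun i j : Fin l => ⟪v i, v j⟫)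

/-- The first row of the Gram matrix is `(1, 0, …, 0)`. -/
lemma gramDet_cons {k l : ℕ} {w : Euc k} {v : Fin l → Euc k} (hw : ‖w‖ = 1)
    (hv : ∀ i, ⟪w, v i⟫ = 0) : gramDet (Fin.cons w v : Fin (l + 1) → Euc k) = gramDet v := by
  rw [gramDet, Matrix.det_succ_row_zero, Fin.sum_univ_succ, Finset.sum_eq_zero]
  · simp only [Fin.val_zero, pow_zero, Matrix.of_apply, Fin.cons_zero, one_mul, add_zero,
      real_inner_self_eq_norm_sq, hw, one_pow]
    rw [gramDet]
    congr 1
  · intro i _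
    simp [hv]

/-- The Gram matrix is `A Aᵀ` for the matrix `A` with rows `v i`. -/
lemma detForm_sq (v : Fin (n + 1) → Euc (n + 1)) : detForm n v ^ 2 = gramDet v := by
  rw [detForm_apply, sq]
  nth_rewrite 2 [← Matrix.det_transpose]
  rw [← Matrix.det_mul, gramDet]
  congr 1
  ext i j
  simp [Matrix.mul_apply, PiLp.inner_apply, mul_comm]

lemma frameDet_sq {ν : Euc (n + 1)} (hν : ‖ν‖ = 1) {v : Fin n → Euc (n + 1)}
    (hv : ∀ i, ⟪ν, v i⟫ = 0) : frameDet ν v ^ 2 = gramDet v := by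
  rw [frameDet_eq_detForm, detForm_sq, gramDet_cons hν hv]

lemma sqrt_gramDet_eq_abs {ν : Euc (n + 1)} (hν : ‖ν‖ = 1) {v : Fin n → Euc (n + 1)}
    (hv : ∀ i, ⟪ν, v i⟫ = 0) : √(gramDet v) = |frameDet ν v| := by
  rw [← frameDet_sq hν hv, Real.sqrt_sq_eq_abs]

lemma frameDet_cons_sq {ν N : Euc (n + 1 + 1)} (hν : ‖ν‖ = 1) (hN : ‖N‖ = 1) (hνN : ⟪ν, N⟫ = 0)
    {y : Fin n → Euc (n + 1 + 1)} (hy : ∀ i, ⟪ν, y i⟫ = 0) (hy' : ∀ i, ⟪N, y i⟫ = 0) :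
    frameDet ν (Fin.cons N y) ^ 2 = gramDet y := by
  rw [frameDet_sq hν, gramDet_cons hN hy']
  exact Fin.cases hνN hy

lemma frameDet_cons_swap (w z : Euc (n + 1 + 1)) (y : Fin n → Euc (n + 1 + 1)) :
    frameDet w (Fin.cons z y) = -frameDet z (Fin.cons w y) := by
  simpa using frameDet_update_swap w z (Fin.cons z y : Fin (n + 1) → Euc (n + 1 + 1)) 0

lemma frameDet_cons_add (w z z' : Euc (n + 1 + 1)) (y : Fin n → Euc (n + 1 + 1)) :
    frameDet w (Fin.cons (z + z') y) = frameDet w (Fin.cons z y) + frameDet w (Fin.cons z' y) := by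
  rw [frameDet_cons_swap, frameDet_add_left, frameDet_cons_swap w z, frameDet_cons_swap w z']
  ring

lemma frameDet_cons_smul (c : ℝ) (w z : Euc (n + 1 + 1)) (y : Fin n → Euc (n + 1 + 1)) :
    frameDet w (Fin.cons (c • z) y) = c * frameDet w (Fin.cons z y) := by
  rw [frameDet_cons_swap, frameDet_smul_left, frameDet_cons_swap w z]
  ring

lemma frameDet_cons_self (w : Euc (n + 1 + 1)) (y : Fin n → Euc (n + 1 + 1)) :
    frameDet w (Fin.cons w y) = 0 := by
  have := frameDet_cons_swap w w y
  linarith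

/-- If `ν`, `N` are orthonormal and the vectors `w`, `yᵢ` are orthogonal to both, then
`w, z, y₁, …` are linearly dependent. -/
lemma frameDet_cons_eq_zero {ν N w : Euc (n + 1 + 1)} (hν : ‖ν‖ = 1) (hN : ‖N‖ = 1)
    (hνN : ⟪ν, N⟫ = 0) {y : Fin n → Euc (n + 1 + 1)} (hy : ∀ i, ⟪ν, y i⟫ = 0)
    (hy' : ∀ i, ⟪N, y i⟫ = 0) (hw : ⟪ν, w⟫ = 0) (hw' : ⟪N, w⟫ = 0) (z : Euc (n + 1 + 1)) :
    frameDet w (Fin.cons z y) = 0 := by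
  have h1 : ⟪ν, ν⟫ = 1 := by rw [real_inner_self_eq_norm_sq, hν, one_pow]
  have h2 : ⟪N, N⟫ = 1 := by rw [real_inner_self_eq_norm_sq, hN, one_pow]
  by_cases hz : ⟪N, z⟫ = 0
  · refine frameDet_eq_zero_of_inner_eq_zero (z := N) ?_ hw' (Fin.cases hz hy')
    rintro rfl
    simp at hN
  -- The vector of the `(ν, N)`-plane orthogonal to `z`; its `ν`-component `⟪N, z⟫` is nonzero in
  -- this case.
  · refine frameDet_eq_zero_of_inner_eq_zero (z := ⟪N, z⟫ • ν - ⟪ν, z⟫ • N) ?_ ?_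
      (Fin.cases ?_ fun i => ?_)
    · intro h
      have := congrArg (fun t => ⟪ν, t⟫) h
      simp only [inner_sub_right, real_inner_smul_right, h1, hνN, inner_zero_right] at this
      apply hz
      linarith
    · rw [inner_sub_left, real_inner_smul_left, real_inner_smul_left, hw, hw']
      ring
    · simp only [Fin.cons_zero, inner_sub_left, real_inner_smul_left]
      ring
    · simp only [Fin.cons_succ, inner_sub_left, real_inner_smul_left, hy, hy']
      ring

/-- The determinant `det (w, z, y₁, …)` in terms of the components of `w`, `z` in the plane
orthogonal to the `yᵢ`. -/
lemma frameDet_cons_eq {ν N : Euc (n + 1 + 1)} (hν : ‖ν‖ = 1) (hN : ‖N‖ = 1)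
    (hνN : ⟪ν, N⟫ = 0) {y : Fin n → Euc (n + 1 + 1)} (hy : ∀ i, ⟪ν, y i⟫ = 0)
    (hy' : ∀ i, ⟪N, y i⟫ = 0) (w z : Euc (n + 1 + 1)) :
    frameDet w (Fin.cons z y) =
      (⟪w, ν⟫ * ⟪z, N⟫ - ⟪w, N⟫ * ⟪z, ν⟫) * frameDet ν (Fin.cons N y) := by
  have h1 : ⟪ν, ν⟫ = 1 := by rw [real_inner_self_eq_norm_sq, hν, one_pow]
  have h2 : ⟪N, N⟫ = 1 := by rw [real_inner_self_eq_norm_sq, hN, one_pow]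
  have hNν : ⟪N, ν⟫ = 0 := by rw [real_inner_comm, hνN]
  -- Splitting off the components along `ν` and `N` leaves remainders orthogonal to both, and a
  -- frame that contains such a remainder beside the `y i` is degenerate (`e1`, `e2`).
  have key : ∀ t : Euc (n + 1 + 1), ∃ t', ⟪ν, t'⟫ = 0 ∧ ⟪N, t'⟫ = 0 ∧
      t = ⟪t, ν⟫ • ν + ⟪t, N⟫ • N + t' := by
    intro t
    refine ⟨t - ⟪t, ν⟫ • ν - ⟪t, N⟫ • N, ?_, ?_, by abel⟩
    · simp only [inner_sub_right, real_inner_smul_right, h1, hνN, real_inner_comm t]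
      ring
    · simp only [inner_sub_right, real_inner_smul_right, h2, hNν, real_inner_comm t]
      ring
  obtain ⟨w', hw1, hw2, hw⟩ := key w
  obtain ⟨z', hz1, hz2, hz⟩ := key z
  have e1 : ∀ t, frameDet w' (Fin.cons t y) = 0 :=
    frameDet_cons_eq_zero hν hN hνN hy hy' hw1 hw2
  have e2 : ∀ t, frameDet t (Fin.cons z' y) = 0 := fun t => by
    rw [frameDet_cons_swap, frameDet_cons_eq_zero hν hN hνN hy hy' hz1 hz2, neg_zero]
  generalize ⟪w, ν⟫ = a at hw ⊢
  generalize ⟪w, N⟫ = b at hw ⊢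
  generalize ⟪z, ν⟫ = c at hz ⊢
  generalize ⟪z, N⟫ = d at hz ⊢
  rw [hw, hz]
  simp only [frameDet_add_left, frameDet_smul_left, frameDet_cons_add, frameDet_cons_smul, e1, e2,
    frameDet_cons_self, frameDet_cons_swap N ν]
  ring

/-- A kernel vector `c` of the Gram matrix `G` satisfies `‖∑ c j • y j‖² = cᵀ G c = 0`. -/
lemma exists_sum_smul_eq_zero_of_gramDet_eq_zero {k l : ℕ} {y : Fin l → Euc k}
    (h : gramDet y = 0) : ∃ c : Fin l → ℝ, c ≠ 0 ∧ ∑ j, c j • y j = 0 := by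
  obtain ⟨c, hc, hc'⟩ := Matrix.exists_mulVec_eq_zero_iff.mpr h
  refine ⟨c, hc, ?_⟩
  rw [← inner_self_eq_zero (𝕜 := ℝ), sum_inner]
  refine Finset.sum_eq_zero fun i _ => ?_
  rw [real_inner_smul_left, inner_sum]
  have := congrFun hc' i
  simp only [Matrix.mulVec, dotProduct, Matrix.of_apply, Pi.zero_apply] at this
  simp only [real_inner_smul_right]
  rw [← mul_zero (c i), ← this]
  congr 1
  exact Finset.sum_congr rfl fun j _ => mul_comm _ _

/-- Settles the boundary points where `dX` degenerates along `∂M`: the boundary integrand vanishes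
there, so no conormal is needed. -/
lemma frameDet_eq_zero_of_gramDet_eq_zero {y : Fin n → Euc (n + 1 + 1)} (h : gramDet y = 0)
    (w z : Euc (n + 1 + 1)) : frameDet w (Fin.cons z y) = 0 := by
  obtain ⟨c, hc, hsum⟩ := exists_sum_smul_eq_zero_of_gramDet_eq_zero h
  refine AlternatingMap.map_linearDependent (frameForm w) _ fun hli => hc ?_
  have := Fintype.linearIndependent_iff.mp (hli.comp Fin.succ (Fin.succ_injective _)) c
    (by simpa using hsum)
  exact funext this

/-- When `S (e i)` is expanded in the basis, every off-diagonal term repeats some `A (e j)` and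
vanishes, so slot `i` contributes the diagonal entry of `S`. For the shape operator this produces
the mean curvature. -/
lemma frameDet_trace {T : Type*} [AddCommGroup T] [Module ℝ T]
    (e : Module.Basis (Fin n) ℝ T) (A : T →ₗ[ℝ] Euc (n + 1)) (S : T →ₗ[ℝ] T) (w : Euc (n + 1)) :
    ∑ i, frameDet w (Function.update (fun j => A (e j)) i (A (S (e i)))) =
      LinearMap.trace ℝ T S * frameDet w (fun j => A (e j)) := by
  rw [LinearMap.trace_eq_matrix_trace ℝ e, Matrix.trace, Finset.sum_mul]
  refine Finset.sum_congr rfl fun i _ => ?_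
  have h1 : A (S (e i)) = ∑ j, (LinearMap.toMatrix e e S j i) • A (e j) := by
    rw [← congrArg A (e.sum_repr (S (e i))), map_sum]
    simp only [map_smul, LinearMap.toMatrix_apply]
  rw [h1, ← frameForm_apply, AlternatingMap.map_update_sum, Finset.sum_eq_single i]
  · rw [AlternatingMap.map_update_smul, Function.update_eq_self, smul_eq_mul, Matrix.diag_apply,
      frameForm_apply]
  · intro j _ hj
    rw [AlternatingMap.map_update_smul]
    have := (frameForm w).map_update_self (fun j => A (e j)) hj.symm
    rw [this, smul_zero]
  · simp

/-- The determinant as a continuous multilinear map. -/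
def detCMM (n : ℕ) : ContinuousMultilinearMap ℝ (fun _ : Fin (n + 1) => Euc (n + 1)) ℝ :=
  ⟨(detForm n).toMultilinearMap, by
    change Continuous fun v : Fin (n + 1) → Euc (n + 1) => Matrix.det (Matrix.of fun i j => v i j)
    refine Continuous.matrix_det ?_
    refine continuous_matrix fun i j => ?_
    simp only [Matrix.of_apply]
    fun_prop⟩

lemma hasFDerivAt_frameDet {G : Type*} [NormedAddCommGroup G] [NormedSpace ℝ G]
    {w : G → Euc (n + 1)} {v : Fin n → G → Euc (n + 1)} {w' : G →L[ℝ] Euc (n + 1)}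
    {v' : Fin n → G →L[ℝ] Euc (n + 1)} {x : G} (hw : HasFDerivAt w w' x)
    (hv : ∀ i, HasFDerivAt (v i) (v' i) x) :
    ∃ D : G →L[ℝ] ℝ, HasFDerivAt (fun t => frameDet (w t) (fun i => v i t)) D x ∧
      ∀ t, D t = frameDet (w' t) (fun i => v i x) +
        ∑ i, frameDet (w x) (Function.update (fun j => v j x) i (v' i t)) := by
  have h := HasFDerivAt.multilinear_comp (detCMM n) (x := x)
    (g := (Fin.cons w v : Fin (n + 1) → G → Euc (n + 1)))
    (g' := (Fin.cons w' v' : Fin (n + 1) → G →L[ℝ] Euc (n + 1))) (Fin.cases hw hv)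
  have hc : ∀ t, (fun i => (Fin.cons w v : Fin (n + 1) → G → Euc (n + 1)) i t) =
      Fin.cons (w t) (fun i => v i t) := fun t => by
    ext i : 1
    refine Fin.cases rfl (fun i => rfl) i
  simp only [hc] at h
  refine ⟨_, h, fun t => ?_⟩
  rw [sum_apply, Fin.sum_univ_succ]
  congr 1
  · change detForm n (Function.update _ 0 _) = _
    rw [Fin.update_cons_zero]
    rfl
  · refine Finset.sum_congr rfl fun i _ => ?_
    change detForm n (Function.update _ i.succ _) = _
    rw [← Fin.cons_update]
    rfl

lemma hasDerivAt_frameDet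
    {w : ℝ → Euc (n + 1)} {v : Fin n → ℝ → Euc (n + 1)} {w' : Euc (n + 1)}
    {v' : Fin n → Euc (n + 1)} {x : ℝ} (hw : HasDerivAt w w' x)
    (hv : ∀ i, HasDerivAt (v i) (v' i) x) :
    HasDerivAt (fun t => frameDet (w t) (fun i => v i t))
      (frameDet w' (fun i => v i x) +
        ∑ i, frameDet (w x) (Function.update (fun j => v j x) i (v' i))) x := by
  obtain ⟨D, hD, hD'⟩ := hasFDerivAt_frameDet hw.hasFDerivAt (fun i => (hv i).hasFDerivAt)
  have := hD.hasDerivAt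
  rw [hD'] at this
  simpa using this

lemma contDiffOn_frameDet {G : Type*} [NormedAddCommGroup G] [NormedSpace ℝ G] {k : WithTop ℕ∞}
    {s : Set G} {w : G → Euc (n + 1)} {v : Fin n → G → Euc (n + 1)} (hw : ContDiffOn ℝ k w s)
    (hv : ∀ i, ContDiffOn ℝ k (v i) s) :
    ContDiffOn ℝ k (fun t => frameDet (w t) (fun i => v i t)) s := by
  have : (fun t => frameDet (w t) (fun i => v i t)) =
      (detCMM n) ∘ fun t => (Fin.cons (w t) fun i => v i t) := rfl
  rw [this]
  refine (detCMM n).contDiff.comp_contDiffOn ?_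
  rw [contDiffOn_pi]
  exact Fin.cases hw hv

lemma continuousOn_frameDet {G : Type*} [TopologicalSpace G]
    {s : Set G} {w : G → Euc (n + 1)} {v : Fin n → G → Euc (n + 1)} (hw : ContinuousOn w s)
    (hv : ∀ i, ContinuousOn (v i) s) :
    ContinuousOn (fun t => frameDet (w t) (fun i => v i t)) s := by
  have : (fun t => frameDet (w t) (fun i => v i t)) =
      (detCMM n) ∘ fun t => (Fin.cons (w t) fun i => v i t) := rfl
  rw [this]
  refine (detCMM n).cont.comp_continuousOn ?_
  rw [continuousOn_pi]
  exact Fin.cases hw hv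

/-- Change of basis for the determinant of the images of a basis. -/
lemma frameDet_comp_basis {T : Type*} [AddCommGroup T] [Module ℝ T]
    (e : Module.Basis (Fin n) ℝ T) (A : T →ₗ[ℝ] Euc (n + 1)) (w : Euc (n + 1)) (b : Fin n → T) :
    frameDet w (fun j => A (b j)) = frameDet w (fun j => A (e j)) * e.det b := by
  have h := AlternatingMap.congr_fun
    (((frameForm w).compLinearMap A).eq_smul_basis_det e) b
  simpa [AlternatingMap.compLinearMap_apply, frameForm_apply, Function.comp_def] using h

/-- The derivative at `t = 0` of `frameDet_comp_basis` applied to the linear map `A + t B`. -/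
lemma frameDet_deriv_comp_basis {T : Type*} [AddCommGroup T] [Module ℝ T]
    (e : Module.Basis (Fin n) ℝ T) (A B : T →ₗ[ℝ] Euc (n + 1)) (w : Euc (n + 1)) (b : Fin n → T) :
    ∑ i, frameDet w (Function.update (fun j => A (b j)) i (B (b i))) =
      (∑ i, frameDet w (Function.update (fun j => A (e j)) i (B (e i)))) * e.det b := by
  have key : ∀ c : Fin n → T, HasDerivAt (fun t : ℝ => frameDet w (fun j => (A + t • B) (c j)))
      (∑ i, frameDet w (Function.update (fun j => A (c j)) i (B (c i)))) 0 := by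
    intro c
    have h := hasDerivAt_frameDet (hasDerivAt_const (0 : ℝ) w)
      (v := fun j t => (A + t • B) (c j)) (v' := fun j => B (c j)) (x := 0) (fun i => by
        have : HasDerivAt (fun t : ℝ => A (c i) + t • B (c i)) (B (c i)) 0 := by
          simpa using ((hasDerivAt_id (0 : ℝ)).smul_const (B (c i))).const_add (A (c i))
        simpa using this)
    have h0 : frameDet (0 : Euc (n + 1)) (fun i => (A + (0 : ℝ) • B) (c i)) = 0 := by
      simpa using frameDet_smul_left 0 (0 : Euc (n + 1)) (fun i => (A + (0 : ℝ) • B) (c i))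
    rw [h0, zero_add] at h
    simpa using h
  have h1 := (key e).mul_const (e.det b)
  have h2 := key b
  simp only [frameDet_comp_basis e _ w b] at h2
  exact h2.unique h1

end FrameDet

/-! ### The positively homogeneous extension of `γ` -/

section HomExtension

variable {n : ℕ}

/-- The positively homogeneous extension of degree one of `γ : Sⁿ → ℝ`. -/
def homExt (γ : Sph n → ℝ) (z : Euc (n + 1)) : ℝ := ‖z‖ * radialExtension γ z

lemma norm_coe_sph (ν : Sph n) : ‖(ν : Euc (n + 1))‖ = 1 := norm_eq_of_mem_sphere ν

lemma coe_sph_ne_zero (ν : Sph n) : (ν : Euc (n + 1)) ≠ 0 := ne_zero_of_mem_unit_sphere ν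

lemma radialExtension_coe (γ : Sph n → ℝ) (ν : Sph n) : radialExtension γ ν = γ ν := by
  rw [radialExtension, dif_neg (coe_sph_ne_zero ν)]
  congr 1
  ext1
  simp [norm_coe_sph ν]

lemma radialExtension_smul (γ : Sph n → ℝ) {c : ℝ} (hc : 0 < c) (z : Euc (n + 1)) :
    radialExtension γ (c • z) = radialExtension γ z := by
  by_cases hz : z = 0
  · simp [hz]
  · rw [radialExtension, radialExtension, dif_neg hz, dif_neg (smul_ne_zero hc.ne' hz)]
    congr 2
    rw [norm_smul, Real.norm_of_nonneg hc.le, smul_smul]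
    congr 1
    field_simp

lemma homExt_smul (γ : Sph n → ℝ) {c : ℝ} (hc : 0 < c) (z : Euc (n + 1)) :
    homExt γ (c • z) = c * homExt γ z := by
  rw [homExt, homExt, radialExtension_smul γ hc, norm_smul, Real.norm_of_nonneg hc.le, mul_assoc]

lemma homExt_coe (γ : Sph n → ℝ) (ν : Sph n) : homExt γ ν = γ ν := by
  rw [homExt, norm_coe_sph, one_mul, radialExtension_coe]

/-- On the open submanifold `ℝⁿ⁺¹ ∖ {0}` this is `γ` composed with the normalization `x ↦ x / ‖x‖`,
a smooth map into the sphere. -/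
lemma contDiffAt_radialExtension {γ : Sph n → ℝ} {k : WithTop ℕ∞}
    (hγ : ContMDiff (𝓡 n) 𝓘(ℝ, ℝ) k γ) {z : Euc (n + 1)} (hz : z ≠ 0) :
    ContDiffAt ℝ k (radialExtension γ) z := by
  let U : TopologicalSpace.Opens (Euc (n + 1)) := ⟨{0}ᶜ, isOpen_compl_singleton⟩
  let f : U → Euc (n + 1) := fun x => ‖(x : Euc (n + 1))‖⁻¹ • (x : Euc (n + 1))
  have hU : ∀ x : U, (x : Euc (n + 1)) ≠ 0 := fun x => x.2
  have hf : ContMDiff 𝓘(ℝ, Euc (n + 1)) 𝓘(ℝ, Euc (n + 1)) k f := by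
    intro x
    have : ContMDiffAt 𝓘(ℝ, Euc (n + 1)) 𝓘(ℝ, Euc (n + 1)) k
        (fun y : Euc (n + 1) => ‖y‖⁻¹ • y) (x : Euc (n + 1)) :=
      (((contDiffAt_norm ℝ (hU x)).inv (norm_ne_zero_iff.mpr (hU x))).smul
        contDiffAt_id).contMDiffAt
    exact contMDiffAt_subtype_iff.mpr this
  have hf' : ∀ x, f x ∈ sphere (0 : Euc (n + 1)) 1 := by
    intro x
    rw [mem_sphere_zero_iff_norm, norm_smul, norm_inv, norm_norm,
      inv_mul_cancel₀ (norm_ne_zero_iff.mpr (hU x))]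
  have := Fact.mk (finrank_euclideanSpace_fin (𝕜 := ℝ) (n := n + 1))
  have h := hγ.comp (hf.codRestrict_sphere (n := n) hf')
  have h2 := h ⟨z, hz⟩
  have h3 : (γ ∘ Set.codRestrict f (sphere (0 : Euc (n + 1)) 1) hf') =
      fun x : U => radialExtension γ (x : Euc (n + 1)) := by
    ext x
    rw [radialExtension, dif_neg (hU x)]
    rfl
  rw [h3] at h2
  exact (contMDiffAt_subtype_iff (U := U) (x := ⟨z, hz⟩)).mp h2 |>.contDiffAt

lemma contDiffAt_homExt {γ : Sph n → ℝ} {k : WithTop ℕ∞}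
    (hγ : ContMDiff (𝓡 n) 𝓘(ℝ, ℝ) k γ) {z : Euc (n + 1)} (hz : z ≠ 0) :
    ContDiffAt ℝ k (homExt γ) z :=
  (contDiffAt_norm ℝ hz).mul (contDiffAt_radialExtension hγ hz)

lemma fderiv_norm_apply {z : Euc (n + 1)} (hz : ‖z‖ = 1) (w : Euc (n + 1)) :
    fderiv ℝ (fun y : Euc (n + 1) => ‖y‖) z w = ⟪z, w⟫ := by
  have hz0 : z ≠ 0 := by
    rintro rfl
    simp at hz
  have h1 := ((contDiffAt_norm (n := 1) ℝ hz0).differentiableAt one_ne_zero).hasFDerivAt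
  have h2 := (hasStrictFDerivAt_norm_sq z).hasFDerivAt
  have h3 := h2.unique (h1.pow 2)
  have h4 := congrArg (fun L : Euc (n + 1) →L[ℝ] ℝ => L w) h3
  simp [hz] at h4
  linarith

/-- Product rule for `‖z‖ * radialExtension γ z`: the second factor contributes `Dγ`, the norm
contributes `γ(ν) ν`. -/
lemma fderiv_homExt_coe {γ : Sph n → ℝ} (hγ : ContMDiff (𝓡 n) 𝓘(ℝ, ℝ) 1 γ) (ν : Sph n)
    (w : Euc (n + 1)) : fderiv ℝ (homExt γ) ν w = ⟪cahnHoffman γ ν, w⟫ := by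
  have hν := coe_sph_ne_zero ν
  have h1 := (contDiffAt_norm (n := 1) ℝ hν).differentiableAt one_ne_zero
  have h2 := (contDiffAt_radialExtension hγ hν).differentiableAt one_ne_zero
  have h3 : fderiv ℝ (homExt γ) (ν : Euc (n + 1)) = _ := (h1.hasFDerivAt.mul h2.hasFDerivAt).fderiv
  have h4 : ⟪sphereGradient γ ν, w⟫ = fderiv ℝ (radialExtension γ) ν w := by
    rw [sphereGradient, ← toDual_gradient]
    rfl
  rw [h3, cahnHoffman, inner_add_left, h4, real_inner_smul_left, norm_coe_sph,
    radialExtension_coe]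
  simp [fderiv_norm_apply (norm_coe_sph ν)]

/-- The derivative of a function homogeneous of degree one is homogeneous of degree zero. In a chart
the extension is evaluated at a positive multiple of the normal, not at the normal itself. -/
lemma fderiv_homExt_smul {γ : Sph n → ℝ} (hγ : ContMDiff (𝓡 n) 𝓘(ℝ, ℝ) 1 γ) (ν : Sph n)
    {c : ℝ} (hc : 0 < c) (w : Euc (n + 1)) :
    fderiv ℝ (homExt γ) (c • (ν : Euc (n + 1))) w = ⟪cahnHoffman γ ν, w⟫ := by
  have hν := coe_sph_ne_zero ν
  have h1 := ((contDiffAt_homExt hγ hν).differentiableAt one_ne_zero).hasFDerivAt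
  have h2 := ((contDiffAt_homExt hγ (smul_ne_zero hc.ne' hν)).differentiableAt
    one_ne_zero).hasFDerivAt
  have h3 : HasFDerivAt (fun z : Euc (n + 1) => homExt γ (c • z)) _ (ν : Euc (n + 1)) :=
    HasFDerivAt.comp (ν : Euc (n + 1)) h2 ((hasFDerivAt_id (ν : Euc (n + 1))).const_smul c)
  have h4 : (fun z : Euc (n + 1) => homExt γ (c • z)) = fun z => c * homExt γ z :=
    funext fun z => homExt_smul γ hc z
  rw [h4] at h3
  have h5 := congrArg (fun L : Euc (n + 1) →L[ℝ] ℝ => L w) (h3.unique (h1.const_mul c))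
  simp at h5
  rw [← fderiv_homExt_coe hγ]
  rcases h5 with h | h
  · exact h
  · exact absurd h hc.ne'

/-- Euler's relation: along the ray `t • ν`, `t > 0`, the homogeneous extension is linear in `t`. -/
lemma inner_cahnHoffman_self {γ : Sph n → ℝ} (hγ : ContMDiff (𝓡 n) 𝓘(ℝ, ℝ) 1 γ) (ν : Sph n) :
    ⟪cahnHoffman γ ν, (ν : Euc (n + 1))⟫ = γ ν := by
  have hν := coe_sph_ne_zero ν
  have h1 := ((contDiffAt_homExt hγ hν).differentiableAt one_ne_zero).hasFDerivAt
  have h2 : HasDerivAt (fun t : ℝ => t • (ν : Euc (n + 1))) ((1 : ℝ) • (ν : Euc (n + 1))) 1 :=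
    (hasDerivAt_id (1 : ℝ)).smul_const _
  have h3 : HasDerivAt (fun t : ℝ => homExt γ (t • (ν : Euc (n + 1))))
      (fderiv ℝ (homExt γ) ν ((1 : ℝ) • (ν : Euc (n + 1)))) 1 :=
    HasFDerivAt.comp_hasDerivAt (l := homExt γ) (l' := fderiv ℝ (homExt γ) ν)
      (1 : ℝ) (by rw [one_smul]; exact h1) h2
  have h4 : (fun t : ℝ => homExt γ (t • (ν : Euc (n + 1)))) =ᶠ[𝓝 1] fun t => t * γ ν := by
    filter_upwards [lt_mem_nhds (zero_lt_one (α := ℝ))] with t ht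
    rw [homExt_smul γ ht, homExt_coe]
  have h5 := (h3.congr_of_eventuallyEq h4.symm).unique ((hasDerivAt_id (1 : ℝ)).mul_const (γ ν))
  rw [one_smul, one_mul, fderiv_homExt_coe hγ] at h5
  exact h5

/-- The gradient of the homogeneous extension of `γ`; on the sphere it is the Cahn-Hoffman map. -/
lemma gradient_homExt_coe {γ : Sph n → ℝ} (hγ : ContMDiff (𝓡 n) 𝓘(ℝ, ℝ) 1 γ) (ν : Sph n) :
    gradient (homExt γ) (ν : Euc (n + 1)) = cahnHoffman γ ν := by
  refine ext_inner_right ℝ fun w => ?_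
  rw [← fderiv_homExt_coe hγ, ← toDual_gradient]
  rfl

/-- The `C²` regularity of `γ` is spent here: it makes the Cahn-Hoffman map `C¹`, so that
integration by parts can differentiate `ξ̃`. -/
lemma contDiffAt_gradient_homExt {γ : Sph n → ℝ} (hγ : ContMDiff (𝓡 n) 𝓘(ℝ, ℝ) 2 γ)
    {z : Euc (n + 1)} (hz : z ≠ 0) : ContDiffAt ℝ 1 (gradient (homExt γ)) z := by
  have h : ContDiffAt ℝ 1 (fderiv ℝ (homExt γ)) z :=
    (contDiffAt_homExt hγ hz).fderiv_right (by norm_num)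
  exact (InnerProductSpace.toDual ℝ
    (Euc (n + 1))).symm.toContinuousLinearEquiv.contDiff.contDiffAt.comp z h

lemma norm_cahnHoffman_bdd {γ : Sph n → ℝ} (hγ : ContMDiff (𝓡 n) 𝓘(ℝ, ℝ) 2 γ) :
    ∃ C : ℝ, 0 ≤ C ∧ ∀ ν : Sph n, ‖cahnHoffman γ ν‖ ≤ C := by
  have hc : Continuous (cahnHoffman γ) := by
    rw [continuous_iff_continuousAt]
    intro ν
    have h := (contDiffAt_gradient_homExt hγ (coe_sph_ne_zero ν)).continuousAt
    have h2 : cahnHoffman γ = gradient (homExt γ) ∘ fun ν : Sph n => (ν : Euc (n + 1)) :=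
      funext fun ν => (gradient_homExt_coe (hγ.of_le (by norm_num)) ν).symm
    rw [h2]
    exact ContinuousAt.comp h continuous_subtype_val.continuousAt
  obtain ⟨C, hC⟩ := (isCompact_range hc).isBounded.exists_norm_le
  exact ⟨max C 0, le_max_right _ _, fun ν => (hC _ (mem_range_self ν)).trans (le_max_left _ _)⟩

end HomExtension

/-! ### Push-forwards of densities under charts -/

section DensityChart

variable {E M : Type*} [TopologicalSpace E] [MeasureSpace E] [BorelSpace E]
  [SFinite (volume : Measure E)]
  [TopologicalSpace M] [MeasurableSpace M] [BorelSpace M]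

/-- The push-forward under `i` of the measure with density `d` on `T`. -/
def densityMap (i : E → M) (T : Set E) (d : E → ℝ) : Measure M :=
  Measure.map i ((volume.restrict T).withDensity fun u => ENNReal.ofReal (d u))

/-- `i : T → S` is a homeomorphism between measurable sets with inverse `j`, and `d` is a
nonnegative density, continuous on `T`. -/
structure IsDensityChart (i : E → M) (j : M → E) (T : Set E) (S : Set M) (d : E → ℝ) : Prop where
  measurableSet_domain : MeasurableSet T
  measurableSet_image : MeasurableSet S
  mapsTo : MapsTo i T S
  mapsTo_inv : MapsTo j S T
  left_inv : ∀ u ∈ T, j (i u) = u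
  right_inv : ∀ p ∈ S, i (j p) = p
  continuousOn : ContinuousOn i T
  continuousOn_inv : ContinuousOn j S
  continuousOn_density : ContinuousOn d T
  nonneg : ∀ u, 0 ≤ d u

lemma _root_.ContinuousOn.measurableSet_inter_preimage' {X Y : Type*} [TopologicalSpace X]
    [MeasurableSpace X] [BorelSpace X] [TopologicalSpace Y] [MeasurableSpace Y] [BorelSpace Y]
    {f : X → Y} {s : Set X} (hf : ContinuousOn f s) (hs : MeasurableSet s) {B : Set Y}
    (hB : MeasurableSet B) : MeasurableSet (s ∩ f ⁻¹' B) := by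
  have h1 : Measurable (s.domRestrict f) := (continuousOn_iff_continuous_domRestrict.mp hf).measurable
  have h2 := hs.subtype_image (h1 hB)
  convert h2 using 1
  ext x
  simp [Set.domRestrict_apply, and_comm]

namespace IsDensityChart

variable {i : E → M} {j : M → E} {T : Set E} {S : Set M} {d : E → ℝ}

lemma aemeasurable_ofReal (h : IsDensityChart i j T S d) :
    AEMeasurable (fun u => ENNReal.ofReal (d u)) (volume.restrict T) :=
  (h.continuousOn_density.aemeasurable h.measurableSet_domain).ennreal_ofReal

lemma aemeasurable (h : IsDensityChart i j T S d) :
    AEMeasurable i ((volume.restrict T).withDensity fun u => ENNReal.ofReal (d u)) :=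
  (h.continuousOn.aemeasurable h.measurableSet_domain).mono_ac (withDensity_absolutelyContinuous _ _)

lemma densityMap_apply (h : IsDensityChart i j T S d) {B : Set M} (hB : MeasurableSet B) :
    densityMap i T d B = ∫⁻ u in T ∩ i ⁻¹' B, ENNReal.ofReal (d u) := by
  rw [densityMap, Measure.map_apply_of_aemeasurable h.aemeasurable hB, withDensity_apply',
    Measure.restrict_restrict' h.measurableSet_domain, inter_comm]

lemma densityMap_compl (h : IsDensityChart i j T S d) : densityMap i T d Sᶜ = 0 := by
  rw [h.densityMap_apply h.measurableSet_image.compl]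
  have : T ∩ i ⁻¹' Sᶜ = ∅ := by
    ext u
    simp only [mem_inter_iff, mem_preimage, mem_compl_iff, mem_empty_iff_false, iff_false, not_and,
      not_not]
    exact fun hu => h.mapsTo hu
  rw [this, Measure.restrict_empty, lintegral_zero_measure]

lemma ae_mem_domain (h : IsDensityChart i j T S d) :
    ∀ᵐ u ∂((volume.restrict T).withDensity fun u => ENNReal.ofReal (d u)), u ∈ T :=
  (withDensity_absolutelyContinuous _ _) (ae_restrict_mem h.measurableSet_domain)

lemma ae_mem_image (h : IsDensityChart i j T S d) : ∀ᵐ p ∂(densityMap i T d), p ∈ S := by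
  rw [ae_iff]
  exact h.densityMap_compl

/-- Almost everywhere for the push-forward, `f = (f ∘ i) ∘ j`, and `j` carries the push-forward back
to the measure on `T`. Hence measurability only has to be checked in the chart. -/
lemma aestronglyMeasurable (h : IsDensityChart i j T S d) {f : M → ℝ}
    (hf : AEStronglyMeasurable (fun u => f (i u))
      ((volume.restrict T).withDensity fun u => ENNReal.ofReal (d u))) :
    AEStronglyMeasurable f (densityMap i T d) := by
  have hj : AEMeasurable j (densityMap i T d) := by
    have h1 : (densityMap i T d).restrict S = densityMap i T d :=
      Measure.restrict_eq_self_of_ae_mem h.ae_mem_image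
    rw [← h1]
    exact h.continuousOn_inv.aemeasurable h.measurableSet_image
  have hmap : Measure.map j (densityMap i T d) =
      (volume.restrict T).withDensity fun u => ENNReal.ofReal (d u) := by
    rw [densityMap, AEMeasurable.map_map_of_aemeasurable (by exact hj) h.aemeasurable]
    conv_rhs => rw [← Measure.map_id (μ := (volume.restrict T).withDensity _)]
    refine Measure.map_congr ?_
    filter_upwards [h.ae_mem_domain] with u hu
    exact h.left_inv u hu
  have h2 : AEStronglyMeasurable ((fun u => f (i u)) ∘ j) (densityMap i T d) :=
    AEStronglyMeasurable.comp_aemeasurable (by rw [hmap]; exact hf) hj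
  refine h2.congr ?_
  filter_upwards [h.ae_mem_image] with p hp
  simp [h.right_inv p hp]

lemma integrable_iff_aux (h : IsDensityChart i j T S d) (g : E → ℝ) :
    Integrable g ((volume.restrict T).withDensity fun u => ENNReal.ofReal (d u)) ↔
      IntegrableOn (fun u => d u * g u) T := by
  rw [integrable_withDensity_iff_integrable_smul₀' h.aemeasurable_ofReal (by simp)]
  simp only [ENNReal.toReal_ofReal (h.nonneg _), smul_eq_mul]
  rfl

lemma integrable (h : IsDensityChart i j T S d) {f : M → ℝ}
    (hf : IntegrableOn (fun u => d u * f (i u)) T) : Integrable f (densityMap i T d) := by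
  have h1 := (h.integrable_iff_aux (fun u => f (i u))).mpr hf
  exact (integrable_map_measure (h.aestronglyMeasurable h1.aestronglyMeasurable)
    h.aemeasurable).mpr h1

lemma integral_eq (h : IsDensityChart i j T S d) {f : M → ℝ}
    (hf : IntegrableOn (fun u => d u * f (i u)) T) :
    ∫ p, f p ∂(densityMap i T d) = ∫ u in T, d u * f (i u) := by
  have h1 := (h.integrable_iff_aux (fun u => f (i u))).mpr hf
  rw [densityMap, integral_map h.aemeasurable (h.aestronglyMeasurable h1.aestronglyMeasurable)]
  have := integral_withDensity_eq_integral_smul₀ (μ := volume.restrict T)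
    (f := fun u => Real.toNNReal (d u))
    (h.continuousOn_density.aemeasurable h.measurableSet_domain).real_toNNReal (fun u => f (i u))
  refine this.trans ?_
  simp only [NNReal.smul_def, Real.coe_toNNReal _ (h.nonneg _), smul_eq_mul]

end IsDensityChart

/-- Two densities which transform by the Jacobian of the change of charts induce the same measure
where both charts are defined. -/
lemma densityMap_eq_of_chartChange {E : Type*} [NormedAddCommGroup E] [NormedSpace ℝ E]
    [FiniteDimensional ℝ E] [MeasureSpace E] [BorelSpace E] [(volume : Measure E).IsAddHaarMeasure]
    {i i' : E → M} {j j' : M → E} {T T' : Set E} {S S' : Set M} {d d' : E → ℝ}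
    (h : IsDensityChart i j T S d) (h' : IsDensityChart i' j' T' S' d')
    (D : E → E →L[ℝ] E)
    (hD : ∀ u ∈ T, i u ∈ S' → HasFDerivWithinAt (fun u => j' (i u)) (D u) (T ∩ i ⁻¹' S') u)
    (hd : ∀ u ∈ T, i u ∈ S' → d u = |(D u).det| * d' (j' (i u)))
    {B : Set M} (hB : MeasurableSet B) (hBS : B ⊆ S ∩ S') :
    densityMap i T d B = densityMap i' T' d' B := by
  rw [h.densityMap_apply hB, h'.densityMap_apply hB]
  -- The chart change maps one coordinate image of `B` onto the other, so the claim is the change of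
  -- variables formula.
  have himg : T' ∩ i' ⁻¹' B = (fun u => j' (i u)) '' (T ∩ i ⁻¹' B) := by
    ext u'
    constructor
    · rintro ⟨hu', hB'⟩
      have hS := hBS hB'
      refine ⟨j (i' u'), ⟨h.mapsTo_inv hS.1, ?_⟩, ?_⟩
      · simpa [h.right_inv _ hS.1] using hB'
      · simp [h.right_inv _ hS.1, h'.left_inv u' hu']
    · rintro ⟨u, ⟨hu, huB⟩, rfl⟩
      have hS := hBS huB
      refine ⟨h'.mapsTo_inv hS.2, ?_⟩
      simpa [h'.right_inv _ hS.2] using huB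
  have hmeas := h.continuousOn.measurableSet_inter_preimage' h.measurableSet_domain hB
  have hinj : InjOn (fun u => j' (i u)) (T ∩ i ⁻¹' B) := by
    intro u hu v hv huv
    have h1 := congrArg i' huv
    simp only [h'.right_inv _ (hBS hu.2).2, h'.right_inv _ (hBS hv.2).2] at h1
    rw [← h.left_inv u hu.1, ← h.left_inv v hv.1, h1]
  rw [himg, lintegral_image_eq_lintegral_abs_det_fderiv_mul volume hmeas
    (fun u hu => (hD u hu.1 (hBS hu.2).2).mono fun v hv => ⟨hv.1, (hBS hv.2).2⟩) hinj]
  refine setLIntegral_congr_fun hmeas fun u hu => ?_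
  rw [hd u hu.1 (hBS hu.2).2, ENNReal.ofReal_mul (abs_nonneg _)]

/-- The supremum of a family of measures carried by sets `S c`, which agree where two of these sets
overlap, coincides with each of the measures on its set. -/
lemma iSup_measure_restrict {M ι : Type*} [MeasurableSpace M] {μ : ι → Measure M} {S : ι → Set M}
    (hS : ∀ c, MeasurableSet (S c)) (h0 : ∀ c, μ c (S c)ᶜ = 0)
    (hcompat : ∀ c d B, MeasurableSet B → B ⊆ S c ∩ S d → μ c B = μ d B) (c : ι) :
    (⨆ d, μ d).restrict (S c) = μ c := by
  -- It suffices to bound each `μ d` by this sum: on `S c` it is at most `μ c` by compatibility, and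
  -- off `S c` it is at most the supremum itself.
  have hle : (⨆ d, μ d) ≤ μ c + (⨆ d, μ d).restrict (S c)ᶜ := by
    refine iSup_le fun d => Measure.le_iff.mpr fun B hB => ?_
    rw [← measure_inter_add_sdiff B (hS c), Measure.add_apply]
    refine add_le_add ?_ ?_
    · have h1 : μ d (B ∩ S c) = μ d (B ∩ S c ∩ S d) := by
        rw [← measure_inter_add_sdiff (B ∩ S c) (hS d)]
        have : μ d ((B ∩ S c) \ S d) = 0 := measure_mono_null (fun x hx => hx.2) (h0 d)
        rw [this, add_zero]
      rw [h1, hcompat d c _ ((hB.inter (hS c)).inter (hS d)) (fun x hx => ⟨hx.2, hx.1.2⟩)]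
      exact measure_mono fun x hx => hx.1.1
    · rw [Measure.restrict_apply hB]
      exact Measure.le_iff.mp (le_iSup μ d) _ (hB.inter (hS c).compl)
  refine le_antisymm ?_ ?_
  · calc (⨆ d, μ d).restrict (S c) ≤ (μ c + (⨆ d, μ d).restrict (S c)ᶜ).restrict (S c) :=
          Measure.restrict_mono subset_rfl hle
      _ = (μ c).restrict (S c) := by
          rw [Measure.restrict_add, Measure.restrict_restrict (hS c)]
          simp
      _ ≤ μ c := Measure.restrict_le_self
  · have h1 : (μ c).restrict (S c) = μ c :=
      Measure.restrict_eq_self_of_ae_mem (by rw [ae_iff]; exact h0 c)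
    rw [← h1]
    exact Measure.restrict_mono subset_rfl (le_iSup μ c)

end DensityChart

/-! ### Charts of a manifold with boundary -/

section Charts

variable {m : ℕ} {M : Type*} [TopologicalSpace M] [ChartedSpace (EuclideanHalfSpace (m + 1)) M]

/-- The target is relatively open in the half-space, and a neighbourhood within the half-space is a
full neighbourhood once `0 < u 0`. -/
lemma mem_interior_extChartAt_target_iff {c : M} {u : Euc (m + 1)}
    (hu : u ∈ (extChartAt (𝓡∂ (m + 1)) c).target) :
    u ∈ interior (extChartAt (𝓡∂ (m + 1)) c).target ↔ 0 < u 0 := by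
  have h1 := interior_range_modelWithCornersEuclideanHalfSpace (m + 1)
  have h2 : 0 < u 0 ↔ u ∈ interior (range (𝓡∂ (m + 1))) := by rw [h1]; rfl
  rw [h2]
  refine ⟨fun h => interior_mono (extChartAt_target_subset_range c) h, fun h => ?_⟩
  have h3 := extChartAt_target_mem_nhdsWithin_of_mem hu
  rw [nhdsWithin_eq_nhds.mpr (mem_interior_iff_mem_nhds.mp h)] at h3
  exact mem_interior_iff_mem_nhds.mpr h3

lemma zero_le_of_mem_extChartAt_target {c : M} {u : Euc (m + 1)}
    (hu : u ∈ (extChartAt (𝓡∂ (m + 1)) c).target) : 0 ≤ u 0 := by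
  have h := extChartAt_target_subset_range c hu
  rw [range_modelWithCornersEuclideanHalfSpace] at h
  exact h

lemma measurableSet_extChartAt_target (c : M) :
    MeasurableSet (extChartAt (𝓡∂ (m + 1)) c).target := by
  rw [extChartAt_target]
  exact (((chartAt _ c).open_target.preimage (𝓡∂ (m + 1)).continuous_symm).measurableSet).inter
    (𝓡∂ (m + 1)).isClosed_range.measurableSet

variable [IsManifold (𝓡∂ (m + 1)) ∞ M]

lemma mem_interior_iff_extChartAt {c z : M} (hz : z ∈ (extChartAt (𝓡∂ (m + 1)) c).source) :
    z ∈ (𝓡∂ (m + 1)).interior M ↔ 0 < extChartAt (𝓡∂ (m + 1)) c z 0 := by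
  have h := (𝓡∂ (m + 1)).isInteriorPoint_iff_of_mem_atlas (n := ∞) (by simp)
    (chart_mem_atlas _ c) (x := z) (by rwa [extChartAt_source] at hz)
  exact h.trans (mem_interior_extChartAt_target_iff ((extChartAt (𝓡∂ (m + 1)) c).map_source hz))

lemma mem_interior_symm_iff {c : M} {u : Euc (m + 1)}
    (hu : u ∈ (extChartAt (𝓡∂ (m + 1)) c).target) :
    (extChartAt (𝓡∂ (m + 1)) c).symm u ∈ (𝓡∂ (m + 1)).interior M ↔ 0 < u 0 := by
  rw [mem_interior_iff_extChartAt ((extChartAt (𝓡∂ (m + 1)) c).map_target hu),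
    (extChartAt (𝓡∂ (m + 1)) c).right_inv hu]

/-- Being an interior point does not depend on the chart, and chart values lie in the half-space. -/
lemma extChartAt_zero_eq_zero_iff {c d z : M} (hc : z ∈ (extChartAt (𝓡∂ (m + 1)) c).source)
    (hd : z ∈ (extChartAt (𝓡∂ (m + 1)) d).source) :
    extChartAt (𝓡∂ (m + 1)) c z 0 = 0 ↔ extChartAt (𝓡∂ (m + 1)) d z 0 = 0 := by
  have h := (mem_interior_iff_extChartAt hc).symm.trans (mem_interior_iff_extChartAt hd)
  have h1 := zero_le_of_mem_extChartAt_target ((extChartAt (𝓡∂ (m + 1)) c).map_source hc)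
  have h2 := zero_le_of_mem_extChartAt_target ((extChartAt (𝓡∂ (m + 1)) d).map_source hd)
  constructor
  · intro h3
    exact le_antisymm (not_lt.mp fun h4 => (h.mpr h4).ne' h3) h2
  · intro h3
    exact le_antisymm (not_lt.mp fun h4 => (h.mp h4).ne' h3) h1

/-- The derivative of a map on `M` in the chart at `c`. -/
def chartDeriv {F : Type*} [NormedAddCommGroup F] [NormedSpace ℝ F] (f : M → F) (c : M)
    (u : Euc (m + 1)) : Euc (m + 1) →L[ℝ] F :=
  fderivWithin ℝ (f ∘ (extChartAt (𝓡∂ (m + 1)) c).symm) (range (𝓡∂ (m + 1))) u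

lemma coordDeriv_eq (X : M → Euc (m + 1 + 1)) (c : M) (u : Euc (m + 1)) (i : Fin (m + 1)) :
    coordDeriv X c u i = chartDeriv X c u (EuclideanSpace.single i 1) := rfl

section ChartDeriv

variable {F : Type*} [NormedAddCommGroup F] [NormedSpace ℝ F] {f : M → F}

lemma contDiffOn_comp_symm {k : WithTop ℕ∞} (hk : k ≤ ∞)
    (hf : ContMDiff (𝓡∂ (m + 1)) 𝓘(ℝ, F) k f) (c : M) :
    ContDiffOn ℝ k (f ∘ (extChartAt (𝓡∂ (m + 1)) c).symm) (extChartAt (𝓡∂ (m + 1)) c).target := by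
  have : IsManifold (𝓡∂ (m + 1)) k M := IsManifold.of_le hk
  exact (hf.comp_contMDiffOn (contMDiffOn_extChartAt_symm c)).contDiffOn

lemma hasFDerivWithinAt_chartDeriv {c : M} {u : Euc (m + 1)}
    (hu : u ∈ (extChartAt (𝓡∂ (m + 1)) c).target)
    (hf : ContDiffOn ℝ 1 (f ∘ (extChartAt (𝓡∂ (m + 1)) c).symm)
      (extChartAt (𝓡∂ (m + 1)) c).target) :
    HasFDerivWithinAt (f ∘ (extChartAt (𝓡∂ (m + 1)) c).symm) (chartDeriv f c u)
      (range (𝓡∂ (m + 1))) u := by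
  have h1 := hf.differentiableOn one_ne_zero u hu
  have h2 : DifferentiableWithinAt ℝ (f ∘ (extChartAt (𝓡∂ (m + 1)) c).symm)
      (range (𝓡∂ (m + 1))) u :=
    h1.mono_of_mem_nhdsWithin (extChartAt_target_mem_nhdsWithin_of_mem hu)
  exact h2.hasFDerivWithinAt

lemma fderivWithin_target_eq {c : M} {u : Euc (m + 1)}
    (hu : u ∈ (extChartAt (𝓡∂ (m + 1)) c).target) :
    fderivWithin ℝ (f ∘ (extChartAt (𝓡∂ (m + 1)) c).symm) (extChartAt (𝓡∂ (m + 1)) c).target u =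
      chartDeriv f c u := by
  refine fderivWithin_congr_set' u ?_ |>.trans rfl
  exact (extChartAt_target_eventuallyEq_of_mem hu).filter_mono nhdsWithin_le_nhds

lemma contDiffOn_chartDeriv {k l : WithTop ℕ∞} (hl : l + 1 ≤ k) {c : M}
    (hf : ContDiffOn ℝ k (f ∘ (extChartAt (𝓡∂ (m + 1)) c).symm)
      (extChartAt (𝓡∂ (m + 1)) c).target) :
    ContDiffOn ℝ l (chartDeriv f c) (extChartAt (𝓡∂ (m + 1)) c).target :=
  (hf.fderivWithin (uniqueDiffOn_extChartAt_target c) hl).congr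
    fun _ hu => (fderivWithin_target_eq hu).symm

/-- Transformation of the derivative of a map under a change of charts. -/
lemma chartDeriv_eq_comp {c d z : M} (hc : z ∈ (extChartAt (𝓡∂ (m + 1)) c).source)
    (hd : z ∈ (extChartAt (𝓡∂ (m + 1)) d).source)
    (hf : ContDiffOn ℝ 1 (f ∘ (extChartAt (𝓡∂ (m + 1)) d).symm)
      (extChartAt (𝓡∂ (m + 1)) d).target) :
    chartDeriv f c (extChartAt (𝓡∂ (m + 1)) c z) =
      (chartDeriv f d (extChartAt (𝓡∂ (m + 1)) d z)).comp
        (tangentCoordChange (𝓡∂ (m + 1)) c d z) := by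
  have h1 := hasFDerivWithinAt_tangentCoordChange (I := 𝓡∂ (m + 1)) ⟨hc, hd⟩
  have h2 := hasFDerivWithinAt_chartDeriv ((extChartAt (𝓡∂ (m + 1)) d).map_source hd) hf
  have hz : ((extChartAt (𝓡∂ (m + 1)) d) ∘ (extChartAt (𝓡∂ (m + 1)) c).symm)
      (extChartAt (𝓡∂ (m + 1)) c z) = extChartAt (𝓡∂ (m + 1)) d z := by
    rw [Function.comp_apply, (extChartAt (𝓡∂ (m + 1)) c).left_inv hc]
  rw [← hz] at h2
  have h3 := h2.comp_of_tendsto (extChartAt (𝓡∂ (m + 1)) c z) h1 ?_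
  · have hu := (extChartAt (𝓡∂ (m + 1)) c).map_source hc
    rw [hz] at h3
    refine HasFDerivWithinAt.fderivWithin (h3.congr_of_eventuallyEq ?_ ?_)
      ((𝓡∂ (m + 1)).uniqueDiffOn _ (extChartAt_target_subset_range c hu))
    · have h4 : (extChartAt (𝓡∂ (m + 1)) c).symm ⁻¹' (extChartAt (𝓡∂ (m + 1)) d).source ∈
          𝓝[range (𝓡∂ (m + 1))] (extChartAt (𝓡∂ (m + 1)) c z) := by
        have h5 : ContinuousWithinAt (extChartAt (𝓡∂ (m + 1)) c).symm (range (𝓡∂ (m + 1)))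
            (extChartAt (𝓡∂ (m + 1)) c z) :=
          (continuousAt_extChartAt_symm' hc).continuousWithinAt
        refine h5.preimage_mem_nhdsWithin ?_
        rw [(extChartAt (𝓡∂ (m + 1)) c).left_inv hc]
        exact (isOpen_extChartAt_source d).mem_nhds hd
      filter_upwards [h4] with v hv
      simp only [Function.comp_apply]
      rw [(extChartAt (𝓡∂ (m + 1)) d).left_inv hv]
    · simp only [Function.comp_apply]
      rw [(extChartAt (𝓡∂ (m + 1)) c).left_inv hc, (extChartAt (𝓡∂ (m + 1)) d).left_inv hd]
  · refine tendsto_nhdsWithin_iff.mpr ⟨h1.continuousWithinAt, ?_⟩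
    refine Filter.Eventually.of_forall fun v => ?_
    simp only [Function.comp_apply, extChartAt_coe]
    exact mem_range_self _

lemma mvfderiv_eq_chartDeriv (hf : MDifferentiable (𝓡∂ (m + 1)) 𝓘(ℝ, F) f) (z : M)
    (v : TangentSpace (𝓡∂ (m + 1)) z) :
    mvfderiv (𝓡∂ (m + 1)) f z v = chartDeriv f z (extChartAt (𝓡∂ (m + 1)) z z) v := by
  rw [(hf z).mvfderiv]
  rfl

end ChartDeriv

/-- The coordinate changes of the tangent bundle preserve inward-pointing directions of the
half-space at boundary points. -/
lemma tangentCoordChange_zero_nonneg {c d z : M} (hc : z ∈ (extChartAt (𝓡∂ (m + 1)) c).source)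
    (hd : z ∈ (extChartAt (𝓡∂ (m + 1)) d).source) (h0 : extChartAt (𝓡∂ (m + 1)) c z 0 = 0)
    {v : Euc (m + 1)} (hv : 0 ≤ v 0) : 0 ≤ tangentCoordChange (𝓡∂ (m + 1)) c d z v 0 := by
  have h1 := hasFDerivWithinAt_tangentCoordChange (I := 𝓡∂ (m + 1)) ⟨hc, hd⟩
  have h2 : HasFDerivWithinAt (fun u => ((extChartAt (𝓡∂ (m + 1)) d) ∘
      (extChartAt (𝓡∂ (m + 1)) c).symm) u 0) _ (range (𝓡∂ (m + 1)))
      (extChartAt (𝓡∂ (m + 1)) c z) :=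
    (EuclideanSpace.proj (𝕜 := ℝ) (0 : Fin (m + 1))).hasFDerivAt.comp_hasFDerivWithinAt
      _ h1
  -- The transition map takes values in the half-space and sends this boundary point to the
  -- boundary, so its zeroth coordinate is minimal there. Its derivative is then nonnegative on the
  -- tangent cone.
  have hmin : IsMinOn (fun u => ((extChartAt (𝓡∂ (m + 1)) d) ∘
      (extChartAt (𝓡∂ (m + 1)) c).symm) u 0) (range (𝓡∂ (m + 1)))
      (extChartAt (𝓡∂ (m + 1)) c z) := by
    intro u _
    simp only [mem_ofPred_eq, Function.comp_apply, (extChartAt (𝓡∂ (m + 1)) c).left_inv hc]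
    rw [(extChartAt_zero_eq_zero_iff hc hd).mp h0]
    rw [extChartAt_coe]
    exact ((chartAt (EuclideanHalfSpace (m + 1)) d) _).2
  have hcone : v ∈ posTangentConeAt (range (𝓡∂ (m + 1))) (extChartAt (𝓡∂ (m + 1)) c z) := by
    refine mem_posTangentConeAt_of_segment_subset ?_
    rw [range_modelWithCornersEuclideanHalfSpace]
    have hconv : Convex ℝ {y : Euc (m + 1) | 0 ≤ y 0} := by
      have := (𝓡∂ (m + 1)).convex_range
      rwa [range_modelWithCornersEuclideanHalfSpace] at this
    refine hconv.segment_subset ?_ ?_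
    · exact h0.ge
    · change 0 ≤ (extChartAt (𝓡∂ (m + 1)) c z + v) 0
      rw [PiLp.add_apply, h0, zero_add]
      exact hv
  exact hmin.localize.hasFDerivWithinAt_nonneg h2 hcone

/-- The inequality applies to both `v` and `-v`. -/
lemma tangentCoordChange_zero_eq_zero {c d z : M} (hc : z ∈ (extChartAt (𝓡∂ (m + 1)) c).source)
    (hd : z ∈ (extChartAt (𝓡∂ (m + 1)) d).source) (h0 : extChartAt (𝓡∂ (m + 1)) c z 0 = 0)
    {v : Euc (m + 1)} (hv : v 0 = 0) : tangentCoordChange (𝓡∂ (m + 1)) c d z v 0 = 0 := by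
  refine le_antisymm ?_ (tangentCoordChange_zero_nonneg hc hd h0 hv.ge)
  have := tangentCoordChange_zero_nonneg hc hd h0 (v := -v) (by simp [hv])
  rw [map_neg, PiLp.neg_apply] at this
  linarith

/-- A vanishing component would be carried back to a vanishing one by the inverse coordinate change.
-/
lemma tangentCoordChange_zero_pos {c d z : M} (hc : z ∈ (extChartAt (𝓡∂ (m + 1)) c).source)
    (hd : z ∈ (extChartAt (𝓡∂ (m + 1)) d).source) (h0 : extChartAt (𝓡∂ (m + 1)) c z 0 = 0)
    {v : Euc (m + 1)} (hv : 0 < v 0) : 0 < tangentCoordChange (𝓡∂ (m + 1)) c d z v 0 := by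
  refine lt_of_le_of_ne (tangentCoordChange_zero_nonneg hc hd h0 hv.le) fun h => ?_
  have h1 := tangentCoordChange_zero_eq_zero hd hc ((extChartAt_zero_eq_zero_iff hc hd).mp h0) h.symm
  rw [tangentCoordChange_comp ⟨⟨hc, hd⟩, hc⟩, tangentCoordChange_self hc] at h1
  exact hv.ne' h1

end Charts

/-! ### The induced measures in charts -/

section GramChange

/-- The Gram determinant of the images of the standard basis under a composition. -/
lemma gramDet_comp {k l : ℕ} (A : Euc l →ₗ[ℝ] Euc k) (P : Euc l →ₗ[ℝ] Euc l) :
    gramDet (fun i => A (P (EuclideanSpace.single i 1))) =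
      LinearMap.det P ^ 2 * gramDet (fun i => A (EuclideanSpace.single i 1)) := by
  set b := (EuclideanSpace.basisFun (Fin l) ℝ).toBasis with hb
  have hbi : ∀ i, b i = EuclideanSpace.single i 1 := fun i => by simp [hb]
  set Q := LinearMap.toMatrix b b P with hQ
  have h1 : ∀ i, A (P (EuclideanSpace.single i 1)) =
      ∑ j, Q j i • A (EuclideanSpace.single j 1) := fun i => by
    rw [← hbi i, ← congrArg A (b.sum_repr (P (b i))), map_sum]
    simp only [map_smul, hQ, LinearMap.toMatrix_apply, hbi]
  -- Gram matrices transform as `Qᵀ G Q`, with `Q` the matrix of `P`.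
  have h2 : (Matrix.of fun i j : Fin l => ⟪A (P (EuclideanSpace.single i 1)),
      A (P (EuclideanSpace.single j 1))⟫) =
      Q.transpose * (Matrix.of fun i j : Fin l => ⟪A (EuclideanSpace.single i 1),
        A (EuclideanSpace.single j 1)⟫) * Q := by
    ext i j
    simp only [Matrix.of_apply, h1, sum_inner, inner_sum, real_inner_smul_left,
      real_inner_smul_right, Matrix.mul_apply, Matrix.transpose_apply, Finset.sum_mul]
    refine Finset.sum_congr rfl fun a _ => Finset.sum_congr rfl fun b _ => ?_
    rw [real_inner_comm]
    ring
  rw [gramDet, h2, Matrix.det_mul, Matrix.det_mul, Matrix.det_transpose, hQ,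
    LinearMap.det_toMatrix, gramDet]
  ring

end GramChange

section ChartMeasures

variable {m : ℕ}

/-- The inclusion `v ↦ (0, v)` of the boundary hyperplane as a continuous linear map. -/
def boundaryIncl (m : ℕ) : Euc m →L[ℝ] Euc (m + 1) :=
  LinearMap.toContinuousLinearMap
    { toFun := boundaryPoint
      map_add' := fun v w => by
        ext i
        refine Fin.cases ?_ (fun i => ?_) i <;> simp [boundaryPoint]
      map_smul' := fun c v => by
        ext i
        refine Fin.cases ?_ (fun i => ?_) i <;> simp [boundaryPoint] }

/-- The projection `(u₀, v) ↦ v`. -/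
def boundaryProj (m : ℕ) : Euc (m + 1) →L[ℝ] Euc m :=
  LinearMap.toContinuousLinearMap
    { toFun := fun u => WithLp.toLp 2 fun i => u i.succ
      map_add' := fun v w => by
        ext i
        simp
      map_smul' := fun c v => by
        ext i
        simp }

lemma boundaryPoint_zero (v : Euc m) : boundaryPoint v 0 = 0 := rfl

lemma boundaryPoint_succ (v : Euc m) (i : Fin m) : boundaryPoint v i.succ = v i := rfl

lemma boundaryProj_boundaryPoint (v : Euc m) : boundaryProj m (boundaryPoint v) = v := by
  ext i
  rfl

lemma boundaryPoint_boundaryProj {u : Euc (m + 1)} (hu : u 0 = 0) :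
    boundaryPoint (boundaryProj m u) = u := by
  ext i
  refine Fin.cases ?_ (fun i => ?_) i
  · exact hu.symm
  · rfl

lemma boundaryPoint_single (j : Fin m) :
    boundaryPoint (EuclideanSpace.single j (1 : ℝ)) = EuclideanSpace.single j.succ 1 := by
  ext i
  refine Fin.cases ?_ (fun i => ?_) i
  · simp [boundaryPoint_zero]
  · simp [boundaryPoint_succ]

lemma continuous_boundaryPoint : Continuous (boundaryPoint : Euc m → Euc (m + 1)) :=
  (boundaryIncl m).continuous

variable {M : Type*} [TopologicalSpace M] [ChartedSpace (EuclideanHalfSpace (m + 1)) M]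

lemma isOpen_boundaryPoint_preimage (c : M) :
    IsOpen {v : Euc m | boundaryPoint v ∈ (extChartAt (𝓡∂ (m + 1)) c).target} := by
  have : {v : Euc m | boundaryPoint v ∈ (extChartAt (𝓡∂ (m + 1)) c).target} =
      (fun v => (𝓡∂ (m + 1)).symm (boundaryPoint v)) ⁻¹' (chartAt _ c).target := by
    ext v
    rw [mem_ofPred_eq, extChartAt_target]
    refine ⟨fun h => h.1, fun h => ⟨h, ?_⟩⟩
    rw [range_modelWithCornersEuclideanHalfSpace]
    exact (boundaryPoint_zero v).ge
  rw [this]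
  exact (chartAt _ c).open_target.preimage
    ((𝓡∂ (m + 1)).continuous_symm.comp continuous_boundaryPoint)

variable [IsManifold (𝓡∂ (m + 1)) ∞ M]

lemma volumeDensity_eq (X : M → Euc (m + 1 + 1)) (c : M) (u : Euc (m + 1)) :
    volumeDensity X c u = √(gramDet fun i => coordDeriv X c u i) := rfl

lemma boundaryDensity_eq (X : M → Euc (m + 1 + 1)) (c : M) (u : Euc (m + 1)) :
    boundaryDensity X c u = √(gramDet fun j : Fin m => coordDeriv X c u j.succ) := rfl

variable {X : M → Euc (m + 1 + 1)}

lemma continuousOn_coordDeriv (hX : ContMDiff (𝓡∂ (m + 1)) 𝓘(ℝ, Euc (m + 1 + 1)) 1 X) (c : M)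
    (i : Fin (m + 1)) :
    ContinuousOn (fun u => coordDeriv X c u i) (extChartAt (𝓡∂ (m + 1)) c).target := by
  have h := (contDiffOn_chartDeriv (l := 0) (by simp)
    (contDiffOn_comp_symm (by simp) hX c)).continuousOn
  exact h.clm_apply continuousOn_const

lemma continuousOn_gramDet {G : Type*} [TopologicalSpace G] {s : Set G} {k l : ℕ}
    {v : Fin l → G → Euc k} (hv : ∀ i, ContinuousOn (v i) s) :
    ContinuousOn (fun t => gramDet fun i => v i t) s := by
  rw [continuousOn_iff_continuous_domRestrict]
  refine Continuous.matrix_det (continuous_matrix fun i j => ?_)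
  exact Continuous.inner (continuousOn_iff_continuous_domRestrict.mp (hv i))
    (continuousOn_iff_continuous_domRestrict.mp (hv j))

lemma continuousOn_volumeDensity (hX : ContMDiff (𝓡∂ (m + 1)) 𝓘(ℝ, Euc (m + 1 + 1)) 1 X)
    (c : M) : ContinuousOn (volumeDensity X c) (extChartAt (𝓡∂ (m + 1)) c).target :=
  (continuousOn_gramDet fun i => continuousOn_coordDeriv hX c i).sqrt

lemma continuousOn_boundaryDensity (hX : ContMDiff (𝓡∂ (m + 1)) 𝓘(ℝ, Euc (m + 1 + 1)) 1 X)
    (c : M) : ContinuousOn (boundaryDensity X c) (extChartAt (𝓡∂ (m + 1)) c).target :=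
  (continuousOn_gramDet fun i : Fin m => continuousOn_coordDeriv hX c i.succ).sqrt

variable [MeasurableSpace M] [BorelSpace M]

lemma isDensityChart_volume (hX : ContMDiff (𝓡∂ (m + 1)) 𝓘(ℝ, Euc (m + 1 + 1)) 1 X) (c : M) :
    IsDensityChart (extChartAt (𝓡∂ (m + 1)) c).symm (extChartAt (𝓡∂ (m + 1)) c)
      (extChartAt (𝓡∂ (m + 1)) c).target (extChartAt (𝓡∂ (m + 1)) c).source
      (volumeDensity X c) where
  measurableSet_domain := measurableSet_extChartAt_target c
  measurableSet_image := (isOpen_extChartAt_source c).measurableSet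
  mapsTo := fun _ hu => (extChartAt _ c).map_target hu
  mapsTo_inv := fun _ hp => (extChartAt _ c).map_source hp
  left_inv := fun _ hu => (extChartAt _ c).right_inv hu
  right_inv := fun _ hp => (extChartAt _ c).left_inv hp
  continuousOn := continuousOn_extChartAt_symm c
  continuousOn_inv := continuousOn_extChartAt c
  continuousOn_density := continuousOn_volumeDensity hX c
  nonneg := fun _ => Real.sqrt_nonneg _

lemma isDensityChart_boundary (hX : ContMDiff (𝓡∂ (m + 1)) 𝓘(ℝ, Euc (m + 1 + 1)) 1 X) (c : M) :
    IsDensityChart (fun v => (extChartAt (𝓡∂ (m + 1)) c).symm (boundaryPoint v))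
      (fun p => boundaryProj m (extChartAt (𝓡∂ (m + 1)) c p))
      {v : Euc m | boundaryPoint v ∈ (extChartAt (𝓡∂ (m + 1)) c).target}
      ((extChartAt (𝓡∂ (m + 1)) c).source ∩ {p | extChartAt (𝓡∂ (m + 1)) c p 0 = 0})
      (fun v => boundaryDensity X c (boundaryPoint v)) where
  measurableSet_domain := (isOpen_boundaryPoint_preimage c).measurableSet
  measurableSet_image :=
    (continuousOn_extChartAt c).measurableSet_inter_preimage'
      (isOpen_extChartAt_source c).measurableSet
      (B := {u : Euc (m + 1) | u 0 = 0})
      (measurableSet_eq_fun (by fun_prop) measurable_const)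
  mapsTo := fun v hv => ⟨(extChartAt _ c).map_target hv, by
    rw [mem_ofPred_eq, (extChartAt _ c).right_inv hv, boundaryPoint_zero]⟩
  mapsTo_inv := fun p hp => by
    rw [mem_ofPred_eq, boundaryPoint_boundaryProj hp.2]
    exact (extChartAt _ c).map_source hp.1
  left_inv := fun v hv => by
    rw [(extChartAt _ c).right_inv hv, boundaryProj_boundaryPoint]
  right_inv := fun p hp => by
    rw [boundaryPoint_boundaryProj hp.2, (extChartAt _ c).left_inv hp.1]
  continuousOn := (continuousOn_extChartAt_symm c).comp continuous_boundaryPoint.continuousOn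
    fun _ hv => hv
  continuousOn_inv := (boundaryProj m).continuous.comp_continuousOn
    ((continuousOn_extChartAt c).mono inter_subset_left)
  continuousOn_density := (continuousOn_boundaryDensity hX c).comp
    continuous_boundaryPoint.continuousOn fun _ hv => hv
  nonneg := fun _ => Real.sqrt_nonneg _

/-- The Gram determinant picks up the square of the Jacobian determinant of the chart change, hence
its square root picks up the absolute value. -/
lemma chartVolume_eq_of_subset (hX : ContMDiff (𝓡∂ (m + 1)) 𝓘(ℝ, Euc (m + 1 + 1)) 1 X) (c d : M)
    {B : Set M} (hB : MeasurableSet B)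
    (hBS : B ⊆ (extChartAt (𝓡∂ (m + 1)) c).source ∩ (extChartAt (𝓡∂ (m + 1)) d).source) :
    chartVolume X c B = chartVolume X d B := by
  refine densityMap_eq_of_chartChange (isDensityChart_volume hX c) (isDensityChart_volume hX d)
    (fun u => tangentCoordChange (𝓡∂ (m + 1)) c d ((extChartAt (𝓡∂ (m + 1)) c).symm u))
    (fun u hu hd => ?_) (fun u hu hd => ?_) hB hBS
  · have hc := (extChartAt (𝓡∂ (m + 1)) c).map_target hu
    have h := hasFDerivWithinAt_tangentCoordChange (I := 𝓡∂ (m + 1)) ⟨hc, hd⟩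
    rw [(extChartAt (𝓡∂ (m + 1)) c).right_inv hu] at h
    exact h.mono fun v hv => extChartAt_target_subset_range c hv.1
  · have hc := (extChartAt (𝓡∂ (m + 1)) c).map_target hu
    have h := chartDeriv_eq_comp hc hd (contDiffOn_comp_symm (by simp) hX d)
    rw [(extChartAt (𝓡∂ (m + 1)) c).right_inv hu] at h
    rw [volumeDensity_eq, volumeDensity_eq]
    simp only [coordDeriv_eq, h]
    have h2 := gramDet_comp (chartDeriv X d (extChartAt (𝓡∂ (m + 1)) d
      ((extChartAt (𝓡∂ (m + 1)) c).symm u))).toLinearMap (tangentCoordChange (𝓡∂ (m + 1)) c d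
      ((extChartAt (𝓡∂ (m + 1)) c).symm u)).toLinearMap
    refine (congrArg Real.sqrt h2).trans ?_
    rw [Real.sqrt_mul (sq_nonneg _), Real.sqrt_sq_eq_abs]
    rfl

lemma chartBoundaryVolume_eq_of_subset (hX : ContMDiff (𝓡∂ (m + 1)) 𝓘(ℝ, Euc (m + 1 + 1)) 1 X)
    (c d : M) {B : Set M} (hB : MeasurableSet B)
    (hBS : B ⊆ ((extChartAt (𝓡∂ (m + 1)) c).source ∩ {p | extChartAt (𝓡∂ (m + 1)) c p 0 = 0}) ∩
      ((extChartAt (𝓡∂ (m + 1)) d).source ∩ {p | extChartAt (𝓡∂ (m + 1)) d p 0 = 0})) :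
    chartBoundaryVolume X c B = chartBoundaryVolume X d B := by
  refine densityMap_eq_of_chartChange (isDensityChart_boundary hX c)
    (isDensityChart_boundary hX d)
    (fun v => (boundaryProj m).comp ((tangentCoordChange (𝓡∂ (m + 1)) c d
      ((extChartAt (𝓡∂ (m + 1)) c).symm (boundaryPoint v))).comp (boundaryIncl m)))
    (fun v hv hd => ?_) (fun v hv hd => ?_) hB hBS
  · have hc := (extChartAt (𝓡∂ (m + 1)) c).map_target hv
    have h := hasFDerivWithinAt_tangentCoordChange (I := 𝓡∂ (m + 1)) ⟨hc, hd.1⟩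
    rw [(extChartAt (𝓡∂ (m + 1)) c).right_inv hv] at h
    refine (boundaryProj m).hasFDerivAt.comp_hasFDerivWithinAt v
      (HasFDerivWithinAt.comp v h (boundaryIncl m).hasFDerivAt.hasFDerivWithinAt ?_)
    exact fun w hw => extChartAt_target_subset_range c hw.1
  · have hc := (extChartAt (𝓡∂ (m + 1)) c).map_target hv
    have h0 : extChartAt (𝓡∂ (m + 1)) c ((extChartAt (𝓡∂ (m + 1)) c).symm (boundaryPoint v)) 0 = 0 := by
      rw [(extChartAt (𝓡∂ (m + 1)) c).right_inv hv, boundaryPoint_zero]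
    have h := chartDeriv_eq_comp hc hd.1 (contDiffOn_comp_symm (by simp) hX d)
    rw [(extChartAt (𝓡∂ (m + 1)) c).right_inv hv] at h
    rw [boundaryPoint_boundaryProj hd.2, boundaryDensity_eq, boundaryDensity_eq]
    set z := (extChartAt (𝓡∂ (m + 1)) c).symm (boundaryPoint v) with hz
    set A := chartDeriv X d (extChartAt (𝓡∂ (m + 1)) d z) with hA
    set P := tangentCoordChange (𝓡∂ (m + 1)) c d z with hP
    -- The chart change is tangent to the boundary hyperplane, so projecting to `ℝᵐ` loses nothing
    -- and the boundary density transforms by the Jacobian of the restricted map.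
    have h3 : ∀ w, P (boundaryIncl m w) =
        boundaryIncl m (((boundaryProj m).comp (P.comp (boundaryIncl m))) w) := fun w => by
      refine (boundaryPoint_boundaryProj ?_).symm
      exact tangentCoordChange_zero_eq_zero hc hd.1 h0 (boundaryPoint_zero w)
    have h2 := gramDet_comp (A.comp (boundaryIncl m)).toLinearMap
      ((boundaryProj m).comp (P.comp (boundaryIncl m))).toLinearMap
    have h4 : ∀ j : Fin m, coordDeriv X c (boundaryPoint v) j.succ =
        (A.comp (boundaryIncl m)).toLinearMap (((boundaryProj m).comp
          (P.comp (boundaryIncl m))).toLinearMap (EuclideanSpace.single j 1)) := fun j => by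
      rw [coordDeriv_eq, h, ← boundaryPoint_single]
      exact congrArg A (h3 _)
    have h5 : ∀ j : Fin m, coordDeriv X d (extChartAt (𝓡∂ (m + 1)) d z) j.succ =
        (A.comp (boundaryIncl m)).toLinearMap (EuclideanSpace.single j 1) := fun j => by
      rw [coordDeriv_eq, ← boundaryPoint_single]
      rfl
    simp only [h4, h5]
    rw [h2, Real.sqrt_mul (sq_nonneg _), Real.sqrt_sq_eq_abs]

lemma volumeMeasure_restrict_source (hX : ContMDiff (𝓡∂ (m + 1)) 𝓘(ℝ, Euc (m + 1 + 1)) 1 X)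
    (c : M) :
    (volumeMeasure X).restrict (extChartAt (𝓡∂ (m + 1)) c).source = chartVolume X c :=
  iSup_measure_restrict (fun c => (isDensityChart_volume hX c).measurableSet_image)
    (fun c => (isDensityChart_volume hX c).densityMap_compl)
    (fun c d _ hB hBS => chartVolume_eq_of_subset hX c d hB hBS) c

lemma boundaryMeasure_restrict_source (hX : ContMDiff (𝓡∂ (m + 1)) 𝓘(ℝ, Euc (m + 1 + 1)) 1 X)
    (c : M) :
    (boundaryMeasure X).restrict (extChartAt (𝓡∂ (m + 1)) c).source = chartBoundaryVolume X c := by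
  have hnull : ∀ c : M, chartBoundaryVolume X c
      ((extChartAt (𝓡∂ (m + 1)) c).source ∩ {p | extChartAt (𝓡∂ (m + 1)) c p 0 = 0})ᶜ = 0 :=
    fun c => (isDensityChart_boundary hX c).densityMap_compl
  have hmeas : ∀ c : M, MeasurableSet
      ((extChartAt (𝓡∂ (m + 1)) c).source ∩ {p | extChartAt (𝓡∂ (m + 1)) c p 0 = 0}) :=
    fun c => (isDensityChart_boundary hX c).measurableSet_image
  -- Each chart measure is carried by the boundary part of its chart domain, so compatibility on
  -- overlaps of domains reduces to boundary points.
  have hB' : ∀ (c : M) (B : Set M), chartBoundaryVolume X c B = chartBoundaryVolume X c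
      (B ∩ ((extChartAt (𝓡∂ (m + 1)) c).source ∩ {p | extChartAt (𝓡∂ (m + 1)) c p 0 = 0})) := by
    intro c B
    have h : chartBoundaryVolume X c (B \ ((extChartAt (𝓡∂ (m + 1)) c).source ∩
        {p | extChartAt (𝓡∂ (m + 1)) c p 0 = 0})) = 0 :=
      measure_mono_null (fun x hx => hx.2) (hnull c)
    rw [← measure_inter_add_sdiff B (hmeas c), h, add_zero]
  refine iSup_measure_restrict (fun c => (isOpen_extChartAt_source c).measurableSet)
    (fun c => measure_mono_null (compl_subset_compl.mpr inter_subset_left) (hnull c))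
    (fun c d B hB hBS => ?_) c
  rw [hB' c, hB' d]
  have hsub : B ∩ ((extChartAt (𝓡∂ (m + 1)) c).source ∩ {p | extChartAt (𝓡∂ (m + 1)) c p 0 = 0}) =
      B ∩ ((extChartAt (𝓡∂ (m + 1)) d).source ∩ {p | extChartAt (𝓡∂ (m + 1)) d p 0 = 0}) := by
    ext p
    constructor
    · rintro ⟨h1, h2, h3⟩
      exact ⟨h1, (hBS h1).2, (extChartAt_zero_eq_zero_iff (hBS h1).1 (hBS h1).2).mp h3⟩
    · rintro ⟨h1, h2, h3⟩
      exact ⟨h1, (hBS h1).1, (extChartAt_zero_eq_zero_iff (hBS h1).1 (hBS h1).2).mpr h3⟩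
  rw [← hsub]
  refine chartBoundaryVolume_eq_of_subset hX c d (hB.inter (hmeas c)) fun p hp => ⟨hp.2, ?_⟩
  exact (hsub ▸ hp).2

/-- As `f` vanishes off the chart domain, only the restriction of the supremum to that domain
matters, and this is the chart measure. Measurability of `f` on `M` follows from integrability in
coordinates. -/
lemma integral_volumeMeasure_of_source (hX : ContMDiff (𝓡∂ (m + 1)) 𝓘(ℝ, Euc (m + 1 + 1)) 1 X)
    {c : M} {f : M → ℝ} (hf : ∀ p, p ∉ (extChartAt (𝓡∂ (m + 1)) c).source → f p = 0)
    (hi : IntegrableOn (fun u => volumeDensity X c u * f ((extChartAt (𝓡∂ (m + 1)) c).symm u))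
      (extChartAt (𝓡∂ (m + 1)) c).target) :
    Integrable f (volumeMeasure X) ∧ ∫ p, f p ∂(volumeMeasure X) =
      ∫ u in (extChartAt (𝓡∂ (m + 1)) c).target,
        volumeDensity X c u * f ((extChartAt (𝓡∂ (m + 1)) c).symm u) := by
  have h1 := (isDensityChart_volume hX c).integrable hi
  have h2 := (isDensityChart_volume hX c).integral_eq hi
  change Integrable f (chartVolume X c) at h1
  change ∫ p, f p ∂(chartVolume X c) = _ at h2
  rw [← volumeMeasure_restrict_source hX] at h1 h2
  refine ⟨(integrableOn_iff_integrable_of_support_subset fun p hp => ?_).mp h1, ?_⟩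
  · by_contra h
    exact hp (hf p h)
  · rw [← h2, setIntegral_eq_integral_of_forall_compl_eq_zero hf]

lemma integral_boundaryMeasure_of_source (hX : ContMDiff (𝓡∂ (m + 1)) 𝓘(ℝ, Euc (m + 1 + 1)) 1 X)
    {c : M} {f : M → ℝ} (hf : ∀ p, p ∉ (extChartAt (𝓡∂ (m + 1)) c).source → f p = 0)
    (hi : IntegrableOn (fun v => boundaryDensity X c (boundaryPoint v) *
      f ((extChartAt (𝓡∂ (m + 1)) c).symm (boundaryPoint v)))
      {v : Euc m | boundaryPoint v ∈ (extChartAt (𝓡∂ (m + 1)) c).target}) :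
    Integrable f (boundaryMeasure X) ∧ ∫ p, f p ∂(boundaryMeasure X) =
      ∫ v in {v : Euc m | boundaryPoint v ∈ (extChartAt (𝓡∂ (m + 1)) c).target},
        boundaryDensity X c (boundaryPoint v) *
          f ((extChartAt (𝓡∂ (m + 1)) c).symm (boundaryPoint v)) := by
  have h1 := (isDensityChart_boundary hX c).integrable hi
  have h2 := (isDensityChart_boundary hX c).integral_eq hi
  change Integrable f (chartBoundaryVolume X c) at h1
  change ∫ p, f p ∂(chartBoundaryVolume X c) = _ at h2
  rw [← boundaryMeasure_restrict_source hX] at h1 h2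
  refine ⟨(integrableOn_iff_integrable_of_support_subset fun p hp => ?_).mp h1, ?_⟩
  · by_contra h
    exact hp (hf p h)
  · rw [← h2, setIntegral_eq_integral_of_forall_compl_eq_zero hf]

end ChartMeasures

/-! ### The divergence theorem on the half-space -/

section HalfSpace

variable {m : ℕ}

/-- A measurable subset of the half-space which is relatively open. -/
structure IsHalfSpaceDomain (T : Set (Euc (m + 1))) : Prop where
  measurableSet : MeasurableSet T
  subset : T ⊆ range (𝓡∂ (m + 1))
  mem_nhdsWithin : ∀ u ∈ T, T ∈ 𝓝[range (𝓡∂ (m + 1))] u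

lemma mem_halfSpace_iff {u : Euc (m + 1)} : u ∈ range (𝓡∂ (m + 1)) ↔ 0 ≤ u 0 := by
  rw [range_modelWithCornersEuclideanHalfSpace]
  rfl

lemma halfSpace_mem_nhds {u : Euc (m + 1)} (hu : 0 < u 0) : range (𝓡∂ (m + 1)) ∈ 𝓝 u := by
  rw [← mem_interior_iff_mem_nhds, interior_range_modelWithCornersEuclideanHalfSpace]
  exact hu

lemma volume_hyperplane_eq_zero : volume {u : Euc (m + 1) | u 0 = 0} = 0 := by
  have h := Measure.addHaar_submodule (volume : Measure (Euc (m + 1)))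
    (LinearMap.ker (EuclideanSpace.proj (𝕜 := ℝ) (0 : Fin (m + 1))).toLinearMap) (fun h => by
      have : (EuclideanSpace.single 0 1 : Euc (m + 1)) ∈
          LinearMap.ker (EuclideanSpace.proj (𝕜 := ℝ) (0 : Fin (m + 1))).toLinearMap := by
        rw [h]
        trivial
      simp at this)
  refine measure_mono_null (fun u hu => ?_) h
  simpa using hu

lemma integrableOn_of_continuousOn_of_eq_zero {E : Type*} [TopologicalSpace E] [MeasurableSpace E]
    [BorelSpace E] [T2Space E] {μ : Measure E} [IsFiniteMeasureOnCompacts μ] {T K : Set E}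
    {f : E → ℝ} (hT : MeasurableSet T) (hK : IsCompact K) (hKT : K ⊆ T) (hf : ContinuousOn f T)
    (h0 : ∀ u ∈ T, u ∉ K → f u = 0) : IntegrableOn f T μ :=
  ((hf.mono hKT).integrableOn_compact' hK hK.measurableSet).of_forall_sdiff_eq_zero hT
    fun u hu => h0 u hu.1 hu.2

namespace IsHalfSpaceDomain

variable {T : Set (Euc (m + 1))}

lemma mem_nhds (hT : IsHalfSpaceDomain T) {u : Euc (m + 1)} (hu : u ∈ T) (h0 : 0 < u 0) :
    T ∈ 𝓝 u := by
  have := hT.mem_nhdsWithin u hu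
  rwa [nhdsWithin_eq_nhds.mpr (halfSpace_mem_nhds h0)] at this

lemma uniqueDiffOn (hT : IsHalfSpaceDomain T) : UniqueDiffOn ℝ T := fun u hu =>
  ((𝓡∂ (m + 1)).uniqueDiffOn u (hT.subset hu)).mono_nhds
    (nhdsWithin_le_of_mem (hT.mem_nhdsWithin u hu))

lemma nhdsWithin_eq (hT : IsHalfSpaceDomain T) {u : Euc (m + 1)} (hu : u ∈ T) :
    𝓝[range (𝓡∂ (m + 1))] u = 𝓝[T] u :=
  le_antisymm (nhdsWithin_le_of_mem (hT.mem_nhdsWithin u hu)) (nhdsWithin_mono u hT.subset)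

variable {F : Type*} [NormedAddCommGroup F] [NormedSpace ℝ F] {f : Euc (m + 1) → F}

lemma fderivWithin_eq (hT : IsHalfSpaceDomain T) {u : Euc (m + 1)} (hu : u ∈ T) :
    fderivWithin ℝ f T u = fderivWithin ℝ f (range (𝓡∂ (m + 1))) u := by
  refine fderivWithin_congr_set' u ?_
  have h : T =ᶠ[𝓝 u] range (𝓡∂ (m + 1)) := by
    rw [← nhdsWithin_eq_iff_eventuallyEq, hT.nhdsWithin_eq hu]
  exact h.filter_mono nhdsWithin_le_nhds

lemma contDiffOn_fderivWithin (hT : IsHalfSpaceDomain T) {k l : WithTop ℕ∞} (hl : l + 1 ≤ k)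
    (hf : ContDiffOn ℝ k f T) : ContDiffOn ℝ l (fderivWithin ℝ f (range (𝓡∂ (m + 1)))) T :=
  (hf.fderivWithin hT.uniqueDiffOn hl).congr fun _ hu => (hT.fderivWithin_eq hu).symm

lemma continuousOn_fderivWithin_apply (hT : IsHalfSpaceDomain T) (hf : ContDiffOn ℝ 1 f T)
    (v : Euc (m + 1)) :
    ContinuousOn (fun u => fderivWithin ℝ f (range (𝓡∂ (m + 1))) u v) T :=
  (hT.contDiffOn_fderivWithin (l := 0) (by simp) hf).continuousOn.clm_apply continuousOn_const

lemma fderivWithin_eq_zero (hT : IsHalfSpaceDomain T) {K : Set (Euc (m + 1))} (hK : IsClosed K)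
    (h0 : ∀ u ∈ T, u ∉ K → f u = 0) {u : Euc (m + 1)} (hu : u ∈ T) (huK : u ∉ K) :
    fderivWithin ℝ f (range (𝓡∂ (m + 1))) u = 0 := by
  have h : f =ᶠ[𝓝[range (𝓡∂ (m + 1))] u] fun _ => 0 := by
    filter_upwards [hT.mem_nhdsWithin u hu, mem_nhdsWithin_of_mem_nhds (hK.isOpen_compl.mem_nhds huK)]
      with v hv hvK using h0 v hv hvK
  rw [h.fderivWithin_eq (h0 u hu huK)]
  simp

lemma hasFDerivAt (hT : IsHalfSpaceDomain T) (hf : ContDiffOn ℝ 1 f T) {u : Euc (m + 1)}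
    (hu : u ∈ T) (h0 : 0 < u 0) :
    HasFDerivAt f (fderivWithin ℝ f (range (𝓡∂ (m + 1))) u) u := by
  have h := ((hf.contDiffAt (hT.mem_nhds hu h0)).differentiableAt one_ne_zero).hasFDerivAt
  rwa [fderivWithin_of_mem_nhds (halfSpace_mem_nhds h0)]

lemma measurableSet_boundary (hT : IsHalfSpaceDomain T) :
    MeasurableSet {v : Euc m | boundaryPoint v ∈ T} :=
  continuous_boundaryPoint.measurable hT.measurableSet

end IsHalfSpaceDomain

/-- The divergence theorem for vector fields of class `C¹` with compact support on the
half-space. -/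
theorem integral_divergence_halfSpace {T K : Set (Euc (m + 1))} (hT : IsHalfSpaceDomain T)
    (hK : IsCompact K) (hKT : K ⊆ T) {V : Fin (m + 1) → Euc (m + 1) → ℝ}
    (hV : ∀ i, ContDiffOn ℝ 1 (V i) T) (hV0 : ∀ i, ∀ u ∈ T, u ∉ K → V i u = 0) :
    ∫ u in T, ∑ i, fderivWithin ℝ (V i) (range (𝓡∂ (m + 1))) u (EuclideanSpace.single i 1) =
      -∫ v in {v : Euc m | boundaryPoint v ∈ T}, V 0 (boundaryPoint v) := by
  classical
  set H := range (𝓡∂ (m + 1)) with hH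
  -- Extension by zero. As `V i` vanishes off the compact set `K ⊆ T`, the extension is continuous
  -- on the closed half-space and differentiable wherever `0 < u 0`.
  let W : Fin (m + 1) → Euc (m + 1) → ℝ := fun i => T.indicator (V i)
  let W' : Fin (m + 1) → Euc (m + 1) → Euc (m + 1) →L[ℝ] ℝ :=
    fun i => T.indicator (fderivWithin ℝ (V i) H)
  have hW0 : ∀ i, ∀ u, u ∉ K → W i u = 0 := fun i u hu => by
    by_cases h : u ∈ T
    · simp only [W, indicator_of_mem h, hV0 i u h hu]
    · simp only [W, indicator_of_notMem h]
  have hW'0 : ∀ i, ∀ u, u ∉ K → W' i u = 0 := fun i u hu => by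
    by_cases h : u ∈ T
    · simp only [W', indicator_of_mem h, hH, hT.fderivWithin_eq_zero hK.isClosed (hV0 i) h hu]
    · simp only [W', indicator_of_notMem h]
  have hWc : ∀ i, ContinuousOn (W i) H := fun i u hu => by
    by_cases h : u ∈ T
    · have h1 : ContinuousWithinAt (V i) H u := by
        rw [ContinuousWithinAt, hT.nhdsWithin_eq h]
        exact (hV i).continuousOn u h
      refine h1.congr_of_eventuallyEq ?_ (indicator_of_mem h _)
      filter_upwards [hT.mem_nhdsWithin u h] with v hv using indicator_of_mem hv _
    · have hu' : u ∉ K := fun hk => h (hKT hk)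
      have h1 : W i =ᶠ[𝓝 u] fun _ => 0 := by
        filter_upwards [hK.isClosed.isOpen_compl.mem_nhds hu'] with v hv using hW0 i v hv
      exact (continuousAt_const.congr h1.symm).continuousWithinAt
  have hWd : ∀ i, ∀ u : Euc (m + 1), 0 < u 0 → HasFDerivAt (W i) (W' i u) u := fun i u hu => by
    by_cases h : u ∈ T
    · simp only [W', indicator_of_mem h]
      refine (hT.hasFDerivAt (hV i) h hu).congr_of_eventuallyEq ?_
      filter_upwards [hT.mem_nhds h hu] with v hv using indicator_of_mem hv _
    · have hu' : u ∉ K := fun hk => h (hKT hk)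
      simp only [W', indicator_of_notMem h]
      refine (hasFDerivAt_const (0 : ℝ) u).congr_of_eventuallyEq ?_
      filter_upwards [hK.isClosed.isOpen_compl.mem_nhds hu'] with v hv using hW0 i v hv
  obtain ⟨R, hR0, hR⟩ : ∃ R : ℝ, 0 < R ∧ ∀ u ∈ K, ∀ i, |u i| < R := by
    obtain ⟨C, hC⟩ := hK.isBounded.exists_norm_le
    refine ⟨max C 0 + 1, by positivity, fun u hu i => ?_⟩
    have h1 := PiLp.norm_apply_le u i
    rw [Real.norm_eq_abs] at h1
    linarith [hC u hu, le_max_left C 0]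
  -- The box `[0, R] × [-R, R]ᵐ` contains `K`. By the strict bound defining `R`, only its face `u 0
  -- = 0` can meet `K`, so the other faces contribute nothing.
  let a : Fin (m + 1) → ℝ := Fin.cons 0 fun _ => -R
  let b : Fin (m + 1) → ℝ := fun _ => R
  let e : (Fin (m + 1) → ℝ) ≃L[ℝ] Euc (m + 1) := (EuclideanSpace.equiv (Fin (m + 1)) ℝ).symm
  have he : ∀ x i, e x i = x i := fun x i => rfl
  have hab : a ≤ b := fun i => by
    refine Fin.cases ?_ (fun i => ?_) i
    · exact hR0.le
    · change -R ≤ R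
      linarith
  have hIcc : ∀ x, e x ∈ K → x ∈ Icc a b := fun x hx => by
    have h1 := hT.subset (hKT hx)
    rw [mem_halfSpace_iff] at h1
    refine ⟨fun i => ?_, fun i => (abs_lt.mp (hR _ hx i)).2.le⟩
    refine Fin.cases ?_ (fun i => ?_) i
    · exact h1
    · exact (abs_lt.mp (hR _ hx i.succ)).1.le
  have hmp : MeasurePreserving e volume volume := PiLp.volume_preserving_toLp (Fin (m + 1))
  have hemb : MeasurableEmbedding e := e.toHomeomorph.measurableEmbedding
  have hint : IntegrableOn (fun u => ∑ i, fderivWithin ℝ (V i) H u (EuclideanSpace.single i 1)) T :=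
    integrableOn_of_continuousOn_of_eq_zero hT.measurableSet hK hKT
      (continuousOn_finsetSum _ fun i _ => hT.continuousOn_fderivWithin_apply (hV i) _)
      fun u hu huK => Finset.sum_eq_zero fun i _ => by
        rw [hT.fderivWithin_eq_zero hK.isClosed (hV0 i) hu huK]
        rfl
  have hG : (fun u => ∑ i, W' i u (EuclideanSpace.single i 1)) =
      T.indicator fun u => ∑ i, fderivWithin ℝ (V i) H u (EuclideanSpace.single i 1) := by
    ext u
    by_cases h : u ∈ T
    · simp only [W', indicator_of_mem h]
    · simp only [W', indicator_of_notMem h, zero_apply, Finset.sum_const_zero]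
  have hGint : Integrable (fun u => ∑ i, W' i u (EuclideanSpace.single i 1)) := by
    rw [hG]
    exact hint.integrable_indicator hT.measurableSet
  have hsingle : ∀ i : Fin (m + 1), e (Pi.single i 1) = EuclideanSpace.single i 1 := fun i => rfl
  -- Differentiability is required only in the open box, where `0 < u 0`; on the hyperplane
  -- continuity is enough.
  have key := integral_divergence_of_hasFDerivAt_off_countable' a b hab
    (fun i x => W i (e x)) (fun i x => (W' i (e x)).comp e.toContinuousLinearMap) ∅
    countable_empty
    (fun i => (hWc i).comp e.continuous.continuousOn fun x hx => by
      rw [hH, mem_halfSpace_iff]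
      exact hx.1 0)
    (fun x hx i => (hWd i (e x) (by
      have := hx.1 0 (mem_univ _)
      exact this.1)).comp x e.hasFDerivAt)
    (by
      have := ((hmp.integrable_comp_emb hemb).mpr hGint).integrableOn (s := Icc a b)
      exact this)
  have hlhs : ∫ x in Icc a b, ∑ i, ((W' i (e x)).comp e.toContinuousLinearMap) (Pi.single i 1) =
      ∫ u in T, ∑ i, fderivWithin ℝ (V i) H u (EuclideanSpace.single i 1) := by
    rw [setIntegral_eq_integral_of_forall_compl_eq_zero, ← integral_indicator hT.measurableSet,
      ← hG, ← hmp.integral_comp hemb]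
    · rfl
    · intro x hx
      refine Finset.sum_eq_zero fun i _ => ?_
      rw [hW'0 i _ fun h => hx (hIcc x h)]
      rfl
  rw [hlhs] at key
  rw [key, Fin.sum_univ_succ, Finset.sum_eq_zero, add_zero]
  · have hfront : ∀ x : Fin m → ℝ, W 0 (e (Fin.insertNth 0 (b 0) x)) = 0 := fun x => by
      refine hW0 _ _ fun h => ?_
      have := (abs_lt.mp (hR _ h 0)).2
      rw [he] at this
      simp [b] at this
    simp only [hfront, integral_zero, zero_sub]
    congr 1
    have hmp' : MeasurePreserving (WithLp.toLp 2 : (Fin m → ℝ) → Euc m) volume volume :=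
      PiLp.volume_preserving_toLp (Fin m)
    have hemb' : MeasurableEmbedding (WithLp.toLp 2 : (Fin m → ℝ) → Euc m) :=
      (EuclideanSpace.equiv (Fin m) ℝ).symm.toHomeomorph.measurableEmbedding
    rw [setIntegral_eq_integral_of_forall_compl_eq_zero]
    · have h1 : ∀ x : Fin m → ℝ, W 0 (e (Fin.insertNth 0 (a 0) x)) =
          {v : Euc m | boundaryPoint v ∈ T}.indicator (fun v => V 0 (boundaryPoint v))
            (WithLp.toLp 2 x) := fun x => by
        have h2 : e (Fin.insertNth 0 (a 0) x) = boundaryPoint (WithLp.toLp 2 x) := by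
          ext i
          rw [he]
          refine Fin.cases ?_ (fun i => ?_) i
          · simp [a, boundaryPoint_zero]
          · simp [boundaryPoint_succ]
        rw [h2]
        rfl
      simp only [h1]
      rw [hmp'.integral_comp hemb', integral_indicator hT.measurableSet_boundary]
    · intro x hx
      refine hW0 _ _ fun h => hx ?_
      have h1 := hIcc _ h
      refine ⟨fun i => ?_, fun i => ?_⟩
      · simpa using h1.1 i.succ
      · simpa using h1.2 i.succ
  · intro i _
    have h1 : ∀ x : Fin m → ℝ, W i.succ (e (Fin.insertNth i.succ (b i.succ) x)) = 0 := fun x => by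
      refine hW0 _ _ fun h => ?_
      have := (abs_lt.mp (hR _ h i.succ)).2
      rw [he] at this
      simp [b] at this
    have h2 : ∀ x : Fin m → ℝ, W i.succ (e (Fin.insertNth i.succ (a i.succ) x)) = 0 := fun x => by
      refine hW0 _ _ fun h => ?_
      have := (abs_lt.mp (hR _ h i.succ)).1
      rw [he] at this
      simp [a] at this
    simp only [h1, h2, integral_zero, sub_self]

end HalfSpace

/-! ### Integration by parts for determinants -/

section FrameDivergence

variable {m : ℕ} {T K : Set (Euc (m + 1))}

/-- The partial derivative along the `i`-th coordinate on the half-space. -/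
def partialDeriv {F : Type*} [NormedAddCommGroup F] [NormedSpace ℝ F] (f : Euc (m + 1) → F)
    (u : Euc (m + 1)) (i : Fin (m + 1)) : F :=
  fderivWithin ℝ f (range (𝓡∂ (m + 1))) u (EuclideanSpace.single i 1)

lemma frameDet_update_update_swap {n : ℕ} (w a b : Euc (n + 1)) (x : Fin n → Euc (n + 1))
    {i j : Fin n} (hij : i ≠ j) :
    frameDet w (Function.update (Function.update x i a) j b) =
      -frameDet w (Function.update (Function.update x j a) i b) := by
  rw [← frameForm_apply, ← frameForm_apply, ← (frameForm w).map_swap _ hij]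
  congr 1
  ext k : 1
  simp only [Function.comp_apply]
  by_cases hki : k = i
  · subst hki
    simp [Function.update_of_ne hij, Function.update_of_ne hij.symm]
  · by_cases hkj : k = j
    · subst hkj
      simp
    · simp [Equiv.swap_apply_of_ne_of_ne hki hkj, hki, hkj]

lemma contDiffOn_frameDet_update {G : Type*} [NormedAddCommGroup G] [NormedSpace ℝ G]
    {k : WithTop ℕ∞} {n : ℕ} {s : Set G} {w z : G → Euc (n + 1)} {x : G → Fin n → Euc (n + 1)}
    (hw : ContDiffOn ℝ k w s) (hz : ContDiffOn ℝ k z s)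
    (hx : ∀ i, ContDiffOn ℝ k (fun t => x t i) s) (i : Fin n) :
    ContDiffOn ℝ k (fun t => frameDet (w t) (Function.update (x t) i (z t))) s := by
  refine contDiffOn_frameDet (v := fun j t => Function.update (x t) i (z t) j) hw fun j => ?_
  by_cases h : j = i
  · subst h
    simpa using hz
  · simpa [h] using hx j

lemma continuousOn_frameDet_update {G : Type*} [TopologicalSpace G]
    {n : ℕ} {s : Set G} {w z : G → Euc (n + 1)} {x : G → Fin n → Euc (n + 1)}
    (hw : ContinuousOn w s) (hz : ContinuousOn z s)
    (hx : ∀ i, ContinuousOn (fun t => x t i) s) (i : Fin n) :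
    ContinuousOn (fun t => frameDet (w t) (Function.update (x t) i (z t))) s := by
  refine continuousOn_frameDet (v := fun j t => Function.update (x t) i (z t) j) hw fun j => ?_
  by_cases h : j = i
  · subst h
    simpa using hz
  · simpa [h] using hx j

lemma frameDet_zero_left {n : ℕ} (x : Fin n → Euc (n + 1)) : frameDet 0 x = 0 := by
  simpa using frameDet_smul_left 0 (0 : Euc (n + 1)) x

lemma frameDet_update_zero {n : ℕ} (w : Euc (n + 1)) (x : Fin n → Euc (n + 1)) (i : Fin n) :
    frameDet w (Function.update x i 0) = 0 := by
  rw [frameDet_update_swap, frameDet_zero_left, neg_zero]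

variable {Y ξ W : Euc (m + 1) → Euc (m + 1 + 1)}

lemma IsHalfSpaceDomain.continuousOn_partialDeriv {F : Type*} [NormedAddCommGroup F]
    [NormedSpace ℝ F] {f : Euc (m + 1) → F} (hT : IsHalfSpaceDomain T) (hf : ContDiffOn ℝ 1 f T)
    (i : Fin (m + 1)) : ContinuousOn (fun u => partialDeriv f u i) T :=
  hT.continuousOn_fderivWithin_apply hf _

lemma IsHalfSpaceDomain.contDiffOn_partialDeriv {F : Type*} [NormedAddCommGroup F]
    [NormedSpace ℝ F] {f : Euc (m + 1) → F} (hT : IsHalfSpaceDomain T) (hf : ContDiffOn ℝ 2 f T)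
    (i : Fin (m + 1)) : ContDiffOn ℝ 1 (fun u => partialDeriv f u i) T :=
  (hT.contDiffOn_fderivWithin (l := 1) (by norm_num) hf).clm_apply contDiffOn_const

/-- Symmetry of second partial derivatives. -/
lemma IsHalfSpaceDomain.partialDeriv_comm {F : Type*} [NormedAddCommGroup F]
    [NormedSpace ℝ F] {f : Euc (m + 1) → F} (hT : IsHalfSpaceDomain T) (hf : ContDiffOn ℝ 2 f T)
    {u : Euc (m + 1)} (hu : u ∈ T) (h0 : 0 < u 0) (i j : Fin (m + 1)) :
    partialDeriv (fun u => partialDeriv f u i) u j =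
      partialDeriv (fun u => partialDeriv f u j) u i := by
  have hf' : ContDiffAt ℝ 2 f u := hf.contDiffAt (hT.mem_nhds hu h0)
  have hd : DifferentiableAt ℝ (fderiv ℝ f) u :=
    (hf'.fderiv_right (m := 1) (by norm_num)).differentiableAt one_ne_zero
  have hsymm : IsSymmSndFDerivAt ℝ f u := hf'.isSymmSndFDerivAt (by simp)
  have key : ∀ i j : Fin (m + 1), partialDeriv (fun u => partialDeriv f u i) u j =
      fderiv ℝ (fderiv ℝ f) u (EuclideanSpace.single j 1) (EuclideanSpace.single i 1) := by
    intro i j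
    have h1 : (fun u => partialDeriv f u i) =ᶠ[𝓝 u]
        fun u => fderiv ℝ f u (EuclideanSpace.single i 1) := by
      have hopen : {u : Euc (m + 1) | 0 < u 0} ∈ 𝓝 u :=
        (isOpen_lt continuous_const (by fun_prop)).mem_nhds h0
      filter_upwards [hopen] with v hv
      rw [partialDeriv, fderivWithin_of_mem_nhds (halfSpace_mem_nhds hv)]
    rw [partialDeriv, fderivWithin_of_mem_nhds (halfSpace_mem_nhds h0), h1.fderiv_eq]
    have h2 := hd.hasFDerivAt.clm_apply
      (hasFDerivAt_const (EuclideanSpace.single i (1 : ℝ) : Euc (m + 1)) u)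
    rw [h2.fderiv]
    simp
  rw [key, key]
  exact hsymm _ _

/-- The divergence of the vector field with components
`det (ξ, ∂₀Y, …, W, …, ∂ₘY)`, with `W` at the `i`-th place. -/
lemma sum_partialDeriv_frameDet (hT : IsHalfSpaceDomain T) (hY : ContDiffOn ℝ 2 Y T)
    (hξ : ContDiffOn ℝ 1 ξ T) (hW : ContDiffOn ℝ 1 W T) {u : Euc (m + 1)} (hu : u ∈ T)
    (h0 : 0 < u 0) :
    ∑ i, partialDeriv (fun u => frameDet (ξ u) (Function.update (partialDeriv Y u) i (W u))) u i =
      (∑ i, frameDet (ξ u) (Function.update (partialDeriv Y u) i (partialDeriv W u i))) -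
      ∑ i, frameDet (W u) (Function.update (partialDeriv Y u) i (partialDeriv ξ u i)) := by
  set x := partialDeriv Y u with hx
  -- The second derivatives of `Y`, whose symmetry removes them from the divergence.
  set h : Fin (m + 1) → Fin (m + 1) → Euc (m + 1 + 1) :=
    fun i j => partialDeriv (fun u => partialDeriv Y u j) u i with hh
  have hsymm : ∀ i j, h i j = h j i := fun i j => hT.partialDeriv_comm hY hu h0 j i
  have hterm : ∀ i, partialDeriv (fun u => frameDet (ξ u)
      (Function.update (partialDeriv Y u) i (W u))) u i =
      -frameDet (W u) (Function.update x i (partialDeriv ξ u i)) +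
        (frameDet (ξ u) (Function.update x i (partialDeriv W u i)) +
          ∑ j, if j = i then 0 else
            frameDet (ξ u) (Function.update (Function.update x i (W u)) j (h i j))) := by
    intro i
    have hv : ∀ j, HasFDerivAt (fun t => Function.update (partialDeriv Y t) i (W t) j)
        (if j = i then fderivWithin ℝ W (range (𝓡∂ (m + 1))) u
          else fderivWithin ℝ (fun u => partialDeriv Y u j) (range (𝓡∂ (m + 1))) u) u := by
      intro j
      by_cases hj : j = i
      · subst hj
        simpa using hT.hasFDerivAt hW hu h0
      · simpa [hj] using hT.hasFDerivAt (hT.contDiffOn_partialDeriv hY j) hu h0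
    obtain ⟨D, hD, hD'⟩ := hasFDerivAt_frameDet (hT.hasFDerivAt hξ hu h0) hv
    have e1 : partialDeriv (fun u => frameDet (ξ u)
        (Function.update (partialDeriv Y u) i (W u))) u i = D (EuclideanSpace.single i 1) := by
      rw [partialDeriv, fderivWithin_of_mem_nhds (halfSpace_mem_nhds h0)]
      exact congrArg (fun L : Euc (m + 1) →L[ℝ] ℝ => L (EuclideanSpace.single i 1)) hD.fderiv
    -- Exchanging the derivative of `ξ` in the first position with `W` in slot `i` gives the minus
    -- sign of the second sum.
    rw [e1, hD', ← frameDet_update_swap]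
    congr 1
    rw [← Finset.add_sum_erase _ _ (Finset.mem_univ i),
      ← Finset.add_sum_erase (Finset.univ) (fun j => if j = i then 0 else
            frameDet (ξ u) (Function.update (Function.update x i (W u)) j (h i j)))
            (Finset.mem_univ i), if_pos rfl, if_pos rfl, zero_add]
    congr 1
    · congr 1
      exact Function.update_idem _ _ _
    · refine Finset.sum_congr rfl fun j hj => ?_
      rw [if_neg (Finset.ne_of_mem_erase hj), if_neg (Finset.ne_of_mem_erase hj)]
      rfl
  simp only [hterm, Finset.sum_add_distrib, Finset.sum_neg_distrib]
  have hcancel : ∑ i, ∑ j, (if j = i then 0 else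
      frameDet (ξ u) (Function.update (Function.update x i (W u)) j (h i j))) = 0 := by
    set S : Fin (m + 1) → Fin (m + 1) → ℝ := fun i j => if j = i then 0 else
      frameDet (ξ u) (Function.update (Function.update x i (W u)) j (h i j)) with hS
    -- Exchanging slots `i` and `j` changes the sign of the determinant while `h i j` is symmetric,
    -- so the double sum is antisymmetric.
    have hanti : ∀ i j, S i j = -S j i := by
      intro i j
      by_cases hij : j = i
      · subst hij
        simp [hS]
      · simp only [hS, if_neg hij, if_neg (Ne.symm hij)]
        rw [frameDet_update_update_swap _ _ _ _ (Ne.symm hij), hsymm i j]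
    have h1 : ∑ i, ∑ j, S i j = -∑ i, ∑ j, S i j := by
      conv_lhs => rw [Finset.sum_comm]
      rw [← Finset.sum_neg_distrib]
      refine Finset.sum_congr rfl fun i _ => ?_
      rw [← Finset.sum_neg_distrib]
      exact Finset.sum_congr rfl fun j _ => hanti j i
    linarith
  rw [hcancel]
  ring

lemma integrableOn_frameDet_partialDeriv (hT : IsHalfSpaceDomain T) (hK : IsCompact K)
    (hKT : K ⊆ T) (hY : ContDiffOn ℝ 1 Y T) (hξ : ContinuousOn ξ T) (hW : ContDiffOn ℝ 1 W T)
    (hW0 : ∀ u ∈ T, u ∉ K → W u = 0) :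
    IntegrableOn (fun u =>
      ∑ i, frameDet (ξ u) (Function.update (partialDeriv Y u) i (partialDeriv W u i))) T := by
  refine integrableOn_of_continuousOn_of_eq_zero hT.measurableSet hK hKT
    (continuousOn_finsetSum _ fun i _ => continuousOn_frameDet_update hξ
      (hT.continuousOn_partialDeriv hW i) (hT.continuousOn_partialDeriv hY) i)
    fun u hu huK => Finset.sum_eq_zero fun i _ => ?_
  rw [partialDeriv, hT.fderivWithin_eq_zero hK.isClosed hW0 hu huK, zero_apply,
    frameDet_update_zero]

lemma integrableOn_frameDet_left (hT : IsHalfSpaceDomain T) (hK : IsCompact K)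
    (hKT : K ⊆ T) (hY : ContDiffOn ℝ 1 Y T) (hξ : ContDiffOn ℝ 1 ξ T) (hW : ContinuousOn W T)
    (hW0 : ∀ u ∈ T, u ∉ K → W u = 0) :
    IntegrableOn (fun u =>
      ∑ i, frameDet (W u) (Function.update (partialDeriv Y u) i (partialDeriv ξ u i))) T := by
  refine integrableOn_of_continuousOn_of_eq_zero hT.measurableSet hK hKT
    (continuousOn_finsetSum _ fun i _ => continuousOn_frameDet_update hW
      (hT.continuousOn_partialDeriv hξ i) (hT.continuousOn_partialDeriv hY) i)
    fun u hu huK => Finset.sum_eq_zero fun i _ => ?_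
  rw [hW0 u hu huK, frameDet_zero_left]

/-- The boundary hyperplane is null, so identities between volume integrands are needed only at
interior points, where `X` is an immersion. -/
lemma ae_restrict_pos (hT : IsHalfSpaceDomain T) :
    ∀ᵐ u ∂(volume.restrict T), u ∈ T ∧ 0 < u 0 := by
  have h1 : ∀ᵐ u ∂(volume.restrict T), u ∈ T := ae_restrict_mem hT.measurableSet
  have h2 : ∀ᵐ u ∂(volume.restrict T), u 0 ≠ 0 :=
    ae_restrict_of_ae (by rw [ae_iff]; simpa using volume_hyperplane_eq_zero)
  filter_upwards [h1, h2] with u hu hu'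
  exact ⟨hu, lt_of_le_of_ne (mem_halfSpace_iff.mp (hT.subset hu)) hu'.symm⟩

/-- Integration by parts for `det (ξ, ∂₀Y, …, ∂ᵢW, …, ∂ₘY)`. -/
theorem integral_frameDet_partialDeriv (hT : IsHalfSpaceDomain T) (hK : IsCompact K)
    (hKT : K ⊆ T) (hY : ContDiffOn ℝ 2 Y T) (hξ : ContDiffOn ℝ 1 ξ T) (hW : ContDiffOn ℝ 1 W T)
    (hW0 : ∀ u ∈ T, u ∉ K → W u = 0) :
    ∫ u in T, ∑ i, frameDet (ξ u) (Function.update (partialDeriv Y u) i (partialDeriv W u i)) =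
      (∫ u in T, ∑ i, frameDet (W u) (Function.update (partialDeriv Y u) i (partialDeriv ξ u i))) -
      ∫ v in {v : Euc m | boundaryPoint v ∈ T}, frameDet (ξ (boundaryPoint v))
        (Fin.cons (W (boundaryPoint v)) fun j => partialDeriv Y (boundaryPoint v) j.succ) := by
  have h := integral_divergence_halfSpace hT hK hKT
    (V := fun i u => frameDet (ξ u) (Function.update (partialDeriv Y u) i (W u)))
    (fun i => contDiffOn_frameDet_update hξ hW (hT.contDiffOn_partialDeriv hY) i)
    (fun i u hu huK => by rw [hW0 u hu huK, frameDet_update_zero])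
  -- Only the zeroth component crosses the boundary hyperplane; in it `W` replaces the transversal
  -- derivative `∂₀Y`.
  have h1 : ∀ v : Euc m, frameDet (ξ (boundaryPoint v)) (Function.update
      (partialDeriv Y (boundaryPoint v)) 0 (W (boundaryPoint v))) =
      frameDet (ξ (boundaryPoint v)) (Fin.cons (W (boundaryPoint v))
        fun j => partialDeriv Y (boundaryPoint v) j.succ) := fun v => by
    congr 1
    ext j : 1
    refine Fin.cases ?_ (fun j => ?_) j <;> simp
  simp only [h1] at h
  have h2 : ∫ u in T, ∑ i, fderivWithin ℝ (fun u => frameDet (ξ u)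
      (Function.update (partialDeriv Y u) i (W u))) (range (𝓡∂ (m + 1))) u
        (EuclideanSpace.single i 1) =
      ∫ u in T, ((∑ i, frameDet (ξ u) (Function.update (partialDeriv Y u) i (partialDeriv W u i))) -
        ∑ i, frameDet (W u) (Function.update (partialDeriv Y u) i (partialDeriv ξ u i))) := by
    refine integral_congr_ae ?_
    filter_upwards [ae_restrict_pos hT] with u hu
    exact sum_partialDeriv_frameDet hT hY hξ hW hu.1 hu.2
  rw [h2, integral_sub (integrableOn_frameDet_partialDeriv hT hK hKT (hY.of_le (by norm_num))
    hξ.continuousOn hW hW0) (integrableOn_frameDet_left hT hK hKT (hY.of_le (by norm_num)) hξ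
    hW.continuousOn hW0)] at h
  linarith

end FrameDivergence

/-! ### Oriented charts -/

section OrientedCharts

variable {m : ℕ} {M : Type*} [TopologicalSpace M] [ChartedSpace (EuclideanHalfSpace (m + 1)) M]
  [IsManifold (𝓡∂ (m + 1)) ∞ M]

/-- The coordinate basis of `T_p M` given by the chart at `c`. -/
def chartBasis (c p : M) (hp : p ∈ (extChartAt (𝓡∂ (m + 1)) c).source) :
    Module.Basis (Fin (m + 1)) ℝ (TangentSpace (𝓡∂ (m + 1)) p) :=
  (EuclideanSpace.basisFun (Fin (m + 1)) ℝ).toBasis.map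
    ((trivializationAt (Euc (m + 1)) (TangentSpace (𝓡∂ (m + 1))) c).continuousLinearEquivAt ℝ p
      (by rwa [TangentBundle.trivializationAt_baseSet,
        ← extChartAt_source (𝓡∂ (m + 1))])).toLinearEquiv.symm

lemma chartBasis_apply {c p : M} (hp : p ∈ (extChartAt (𝓡∂ (m + 1)) c).source) (i : Fin (m + 1)) :
    chartBasis c p hp i = tangentCoordChange (𝓡∂ (m + 1)) c p p (EuclideanSpace.single i 1) := by
  rw [chartBasis, Module.Basis.map_apply]
  have hp' : p ∈ (trivializationAt (Euc (m + 1)) (TangentSpace (𝓡∂ (m + 1))) c).baseSet := by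
    rwa [TangentBundle.trivializationAt_baseSet, ← extChartAt_source (𝓡∂ (m + 1))]
  have h1 := Bundle.Trivialization.symm_continuousLinearEquivAt_eq (R := ℝ)
    (trivializationAt (Euc (m + 1)) (TangentSpace (𝓡∂ (m + 1))) c) hp'
  have h2 := TangentBundle.symmL_trivializationAt_eq_core (𝕜 := ℝ) (I := 𝓡∂ (m + 1)) (b₀ := c)
    (b := p) (by rwa [extChartAt_source] at hp)
  have h3 := congrFun h1 (EuclideanSpace.single i (1 : ℝ))
  rw [h2] at h3
  rw [OrthonormalBasis.coe_toBasis, EuclideanSpace.basisFun_apply]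
  exact h3

lemma chartBasis_repr {c p : M} (hp : p ∈ (extChartAt (𝓡∂ (m + 1)) c).source)
    (v : TangentSpace (𝓡∂ (m + 1)) p) (i : Fin (m + 1)) :
    (chartBasis c p hp).repr v i = tangentCoordChange (𝓡∂ (m + 1)) p c p v i := by
  have hp' : p ∈ (trivializationAt (Euc (m + 1)) (TangentSpace (𝓡∂ (m + 1))) c).baseSet := by
    rwa [TangentBundle.trivializationAt_baseSet, ← extChartAt_source (𝓡∂ (m + 1))]
  have h1 := Bundle.Trivialization.coe_continuousLinearEquivAt_eq (R := ℝ)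
    (trivializationAt (Euc (m + 1)) (TangentSpace (𝓡∂ (m + 1))) c) hp'
  have h2 := TangentBundle.continuousLinearMapAt_trivializationAt_eq_core (𝕜 := ℝ)
    (I := 𝓡∂ (m + 1)) (b₀ := c) (b := p) (by rwa [extChartAt_source] at hp)
  have h3 := congrFun h1 v
  rw [h2] at h3
  rw [chartBasis, Module.Basis.map_repr, LinearEquiv.trans_apply,
    OrthonormalBasis.coe_toBasis_repr_apply]
  exact congrArg (fun w : Euc (m + 1) => w i) h3

/-- The chart at `c` has the constant orientation sign `s` on the open set `U`. -/
structure IsOrientedChart (o : ManifoldOrientation m M) (c : M) (s : ℝ) (U : Set M) : Prop where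
  sign : s = 1 ∨ s = -1
  isOpen : IsOpen U
  mem : c ∈ U
  subset : U ⊆ (extChartAt (𝓡∂ (m + 1)) c).source
  orientation_iff : ∀ p (hp : p ∈ (extChartAt (𝓡∂ (m + 1)) c).source), p ∈ U →
    ∀ b : Module.Basis (Fin (m + 1)) ℝ (TangentSpace (𝓡∂ (m + 1)) p),
      b.orientation = o.at_point p ↔ 0 < s * (chartBasis c p hp).det b

lemma exists_isOrientedChart (o : ManifoldOrientation m M) (c : M) :
    ∃ s U, IsOrientedChart o c s U := by
  obtain ⟨o₀, ho⟩ := o.locally_constant c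
  obtain ⟨V, hV, hVo, hcV⟩ := eventually_nhds_iff.mp ho
  set U := V ∩ (extChartAt (𝓡∂ (m + 1)) c).source with hU
  have hUo : IsOpen U := hVo.inter (isOpen_extChartAt_source c)
  have hcU : c ∈ U := ⟨hcV, mem_extChartAt_source c⟩
  set std := (EuclideanSpace.basisFun (Fin (m + 1)) ℝ).toBasis with hstd
  -- On `U` the trivialization at `c` carries the orientation to the fixed `o₀`, so whether the
  -- coordinate basis is positive is decided once for all `p`, by the standard basis.
  have key : ∀ p (hp : p ∈ (extChartAt (𝓡∂ (m + 1)) c).source), p ∈ U →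
      ((chartBasis c p hp).orientation = o.at_point p ↔ std.orientation = o₀) := by
    intro p hp hpU
    have hp' : p ∈ (trivializationAt (Euc (m + 1)) (TangentSpace (𝓡∂ (m + 1))) c).baseSet := by
      rwa [TangentBundle.trivializationAt_baseSet, ← extChartAt_source (𝓡∂ (m + 1))]
    rw [← hV p hpU.1 hp', chartBasis, Module.Basis.orientation_map, ← Orientation.map_symm,
      Equiv.symm_apply_eq]
  by_cases hs : std.orientation = o₀
  · refine ⟨1, U, Or.inl rfl, hUo, hcU, inter_subset_right, fun p hp hpU b => ?_⟩
    rw [← (key p hp hpU).mpr hs, one_mul, eq_comm]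
    exact Module.Basis.orientation_eq_iff_det_pos _ _
  · refine ⟨-1, U, Or.inr rfl, hUo, hcU, inter_subset_right, fun p hp hpU b => ?_⟩
    have h1 : (chartBasis c p hp).orientation ≠ o.at_point p := fun h => hs ((key p hp hpU).mp h)
    have h2 := (Module.Basis.orientation_ne_iff_eq_neg _ _).mp h1.symm
    rw [h2, ← Module.Basis.orientation_ne_iff_eq_neg, ne_comm, ne_eq,
      Module.Basis.orientation_eq_iff_det_pos]
    have h3 : (chartBasis c p hp).det b ≠ 0 := ((chartBasis c p hp).isUnit_det b).ne_zero
    constructor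
    · intro h
      have := lt_of_le_of_ne (not_lt.mp h) h3
      linarith
    · intro h
      linarith

variable {F : Type*} [NormedAddCommGroup F] [NormedSpace ℝ F]

lemma mvfderiv_chartBasis {f : M → F} (hf : ContMDiff (𝓡∂ (m + 1)) 𝓘(ℝ, F) 1 f) {c p : M}
    (hp : p ∈ (extChartAt (𝓡∂ (m + 1)) c).source) (i : Fin (m + 1)) :
    mvfderiv (𝓡∂ (m + 1)) f p (chartBasis c p hp i) =
      partialDeriv (f ∘ (extChartAt (𝓡∂ (m + 1)) c).symm) (extChartAt (𝓡∂ (m + 1)) c p) i := by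
  rw [mvfderiv_eq_chartDeriv (hf.mdifferentiable one_ne_zero), chartBasis_apply]
  change _ = chartDeriv f c (extChartAt (𝓡∂ (m + 1)) c p) (EuclideanSpace.single i 1)
  rw [chartDeriv_eq_comp hp (mem_extChartAt_source p) (contDiffOn_comp_symm (by simp) hf p)]
  rfl

lemma dmap_chartBasis {X : M → Euc (m + 1 + 1)}
    (hX : ContMDiff (𝓡∂ (m + 1)) 𝓘(ℝ, Euc (m + 1 + 1)) 1 X) {c p : M}
    (hp : p ∈ (extChartAt (𝓡∂ (m + 1)) c).source) (i : Fin (m + 1)) :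
    dmap X p (chartBasis c p hp i) =
      partialDeriv (X ∘ (extChartAt (𝓡∂ (m + 1)) c).symm) (extChartAt (𝓡∂ (m + 1)) c p) i :=
  mvfderiv_chartBasis hX hp i

lemma isHalfSpaceDomain_extChartAt_target (c : M) :
    IsHalfSpaceDomain (extChartAt (𝓡∂ (m + 1)) c).target :=
  ⟨measurableSet_extChartAt_target c, extChartAt_target_subset_range c,
    fun _ hu => extChartAt_target_mem_nhdsWithin_of_mem hu⟩

/-- The field is the gradient of the homogeneous extension, `C¹` away from the origin, composed with
`ν` viewed in Euclidean space. -/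
lemma contMDiff_cahnHoffmanField {γ : Sph (m + 1) → ℝ} (hγ : ContMDiff (𝓡 (m + 1)) 𝓘(ℝ, ℝ) 2 γ)
    {ν : M → Sph (m + 1)} (hν : ContMDiff (𝓡∂ (m + 1)) (𝓡 (m + 1)) 1 ν) :
    ContMDiff (𝓡∂ (m + 1)) 𝓘(ℝ, Euc (m + 1 + 1)) 1 (cahnHoffmanField γ ν) := by
  have := Fact.mk (finrank_euclideanSpace_fin (𝕜 := ℝ) (n := m + 1 + 1))
  have h1 : ContMDiff (𝓡∂ (m + 1)) 𝓘(ℝ, Euc (m + 1 + 1)) 1 fun p => (ν p : Euc (m + 1 + 1)) :=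
    (contMDiff_coe_sphere (n := m + 1)).comp hν
  have h2 : cahnHoffmanField γ ν = fun p => gradient (homExt γ) (ν p : Euc (m + 1 + 1)) :=
    funext fun p => (gradient_homExt_coe (hγ.of_le (by norm_num)) (ν p)).symm
  rw [h2]
  intro p
  have h3 : ContMDiffAt 𝓘(ℝ, Euc (m + 1 + 1)) 𝓘(ℝ, Euc (m + 1 + 1)) 1 (gradient (homExt γ))
      (ν p : Euc (m + 1 + 1)) :=
    (contDiffAt_gradient_homExt hγ (coe_sph_ne_zero (ν p))).contMDiffAt
  exact ContMDiffAt.comp (g := gradient (homExt γ)) (I' := 𝓘(ℝ, Euc (m + 1 + 1))) p h3 (h1 p)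

lemma contMDiff_coe_normal {ν : M → Sph (m + 1)}
    (hν : ContMDiff (𝓡∂ (m + 1)) (𝓡 (m + 1)) 1 ν) :
    ContMDiff (𝓡∂ (m + 1)) 𝓘(ℝ, Euc (m + 1 + 1)) 1 fun p => (ν p : Euc (m + 1 + 1)) := by
  have := Fact.mk (finrank_euclideanSpace_fin (𝕜 := ℝ) (n := m + 1 + 1))
  exact (contMDiff_coe_sphere (n := m + 1)).comp hν

namespace IsWeakImmersion

variable {o : ManifoldOrientation m M} {X : M → Euc (m + 1 + 1)} {ν : M → Sph (m + 1)}

lemma contMDiff_one (h : IsWeakImmersion o X ν) :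
    ContMDiff (𝓡∂ (m + 1)) 𝓘(ℝ, Euc (m + 1 + 1)) 1 X :=
  h.contMDiff_map.of_le (by norm_num)

/-- The normal is orthogonal to the coordinate vector fields, also on the boundary. -/
lemma inner_normal_eq_zero (h : IsWeakImmersion o X ν) {c : M} {u : Euc (m + 1)}
    (hu : u ∈ (extChartAt (𝓡∂ (m + 1)) c).target) (i : Fin (m + 1)) :
    ⟪(ν ((extChartAt (𝓡∂ (m + 1)) c).symm u) : Euc (m + 1 + 1)),
      partialDeriv (X ∘ (extChartAt (𝓡∂ (m + 1)) c).symm) u i⟫ = 0 := by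
  have hT := isHalfSpaceDomain_extChartAt_target (m := m) c
  have h1 : ContinuousOn (fun u => ⟪(ν ((extChartAt (𝓡∂ (m + 1)) c).symm u) : Euc (m + 1 + 1)),
      partialDeriv (X ∘ (extChartAt (𝓡∂ (m + 1)) c).symm) u i⟫)
      (extChartAt (𝓡∂ (m + 1)) c).target := by
    have h0 : ContMDiff (𝓡∂ (m + 1)) 𝓘(ℝ, Euc (m + 1 + 1)) 1
        fun p => (ν p : Euc (m + 1 + 1)) := contMDiff_coe_normal h.contMDiff_normal
    have h3 := contDiffOn_comp_symm (k := 1) (by simp) h0 c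
    have h4 := hT.continuousOn_partialDeriv
      (contDiffOn_comp_symm (m := m) (k := 1) (by simp) h.contMDiff_one c) i
    exact ContinuousOn.inner (𝕜 := ℝ) h3.continuousOn h4
  have h2 : EqOn (fun u => ⟪(ν ((extChartAt (𝓡∂ (m + 1)) c).symm u) : Euc (m + 1 + 1)),
      partialDeriv (X ∘ (extChartAt (𝓡∂ (m + 1)) c).symm) u i⟫) (fun _ => 0)
      (interior (extChartAt (𝓡∂ (m + 1)) c).target) := by
    intro w hw
    have hw' := interior_subset hw
    have hs := (extChartAt (𝓡∂ (m + 1)) c).map_target hw'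
    have h3 := h.normal _ ((mem_interior_symm_iff hw').mpr
      ((mem_interior_extChartAt_target_iff hw').mp hw)) (chartBasis c _ hs i)
    rw [dmap_chartBasis h.contMDiff_one, (extChartAt (𝓡∂ (m + 1)) c).right_inv hw'] at h3
    exact h3
  -- Both sides are continuous on the target, and its interior points are dense in it.
  exact h2.of_subset_closure h1 continuousOn_const interior_subset
    extChartAt_target_subset_closure_interior hu

lemma volumeDensity_eq_abs (h : IsWeakImmersion o X ν) {c : M} {u : Euc (m + 1)}
    (hu : u ∈ (extChartAt (𝓡∂ (m + 1)) c).target) :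
    volumeDensity X c u = |frameDet (ν ((extChartAt (𝓡∂ (m + 1)) c).symm u) : Euc (m + 1 + 1))
      (partialDeriv (X ∘ (extChartAt (𝓡∂ (m + 1)) c).symm) u)| :=
  sqrt_gramDet_eq_abs (norm_coe_sph _) (h.inner_normal_eq_zero hu)

/-- A zero determinant makes the Gram determinant of the coordinate vectors vanish; these are then
dependent, against the immersion property. -/
lemma frameDet_ne_zero (h : IsWeakImmersion o X ν) {c : M} {u : Euc (m + 1)}
    (hu : u ∈ (extChartAt (𝓡∂ (m + 1)) c).target) (h0 : 0 < u 0) :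
    frameDet (ν ((extChartAt (𝓡∂ (m + 1)) c).symm u) : Euc (m + 1 + 1))
      (partialDeriv (X ∘ (extChartAt (𝓡∂ (m + 1)) c).symm) u) ≠ 0 := by
  intro hD
  have hg := frameDet_sq (norm_coe_sph _) (h.inner_normal_eq_zero hu)
  rw [hD, zero_pow two_ne_zero] at hg
  obtain ⟨a, ha, hsum⟩ := exists_sum_smul_eq_zero_of_gramDet_eq_zero hg.symm
  have hs := (extChartAt (𝓡∂ (m + 1)) c).map_target hu
  have h1 : dmap X _ (∑ j, a j • chartBasis c _ hs j) = 0 := by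
    rw [map_sum, ← hsum]
    refine Finset.sum_congr rfl fun j _ => ?_
    rw [map_smul, dmap_chartBasis h.contMDiff_one, (extChartAt (𝓡∂ (m + 1)) c).right_inv hu]
  have h2 := h.immersion _ ((mem_interior_symm_iff hu).mpr h0) (h1.trans (map_zero _).symm)
  exact ha (funext (Fintype.linearIndependent_iff.mp (chartBasis c _ hs).linearIndependent a h2))

/-- In an oriented chart the volume density is the determinant of the normal and the coordinate
vector fields, up to the orientation sign. -/
lemma sign_mul_frameDet (h : IsWeakImmersion o X ν) {c : M} {s : ℝ} {U : Set M}
    (hU : IsOrientedChart o c s U) {u : Euc (m + 1)}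
    (hu : u ∈ (extChartAt (𝓡∂ (m + 1)) c).target) (h0 : 0 < u 0)
    (huU : (extChartAt (𝓡∂ (m + 1)) c).symm u ∈ U) :
    s * frameDet (ν ((extChartAt (𝓡∂ (m + 1)) c).symm u) : Euc (m + 1 + 1))
      (partialDeriv (X ∘ (extChartAt (𝓡∂ (m + 1)) c).symm) u) = volumeDensity X c u := by
  have hs := (extChartAt (𝓡∂ (m + 1)) c).map_target hu
  have h1 := hU.orientation_iff _ hs huU (chartBasis c _ hs)
  have h2 := h.oriented _ ((mem_interior_symm_iff hu).mpr h0) (chartBasis c _ hs)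
  have h3 := h1.symm.trans h2
  rw [Module.Basis.det_self, mul_one] at h3
  have h4 : (fun i => dmap X ((extChartAt (𝓡∂ (m + 1)) c).symm u) (chartBasis c _ hs i)) =
      partialDeriv (X ∘ (extChartAt (𝓡∂ (m + 1)) c).symm) u := funext fun i => by
    rw [dmap_chartBasis h.contMDiff_one, (extChartAt (𝓡∂ (m + 1)) c).right_inv hu]
  rw [h4] at h3
  rw [h.volumeDensity_eq_abs hu]
  rcases hU.sign with rfl | rfl
  · rw [abs_of_pos (h3.mp one_pos), one_mul]
  · rw [abs_of_nonpos (not_lt.mp fun h => by linarith [h3.mpr h]), neg_one_mul]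

end IsWeakImmersion

end OrientedCharts

/-! ### The anisotropic mean curvature in a chart -/

section MeanCurvature

variable {m : ℕ} {M : Type*} [TopologicalSpace M] [ChartedSpace (EuclideanHalfSpace (m + 1)) M]
  [IsManifold (𝓡∂ (m + 1)) ∞ M] {o : ManifoldOrientation m M} {X : M → Euc (m + 1 + 1)}
  {ν : M → Sph (m + 1)} {γ : Sph (m + 1) → ℝ}

/-- The derivative of the Cahn-Hoffman field is orthogonal to the normal. -/
lemma inner_normal_partialDeriv_cahnHoffmanField (hγ : ContMDiff (𝓡 (m + 1)) 𝓘(ℝ, ℝ) 2 γ)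
    (hν : ContMDiff (𝓡∂ (m + 1)) (𝓡 (m + 1)) 1 ν) {c : M} {u : Euc (m + 1)}
    (hu : u ∈ (extChartAt (𝓡∂ (m + 1)) c).target) (h0 : 0 < u 0) (i : Fin (m + 1)) :
    ⟪(ν ((extChartAt (𝓡∂ (m + 1)) c).symm u) : Euc (m + 1 + 1)),
      partialDeriv (cahnHoffmanField γ ν ∘ (extChartAt (𝓡∂ (m + 1)) c).symm) u i⟫ = 0 := by
  have hT := isHalfSpaceDomain_extChartAt_target (m := m) c
  have hγ1 : ContMDiff (𝓡 (m + 1)) 𝓘(ℝ, ℝ) 1 γ := hγ.of_le (by norm_num)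
  set n : Euc (m + 1) → Euc (m + 1 + 1) :=
    (fun p => (ν p : Euc (m + 1 + 1))) ∘ (extChartAt (𝓡∂ (m + 1)) c).symm with hn
  set Ξ : Euc (m + 1) → Euc (m + 1 + 1) :=
    cahnHoffmanField γ ν ∘ (extChartAt (𝓡∂ (m + 1)) c).symm with hΞ
  have h1 := hT.hasFDerivAt (contDiffOn_comp_symm (k := 1) (by simp)
    (contMDiff_coe_normal (m := m) hν) c) hu h0
  have h2 := hT.hasFDerivAt (contDiffOn_comp_symm (k := 1) (by simp)
    (contMDiff_cahnHoffmanField hγ hν) c) hu h0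
  have h3 := h2.inner ℝ h1
  have h4 : HasFDerivAt (homExt γ) (fderiv ℝ (homExt γ) (n u)) (n u) :=
    ((contDiffAt_homExt hγ1 (coe_sph_ne_zero _)).differentiableAt one_ne_zero).hasFDerivAt
  have h5 := h4.comp u h1
  -- Euler's relation. When both sides are differentiated, the terms `⟪ξ̃, ∂ᵢn⟫` cancel, because
  -- `ξ̃` is the gradient of the extension at `n`, and `⟪∂ᵢξ̃, n⟫ = 0` remains.
  have h6 : (fun t => ⟪Ξ t, n t⟫) = homExt γ ∘ n := funext fun t => by
    simp only [hn, hΞ, Function.comp_apply, cahnHoffmanField]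
    rw [inner_cahnHoffman_self hγ1, homExt_coe]
  have h7 := congrArg (fun L : Euc (m + 1) →L[ℝ] ℝ => L (EuclideanSpace.single i 1))
    (h3.unique (h6 ▸ h5))
  simp only [ContinuousLinearMap.comp_apply, fderivInnerCLM_apply,
    ContinuousLinearMap.prod_apply] at h7
  have h8 : ⟪Ξ u, partialDeriv n u i⟫ + ⟪partialDeriv Ξ u i, n u⟫ = ⟪Ξ u, partialDeriv n u i⟫ :=
    h7.trans (fderiv_homExt_coe hγ1 (ν ((extChartAt (𝓡∂ (m + 1)) c).symm u)) _)
  rw [real_inner_comm]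
  exact left_eq_add.mp h8.symm

namespace IsWeakImmersion

/-- The image of `dX_p` lies in the orthogonal complement of `ν`, and both have dimension `m + 1`.
-/
lemma exists_dmap_eq (h : IsWeakImmersion o X ν) {p : M}
    (hp : p ∈ (𝓡∂ (m + 1)).interior M) {w : Euc (m + 1 + 1)}
    (hw : ⟪(ν p : Euc (m + 1 + 1)), w⟫ = 0) : ∃ v, dmap X p v = w := by
  have hfin : Module.finrank ℝ (TangentSpace (𝓡∂ (m + 1)) p) = m + 1 :=
    finrank_euclideanSpace_fin (𝕜 := ℝ) (n := m + 1)
  have := Fact.mk (finrank_euclideanSpace_fin (𝕜 := ℝ) (n := m + 1 + 1))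
  have h1 : LinearMap.range (dmap X p) = (Submodule.span ℝ {(ν p : Euc (m + 1 + 1))})ᗮ := by
    apply Submodule.eq_of_le_of_finrank_eq
    · rintro _ ⟨v, rfl⟩
      exact Submodule.mem_orthogonal_singleton_iff_inner_right.mpr (h.normal p hp v)
    · rw [LinearMap.finrank_range_of_inj (h.immersion p hp), hfin,
        Submodule.finrank_orthogonal_span_singleton (n := m + 1) (coe_sph_ne_zero (ν p))]
  have h2 : w ∈ LinearMap.range (dmap X p) := by
    rw [h1]
    exact Submodule.mem_orthogonal_singleton_iff_inner_right.mpr hw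
  exact h2

/-- At interior points the derivative of `ξ̃` is orthogonal to `ν`, hence takes values in the image
of `dX_p`. So a shape operator exists and the default value is not taken. -/
lemma dmap_shapeOperator (h : IsWeakImmersion o X ν) (hγ : ContMDiff (𝓡 (m + 1)) 𝓘(ℝ, ℝ) 2 γ)
    {p : M} (hp : p ∈ (𝓡∂ (m + 1)).interior M) (v : TangentSpace (𝓡∂ (m + 1)) p) :
    dmap X p (shapeOperator γ X ν p v) = -dmap (cahnHoffmanField γ ν) p v := by
  have hs := mem_extChartAt_source (I := 𝓡∂ (m + 1)) p
  set e := chartBasis p p hs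
  have h1 : ∀ i, ∃ w, dmap X p w = -dmap (cahnHoffmanField γ ν) p (e i) := fun i => by
    apply h.exists_dmap_eq hp
    rw [inner_neg_right, neg_eq_zero, dmap_chartBasis (contMDiff_cahnHoffmanField hγ
      h.contMDiff_normal)]
    have := inner_normal_partialDeriv_cahnHoffmanField hγ h.contMDiff_normal
      (mem_extChartAt_target (I := 𝓡∂ (m + 1)) p) ((mem_interior_iff_extChartAt hs).mp hp) i
    rwa [extChartAt_to_inv] at this
  choose w hw using h1
  have h2 : ∃ S : TangentSpace (𝓡∂ (m + 1)) p →ₗ[ℝ] TangentSpace (𝓡∂ (m + 1)) p,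
      ∀ v, dmap X p (S v) = -dmap (cahnHoffmanField γ ν) p v := by
    refine ⟨e.constr ℝ w, fun v => ?_⟩
    have : (dmap X p).comp (e.constr ℝ w) = -dmap (cahnHoffmanField γ ν) p :=
      e.ext fun i => by
        rw [LinearMap.comp_apply, e.constr_basis, hw]
        rfl
    exact congrArg (fun L => L v) this
  rw [shapeOperator, dif_pos h2]
  exact h2.choose_spec v

/-- The derivative of the Cahn-Hoffman field in an oriented chart gives the anisotropic mean
curvature. -/
lemma sum_frameDet_cahnHoffmanField (h : IsWeakImmersion o X ν)
    (hγ : ContMDiff (𝓡 (m + 1)) 𝓘(ℝ, ℝ) 2 γ) {c : M} {s : ℝ} {U : Set M}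
    (hU : IsOrientedChart o c s U) {u : Euc (m + 1)}
    (hu : u ∈ (extChartAt (𝓡∂ (m + 1)) c).target) (h0 : 0 < u 0)
    (huU : (extChartAt (𝓡∂ (m + 1)) c).symm u ∈ U) (w : Euc (m + 1 + 1)) :
    s * ∑ i, frameDet w
      (Function.update (partialDeriv (X ∘ (extChartAt (𝓡∂ (m + 1)) c).symm) u) i
        (partialDeriv (cahnHoffmanField γ ν ∘ (extChartAt (𝓡∂ (m + 1)) c).symm) u i)) =
      -(volumeDensity X c u * (((m + 1 : ℕ) : ℝ) *
        anisotropicMeanCurvature γ X ν ((extChartAt (𝓡∂ (m + 1)) c).symm u) *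
        ⟪w, (ν ((extChartAt (𝓡∂ (m + 1)) c).symm u) : Euc (m + 1 + 1))⟫)) := by
  set p := (extChartAt (𝓡∂ (m + 1)) c).symm u with hp
  have hs : p ∈ (extChartAt (𝓡∂ (m + 1)) c).source := (extChartAt (𝓡∂ (m + 1)) c).map_target hu
  have hpi : p ∈ (𝓡∂ (m + 1)).interior M := (mem_interior_symm_iff hu).mpr h0
  have hup : extChartAt (𝓡∂ (m + 1)) c p = u := (extChartAt (𝓡∂ (m + 1)) c).right_inv hu
  have h1 : (fun j => dmap X p (chartBasis c p hs j)) =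
      partialDeriv (X ∘ (extChartAt (𝓡∂ (m + 1)) c).symm) u := funext fun j => by
    rw [dmap_chartBasis h.contMDiff_one, hup]
  have h2 : ∀ i, dmap X p (shapeOperator γ X ν p (chartBasis c p hs i)) =
      -partialDeriv (cahnHoffmanField γ ν ∘ (extChartAt (𝓡∂ (m + 1)) c).symm) u i := fun i => by
    rw [h.dmap_shapeOperator hγ hpi,
      dmap_chartBasis (contMDiff_cahnHoffmanField hγ h.contMDiff_normal), hup]
  -- As `∂ᵢξ̃ = -dX(S eᵢ)`, the sum is minus the trace of `S` times `det (w, ∂X)`, in which only the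
  -- normal component of `w` counts.
  have h3 := frameDet_trace (chartBasis c p hs) (dmap X p) (shapeOperator γ X ν p) w
  simp only [h1, h2, ← frameForm_apply, AlternatingMap.map_update_neg] at h3
  rw [frameForm_apply, frameDet_eq_inner_mul (norm_coe_sph (ν p)) (h.inner_normal_eq_zero hu),
    Finset.sum_neg_distrib] at h3
  have h4 : ((m + 1 : ℕ) : ℝ) * anisotropicMeanCurvature γ X ν p =
      LinearMap.trace ℝ _ (shapeOperator γ X ν p) := by
    rw [anisotropicMeanCurvature, ← mul_assoc, mul_one_div_cancel (by positivity), one_mul]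
  rw [h4, ← h.sign_mul_frameDet hU hu h0 huU]
  simp only [← frameForm_apply] at h3 ⊢
  linear_combination (-s) * h3

end IsWeakImmersion

end MeanCurvature

/-! ### The conormal in a chart -/

section Conormal

variable {m : ℕ} {M : Type*} [TopologicalSpace M] [ChartedSpace (EuclideanHalfSpace (m + 1)) M]
  [IsManifold (𝓡∂ (m + 1)) ∞ M] {o : ManifoldOrientation m M} {X : M → Euc (m + 1 + 1)}
  {ν : M → Sph (m + 1)} {γ : Sph (m + 1) → ℝ}

lemma extChartAt_self_zero {c p : M} (hp : p ∈ (extChartAt (𝓡∂ (m + 1)) c).source)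
    (h0 : extChartAt (𝓡∂ (m + 1)) c p 0 = 0) : extChartAt (𝓡∂ (m + 1)) p p 0 = 0 :=
  (extChartAt_zero_eq_zero_iff hp (mem_extChartAt_source p)).mp h0

lemma boundaryComponent_chartBasis_zero {c p : M}
    (hp : p ∈ (extChartAt (𝓡∂ (m + 1)) c).source)
    (h0 : extChartAt (𝓡∂ (m + 1)) c p 0 = 0) : 0 < boundaryComponent p (chartBasis c p hp 0) := by
  rw [chartBasis_apply]
  exact tangentCoordChange_zero_pos hp (mem_extChartAt_source p) h0 (by simp)

lemma boundaryComponent_chartBasis_succ {c p : M}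
    (hp : p ∈ (extChartAt (𝓡∂ (m + 1)) c).source)
    (h0 : extChartAt (𝓡∂ (m + 1)) c p 0 = 0) (j : Fin m) :
    boundaryComponent p (chartBasis c p hp j.succ) = 0 := by
  rw [chartBasis_apply]
  refine tangentCoordChange_zero_eq_zero hp (mem_extChartAt_source p) h0 ?_
  simp [(Fin.succ_ne_zero j).symm]

lemma chartBasis_repr_zero_eq_zero {c p : M} (hp : p ∈ (extChartAt (𝓡∂ (m + 1)) c).source)
    (h0 : extChartAt (𝓡∂ (m + 1)) c p 0 = 0) {v : TangentSpace (𝓡∂ (m + 1)) p}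
    (hv : boundaryComponent p v = 0) : (chartBasis c p hp).repr v 0 = 0 := by
  rw [chartBasis_repr]
  exact tangentCoordChange_zero_eq_zero (mem_extChartAt_source p) hp (extChartAt_self_zero hp h0) hv

lemma chartBasis_repr_zero_neg {c p : M} (hp : p ∈ (extChartAt (𝓡∂ (m + 1)) c).source)
    (h0 : extChartAt (𝓡∂ (m + 1)) c p 0 = 0) {v : TangentSpace (𝓡∂ (m + 1)) p}
    (hv : boundaryComponent p v < 0) : (chartBasis c p hp).repr v 0 < 0 := by
  have h1 : 0 < tangentCoordChange (𝓡∂ (m + 1)) p c p (-v) 0 :=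
    tangentCoordChange_zero_pos (mem_extChartAt_source p) hp (extChartAt_self_zero hp h0)
      (neg_pos.mpr hv)
  rw [chartBasis_repr]
  have h2 : tangentCoordChange (𝓡∂ (m + 1)) p c p (-v) 0 =
      -tangentCoordChange (𝓡∂ (m + 1)) p c p v 0 :=
    congrArg (fun z : Euc (m + 1) => z 0)
      (map_neg (tangentCoordChange (𝓡∂ (m + 1)) p c p) (v : Euc (m + 1)))
  linarith

/-- A unit vector orthogonal to a unit vector and to `k` vectors in dimension `k + 2`. -/
lemma exists_unit_orthogonal {k : ℕ} (w : Euc (k + 1 + 1)) (y : Fin k → Euc (k + 1 + 1)) :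
    ∃ N : Euc (k + 1 + 1), ‖N‖ = 1 ∧ ⟪w, N⟫ = 0 ∧ ∀ j, ⟪N, y j⟫ = 0 := by
  set V : Submodule ℝ (Euc (k + 1 + 1)) :=
    Submodule.span ℝ (range (Fin.cons w y : Fin (k + 1) → Euc (k + 1 + 1)))
  have h1 : Module.finrank ℝ V ≤ k + 1 :=
    (finrank_range_le_card (R := ℝ) _).trans_eq (Fintype.card_fin _)
  have h2 := V.finrank_add_finrank_orthogonal
  rw [finrank_euclideanSpace_fin] at h2
  have h3 : 0 < Module.finrank ℝ Vᗮ := by omega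
  have := Module.finrank_pos_iff.mp h3
  obtain ⟨⟨z, hz⟩, hz0⟩ := exists_ne (0 : Vᗮ)
  have hz1 : z ≠ 0 := fun h => hz0 (Subtype.ext h)
  have hmem : ∀ i, ⟪(Fin.cons w y : Fin (k + 1) → Euc (k + 1 + 1)) i, z⟫ = 0 := fun i =>
    (Submodule.mem_orthogonal _ _).mp hz _ (Submodule.subset_span (mem_range_self i))
  refine ⟨‖z‖⁻¹ • z, norm_smul_inv_norm hz1, ?_, fun j => ?_⟩
  · rw [real_inner_smul_right]
    have := hmem 0
    rw [Fin.cons_zero] at this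
    rw [this, mul_zero]
  · rw [real_inner_smul_left, real_inner_comm]
    have := hmem j.succ
    rw [Fin.cons_succ] at this
    rw [this, mul_zero]

/-- The sign of the frame determinant of an outward-pointing conormal in an oriented chart. -/
lemma IsOutwardConormal.frameDet_eq {N : Euc (m + 1 + 1)} {c : M} {s : ℝ} {U : Set M}
    (h : IsWeakImmersion o X ν) (hU : IsOrientedChart o c s U) {u : Euc (m + 1)}
    (hu : u ∈ (extChartAt (𝓡∂ (m + 1)) c).target) (h0 : u 0 = 0)
    (huU : (extChartAt (𝓡∂ (m + 1)) c).symm u ∈ U)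
    (hN : IsOutwardConormal o X ν ((extChartAt (𝓡∂ (m + 1)) c).symm u) N) :
    frameDet (ν ((extChartAt (𝓡∂ (m + 1)) c).symm u) : Euc (m + 1 + 1)) (Fin.cons N
      fun j : Fin m => partialDeriv (X ∘ (extChartAt (𝓡∂ (m + 1)) c).symm) u j.succ) =
      -(s * boundaryDensity X c u) ∧
    ∀ j : Fin m, ⟪N, partialDeriv (X ∘ (extChartAt (𝓡∂ (m + 1)) c).symm) u j.succ⟫ = 0 := by
  set p := (extChartAt (𝓡∂ (m + 1)) c).symm u with hp
  have hs : p ∈ (extChartAt (𝓡∂ (m + 1)) c).source := (extChartAt (𝓡∂ (m + 1)) c).map_target hu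
  have hup : extChartAt (𝓡∂ (m + 1)) c p = u := (extChartAt (𝓡∂ (m + 1)) c).right_inv hu
  have hc0 : extChartAt (𝓡∂ (m + 1)) c p 0 = 0 := by rw [hup, h0]
  have h1 : ∀ j, dmap X p (chartBasis c p hs j) =
      partialDeriv (X ∘ (extChartAt (𝓡∂ (m + 1)) c).symm) u j := fun j => by
    rw [dmap_chartBasis h.contMDiff_one, hup]
  have hNy : ∀ j : Fin m, ⟪N, partialDeriv (X ∘ (extChartAt (𝓡∂ (m + 1)) c).symm) u j.succ⟫ = 0 :=
    fun j => by
      rw [← h1]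
      exact hN.orthogonal_boundary _ (boundaryComponent_chartBasis_succ hs hc0 j)
  refine ⟨?_, hNy⟩
  -- This fixes the determinant up to sign; the orientation condition on `N` decides the sign.
  have hsq := frameDet_cons_sq (norm_coe_sph (ν p)) hN.norm_eq_one
    ((real_inner_comm _ _).trans hN.orthogonal_normal)
    (fun j : Fin m => h.inner_normal_eq_zero hu j.succ) hNy
  have habs := congrArg Real.sqrt hsq
  rw [Real.sqrt_sq_eq_abs] at habs
  -- The zeroth coordinate vector points inward and is reversed to test the outward condition. Hence
  -- the determinant `-1` of `b`, and the minus sign in the claim.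
  set w : Fin (m + 1) → ℝˣ := Fin.cons (-1) fun _ => 1 with hw
  set b := (chartBasis c p hs).unitsSMul w with hb
  have hb0 : b 0 = -chartBasis c p hs 0 := by
    rw [hb, Module.Basis.unitsSMul_apply, hw, Fin.cons_zero,
      Units.smul_def, Units.val_neg, Units.val_one, neg_smul, one_smul]
  have hbs : ∀ j : Fin m, b j.succ = chartBasis c p hs j.succ := fun j => by
    rw [hb, Module.Basis.unitsSMul_apply, hw, Fin.cons_succ, one_smul]
  have hdet : (chartBasis c p hs).det b = -1 := by
    rw [hb, Module.Basis.det_unitsSMul_self, Fin.prod_univ_succ]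
    simp [hw]
  have h2 := hN.outward b (by
    rw [hb0]
    have := boundaryComponent_chartBasis_zero hs hc0
    change -boundaryComponent p (chartBasis c p hs 0) < 0
    linarith) (fun j => by rw [hbs, boundaryComponent_chartBasis_succ hs hc0])
  rw [hU.orientation_iff p hs huU, hdet] at h2
  simp only [hbs, h1] at h2
  change |_| = boundaryDensity X c u at habs
  rw [← habs]
  rcases hU.sign with rfl | rfl
  · rw [abs_of_nonpos (not_lt.mp fun h => by linarith [h2.mpr h])]
    ring
  · rw [abs_of_pos (h2.mp (by norm_num))]
    ring

/-- The outward-pointing conormal exists where the boundary density does not vanish. -/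
lemma IsWeakImmersion.exists_isOutwardConormal {c : M} {s : ℝ} {U : Set M}
    (h : IsWeakImmersion o X ν) (hU : IsOrientedChart o c s U) {u : Euc (m + 1)}
    (hu : u ∈ (extChartAt (𝓡∂ (m + 1)) c).target) (h0 : u 0 = 0)
    (huU : (extChartAt (𝓡∂ (m + 1)) c).symm u ∈ U) (hd : boundaryDensity X c u ≠ 0) :
    ∃ N, IsOutwardConormal o X ν ((extChartAt (𝓡∂ (m + 1)) c).symm u) N := by
  set p := (extChartAt (𝓡∂ (m + 1)) c).symm u with hp
  have hs : p ∈ (extChartAt (𝓡∂ (m + 1)) c).source := (extChartAt (𝓡∂ (m + 1)) c).map_target hu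
  have hup : extChartAt (𝓡∂ (m + 1)) c p = u := (extChartAt (𝓡∂ (m + 1)) c).right_inv hu
  have hc0 : extChartAt (𝓡∂ (m + 1)) c p 0 = 0 := by rw [hup, h0]
  set e := chartBasis c p hs with he
  set y : Fin m → Euc (m + 1 + 1) :=
    fun j => partialDeriv (X ∘ (extChartAt (𝓡∂ (m + 1)) c).symm) u j.succ with hy
  have h1 : ∀ j : Fin m, dmap X p (e j.succ) = y j := fun j => by
    rw [he, dmap_chartBasis h.contMDiff_one, hup]
  have hνy : ∀ j, ⟪(ν p : Euc (m + 1 + 1)), y j⟫ = 0 := fun j => h.inner_normal_eq_zero hu j.succ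
  have hd0 : 0 < boundaryDensity X c u := lt_of_le_of_ne (Real.sqrt_nonneg _) hd.symm
  have hss : s * s = 1 := by rcases hU.sign with rfl | rfl <;> norm_num
  -- A unit vector orthogonal to `ν` and to the `y j` serves after a choice of sign: the squared
  -- determinant is the Gram determinant of the `y j`, which is nonzero because the boundary density
  -- is.
  obtain ⟨N, hN1, hνN, hNy, hND⟩ : ∃ N : Euc (m + 1 + 1), ‖N‖ = 1 ∧
      ⟪(ν p : Euc (m + 1 + 1)), N⟫ = 0 ∧ (∀ j, ⟪N, y j⟫ = 0) ∧
      s * frameDet (ν p : Euc (m + 1 + 1)) (Fin.cons N y) < 0 := by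
    obtain ⟨N, hN1, hνN, hNy⟩ := exists_unit_orthogonal (ν p : Euc (m + 1 + 1)) y
    have hsq := frameDet_cons_sq (norm_coe_sph (ν p)) hN1 hνN hνy hNy
    have hne : s * frameDet (ν p : Euc (m + 1 + 1)) (Fin.cons N y) ≠ 0 := by
      refine mul_ne_zero (left_ne_zero_of_mul (hss ▸ one_ne_zero)) fun h => hd ?_
      rw [h, zero_pow two_ne_zero] at hsq
      rw [boundaryDensity_eq]
      change √(gramDet y) = 0
      rw [← hsq, Real.sqrt_zero]
    rcases lt_or_gt_of_ne hne with h | h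
    · exact ⟨N, hN1, hνN, hNy, h⟩
    · refine ⟨(-1 : ℝ) • N, ?_, ?_, fun j => ?_, ?_⟩
      · rw [norm_smul, hN1]
        norm_num
      · rw [real_inner_smul_right, hνN, mul_zero]
      · rw [real_inner_smul_left, hNy, mul_zero]
      · rw [frameDet_cons_smul]
        linarith
  have hsum : ∀ v, boundaryComponent p v = 0 →
      v = ∑ j : Fin m, e.repr v j.succ • e j.succ := fun v hv => by
    conv_lhs => rw [← e.sum_repr v]
    rw [Fin.sum_univ_succ, chartBasis_repr_zero_eq_zero hs hc0 hv, zero_smul, zero_add]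
  have hortho : ∀ v, boundaryComponent p v = 0 → ⟪N, dmap X p v⟫ = 0 := fun v hv => by
    rw [hsum v hv, map_sum, inner_sum]
    refine Finset.sum_eq_zero fun j _ => ?_
    rw [map_smul, h1, real_inner_smul_right, hNy, mul_zero]
  have hortho' : ∀ v, boundaryComponent p v = 0 →
      ⟪(ν p : Euc (m + 1 + 1)), dmap X p v⟫ = 0 := fun v hv => by
    rw [hsum v hv, map_sum, inner_sum]
    refine Finset.sum_eq_zero fun j _ => ?_
    rw [map_smul, h1, real_inner_smul_right, hνy, mul_zero]
  refine ⟨N, hN1, (real_inner_comm _ _).trans hνN, hortho, fun b hb0 hbs => ?_⟩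
  rw [hU.orientation_iff p hs huU]
  -- `dX` may be singular transversally to the boundary, so it is replaced by a map that agrees with
  -- it along the boundary and sends the inward vector `e 0` to `N`. The determinant of its values
  -- on `b` relates the orientation of `b` to that of the conormal frame.
  set A := e.constr ℝ (Fin.cons N y : Fin (m + 1) → Euc (m + 1 + 1)) with hA
  have hA0 : A (e 0) = N := by rw [hA, e.constr_basis, Fin.cons_zero]
  have hAs : ∀ j : Fin m, A (e j.succ) = y j := fun j => by rw [hA, e.constr_basis, Fin.cons_succ]
  have hAb : ∀ j : Fin m, A (b j.succ) = dmap X p (b j.succ) := fun j => by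
    rw [hsum _ (hbs j), map_sum, map_sum]
    refine Finset.sum_congr rfl fun k _ => ?_
    rw [map_smul, map_smul, hAs, h1]
  have hAb0 : ⟪A (b 0), N⟫ = e.repr (b 0) 0 := by
    conv_lhs => rw [← e.sum_repr (b 0)]
    rw [Fin.sum_univ_succ, map_add, map_sum, inner_add_left, sum_inner, map_smul, hA0,
      real_inner_smul_left, real_inner_self_eq_norm_sq, hN1, one_pow, mul_one,
      Finset.sum_eq_zero, add_zero]
    intro j _
    rw [map_smul, hAs, real_inner_smul_left, real_inner_comm, hNy, mul_zero]
  have hκ := chartBasis_repr_zero_neg hs hc0 hb0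
  have h2 := frameDet_comp_basis e A (ν p : Euc (m + 1 + 1)) b
  have h3 : (fun j => A (e j)) = Fin.cons N y := funext (Fin.cases hA0 hAs)
  have h4 : (fun j => A (b j)) = Fin.cons (A (b 0)) fun j : Fin m => dmap X p (b j.succ) :=
    funext (Fin.cases rfl hAb)
  rw [h3, h4, frameDet_cons_eq (norm_coe_sph (ν p)) hN1 hνN (fun j => hortho' _ (hbs j))
    (fun j => hortho _ (hbs j)), hνN, hAb0, real_inner_self_eq_norm_sq, norm_coe_sph, one_pow,
    one_mul, zero_mul, sub_zero] at h2
  have h5 : e.repr (b 0) 0 * frameDet (ν p : Euc (m + 1 + 1))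
      (Fin.cons N fun j : Fin m => dmap X p (b j.succ)) =
      (s * frameDet (ν p : Euc (m + 1 + 1)) (Fin.cons N y)) * (s * e.det b) := by
    rw [h2]
    linear_combination (-frameDet (ν p : Euc (m + 1 + 1)) (Fin.cons N y) * e.det b) * hss
  constructor
  · intro h6
    by_contra h7
    have h8 := mul_nonneg_of_nonpos_of_nonpos hκ.le (not_lt.mp h7)
    have h9 := mul_neg_of_neg_of_pos hND h6
    linarith
  · intro h6
    by_contra h7
    have h8 := mul_neg_of_neg_of_pos hκ h6
    have h9 := mul_nonneg_of_nonpos_of_nonpos hND.le (not_lt.mp h7)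
    linarith

/-- The rotation only uses inner products with `N` and `ν`, which lie in the plane, so the
projection can be dropped. -/
lemma inner_planeRotation_planeProjection {k : ℕ} (N ν ξ w : Euc k) :
    ⟪w, planeRotation N ν (planeProjection N ν ξ)⟫ = ⟪ξ, N⟫ * ⟪w, ν⟫ - ⟪ξ, ν⟫ * ⟪w, N⟫ := by
  have h : ∀ z ∈ Submodule.span ℝ {N, ν}, ⟪planeProjection N ν ξ, z⟫ = ⟪ξ, z⟫ := fun z hz => by
    have := Submodule.starProjection_inner_eq_zero (K := Submodule.span ℝ {N, ν}) ξ z hz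
    rw [inner_sub_left] at this
    rw [planeProjection]
    linarith
  rw [planeRotation, h N (Submodule.subset_span (by simp)), h ν (Submodule.subset_span (by simp)),
    inner_sub_right, real_inner_smul_right, real_inner_smul_right]

/-- The boundary term in an oriented chart. -/
lemma IsWeakImmersion.frameDet_cons_cahnHoffmanField {c : M} {s : ℝ} {U : Set M}
    (h : IsWeakImmersion o X ν) (hU : IsOrientedChart o c s U) {u : Euc (m + 1)}
    (hu : u ∈ (extChartAt (𝓡∂ (m + 1)) c).target) (h0 : u 0 = 0)
    (huU : (extChartAt (𝓡∂ (m + 1)) c).symm u ∈ U) (w : Euc (m + 1 + 1)) :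
    s * frameDet (cahnHoffmanField γ ν ((extChartAt (𝓡∂ (m + 1)) c).symm u)) (Fin.cons w
      fun j : Fin m => partialDeriv (X ∘ (extChartAt (𝓡∂ (m + 1)) c).symm) u j.succ) =
      boundaryDensity X c u *
        ⟪w, boundaryField o γ X ν ((extChartAt (𝓡∂ (m + 1)) c).symm u)⟫ := by
  have hss : s * s = 1 := by rcases hU.sign with rfl | rfl <;> norm_num
  -- At density zero the conormal may be the default `0`, but both sides vanish, since the boundary
  -- derivatives of `X` are dependent.
  by_cases hd : boundaryDensity X c u = 0
  · have hg : gramDet (fun j : Fin m =>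
        partialDeriv (X ∘ (extChartAt (𝓡∂ (m + 1)) c).symm) u j.succ) = 0 := by
      -- `N` serves only to exhibit the Gram determinant as a square: a vanishing real square root
      -- alone gives `≤ 0`.
      have hN := exists_unit_orthogonal
        (ν ((extChartAt (𝓡∂ (m + 1)) c).symm u) : Euc (m + 1 + 1)) fun j : Fin m =>
        partialDeriv (X ∘ (extChartAt (𝓡∂ (m + 1)) c).symm) u j.succ
      obtain ⟨N, hN1, hνN, hNy⟩ := hN
      have hsq := frameDet_cons_sq (norm_coe_sph _) hN1 hνN
        (fun j : Fin m => h.inner_normal_eq_zero hu j.succ) hNy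
      have hd' := hd
      rw [boundaryDensity_eq, Real.sqrt_eq_zero'] at hd'
      exact le_antisymm hd' (hsq ▸ sq_nonneg _)
    rw [hd, zero_mul, frameDet_eq_zero_of_gramDet_eq_zero hg, mul_zero]
  · have hex := h.exists_isOutwardConormal hU hu h0 huU hd
    have hN : IsOutwardConormal o X ν ((extChartAt (𝓡∂ (m + 1)) c).symm u)
        (conormal o X ν ((extChartAt (𝓡∂ (m + 1)) c).symm u)) := by
      rw [conormal, dif_pos hex]
      exact hex.choose_spec
    obtain ⟨h1, h2⟩ := hN.frameDet_eq h hU hu h0 huU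
    rw [frameDet_cons_eq (norm_coe_sph (ν ((extChartAt (𝓡∂ (m + 1)) c).symm u))) hN.norm_eq_one
      ((real_inner_comm _ _).trans hN.orthogonal_normal)
      (fun j : Fin m => h.inner_normal_eq_zero hu j.succ) h2, h1, boundaryField,
      inner_planeRotation_planeProjection]
    have h3 : s * -(s * boundaryDensity X c u) = -boundaryDensity X c u := by
      linear_combination (-boundaryDensity X c u) * hss
    rw [mul_left_comm, h3]
    ring

end Conormal

/-! ### The density of the first variation -/

section VariationDensity

variable {m : ℕ} {M : Type*} [TopologicalSpace M] [ChartedSpace (EuclideanHalfSpace (m + 1)) M]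
  [IsManifold (𝓡∂ (m + 1)) ∞ M] {o : ManifoldOrientation m M} {X W : M → Euc (m + 1 + 1)}
  {ξ : M → Euc (m + 1 + 1)} {ν : M → Sph (m + 1)} {γ : Sph (m + 1) → ℝ}

/-- The ratio of `∑ᵢ det (ξ, dX e₁, …, dW eᵢ, …, dX eₙ)` and `det (ν, dX e₁, …, dX eₙ)`, for any
basis `e₁, …, eₙ` of the tangent space. -/
def variationDensity (ξ X : M → Euc (m + 1 + 1)) (ν : M → Sph (m + 1)) (W : M → Euc (m + 1 + 1))
    (p : M) : ℝ :=
  (∑ i, frameDet (ξ p) (Function.update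
      (fun j => dmap X p (chartBasis p p (mem_extChartAt_source p) j)) i
      (dmap W p (chartBasis p p (mem_extChartAt_source p) i)))) /
    frameDet (ν p : Euc (m + 1 + 1))
      (fun j => dmap X p (chartBasis p p (mem_extChartAt_source p) j))

lemma variationDensity_eq_zero {p : M} (hW : dmap W p = 0) : variationDensity ξ X ν W p = 0 := by
  rw [variationDensity, Finset.sum_eq_zero, zero_div]
  intro i _
  rw [hW, LinearMap.zero_apply, frameDet_update_zero]

/-- Linearity in `dW`. It leads from the localized fields `ρ_c δX`, to which the integration by
parts applies, back to `δX`. -/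
lemma variationDensity_finsetSum {ι : Type*} (t : Finset ι) (V : ι → M → Euc (m + 1 + 1)) {p : M}
    (hV : dmap W p = ∑ k ∈ t, dmap (V k) p) :
    variationDensity ξ X ν W p = ∑ k ∈ t, variationDensity ξ X ν (V k) p := by
  simp only [variationDensity]
  rw [← Finset.sum_div, Finset.sum_comm]
  congr 1
  refine Finset.sum_congr rfl fun i _ => ?_
  simp only [← frameForm_apply, hV, LinearMap.sum_apply]
  exact (frameForm (ξ p)).map_update_sum t i _ _

lemma dmap_eq_zero_of_notMem_tsupport {p : M} (hp : p ∉ tsupport W) : dmap W p = 0 := by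
  have h1 : W =ᶠ[𝓝 p] fun _ => 0 := notMem_tsupport_iff_eventuallyEq.mp hp
  have h2 : mfderiv (𝓡∂ (m + 1)) 𝓘(ℝ, Euc (m + 1 + 1)) W p = 0 := by
    rw [h1.mfderiv_eq]
    exact mfderiv_const
  refine LinearMap.ext fun v => ?_
  change mfderiv (𝓡∂ (m + 1)) 𝓘(ℝ, Euc (m + 1 + 1)) W p v = 0
  rw [h2]
  rfl

lemma dmap_sum {ι : Type*} (t : Finset ι) {V : ι → M → Euc (m + 1 + 1)}
    (hV : ∀ k ∈ t, ContMDiff (𝓡∂ (m + 1)) 𝓘(ℝ, Euc (m + 1 + 1)) 1 (V k))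
    (hW : ∀ p, W p = ∑ k ∈ t, V k p) (p : M) : dmap W p = ∑ k ∈ t, dmap (V k) p := by
  have hp := mem_extChartAt_target (I := 𝓡∂ (m + 1)) p
  have hW' : W ∘ (extChartAt (𝓡∂ (m + 1)) p).symm =
      fun u => ∑ k ∈ t, (V k ∘ (extChartAt (𝓡∂ (m + 1)) p).symm) u := funext fun u => hW _
  have h1 : HasFDerivWithinAt (W ∘ (extChartAt (𝓡∂ (m + 1)) p).symm)
      (∑ k ∈ t, chartDeriv (V k) p (extChartAt (𝓡∂ (m + 1)) p p)) (range (𝓡∂ (m + 1)))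
      (extChartAt (𝓡∂ (m + 1)) p p) := by
    rw [hW']
    exact HasFDerivWithinAt.fun_sum fun k hk => hasFDerivWithinAt_chartDeriv hp
      (contDiffOn_comp_symm (k := 1) (by simp) (hV k hk) p)
  have h2 : MDifferentiable (𝓡∂ (m + 1)) 𝓘(ℝ, Euc (m + 1 + 1)) W := by
    have : ContMDiff (𝓡∂ (m + 1)) 𝓘(ℝ, Euc (m + 1 + 1)) 1 W := by
      rw [show W = fun q => ∑ k ∈ t, V k q from funext hW]
      exact contMDiff_finsetSum fun k hk => hV k hk
    exact this.mdifferentiable one_ne_zero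
  have h3 : chartDeriv W p (extChartAt (𝓡∂ (m + 1)) p p) =
      ∑ k ∈ t, chartDeriv (V k) p (extChartAt (𝓡∂ (m + 1)) p p) :=
    h1.fderivWithin ((𝓡∂ (m + 1)).uniqueDiffOn _ (extChartAt_target_subset_range p hp))
  refine LinearMap.ext fun v => ?_
  rw [LinearMap.sum_apply]
  change mvfderiv (𝓡∂ (m + 1)) W p v = ∑ k ∈ t, mvfderiv (𝓡∂ (m + 1)) (V k) p v
  rw [mvfderiv_eq_chartDeriv h2, h3]
  refine (_root_.sum_apply t _ _).trans (Finset.sum_congr rfl fun k hk => ?_)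
  exact (mvfderiv_eq_chartDeriv ((hV k hk).mdifferentiable one_ne_zero) p v).symm

lemma partialDeriv_eq_zero_of_notMem_tsupport
    (hW : ContMDiff (𝓡∂ (m + 1)) 𝓘(ℝ, Euc (m + 1 + 1)) 1 W) {c : M} {u : Euc (m + 1)}
    (hu : u ∈ (extChartAt (𝓡∂ (m + 1)) c).target)
    (h : (extChartAt (𝓡∂ (m + 1)) c).symm u ∉ tsupport W) (i : Fin (m + 1)) :
    partialDeriv (W ∘ (extChartAt (𝓡∂ (m + 1)) c).symm) u i = 0 := by
  have hs := (extChartAt (𝓡∂ (m + 1)) c).map_target hu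
  have h1 := dmap_chartBasis hW hs i
  rw [(extChartAt (𝓡∂ (m + 1)) c).right_inv hu, dmap_eq_zero_of_notMem_tsupport h] at h1
  exact h1.symm

lemma exists_isCompact_extChartAt [CompactSpace M] {F : Type*} [Zero F] {f : M → F}
    {c : M} (hf : tsupport f ⊆ (extChartAt (𝓡∂ (m + 1)) c).source) :
    ∃ K, IsCompact K ∧ K ⊆ (extChartAt (𝓡∂ (m + 1)) c).target ∧
      ∀ u ∈ (extChartAt (𝓡∂ (m + 1)) c).target, u ∉ K →
        f ((extChartAt (𝓡∂ (m + 1)) c).symm u) = 0 := by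
  refine ⟨extChartAt (𝓡∂ (m + 1)) c '' tsupport f,
    ((isClosed_tsupport f).isCompact).image_of_continuousOn
      ((continuousOn_extChartAt c).mono hf), ?_, fun u hu huK => ?_⟩
  · rintro _ ⟨p, hp, rfl⟩
    exact (extChartAt (𝓡∂ (m + 1)) c).map_source (hf hp)
  · by_contra h
    exact huK ⟨_, subset_tsupport f h, (extChartAt (𝓡∂ (m + 1)) c).right_inv hu⟩

namespace IsWeakImmersion

/-- Numerator and denominator scale by the same determinant under a change of basis, so the
coordinate basis of the chart at `c` may be used; the denominator is then the volume density up to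
the sign `s`. -/
lemma variationDensity_eq (h : IsWeakImmersion o X ν)
    (hW : ContMDiff (𝓡∂ (m + 1)) 𝓘(ℝ, Euc (m + 1 + 1)) 1 W) {c : M} {s : ℝ} {U : Set M}
    (hU : IsOrientedChart o c s U) {u : Euc (m + 1)}
    (hu : u ∈ (extChartAt (𝓡∂ (m + 1)) c).target) (h0 : 0 < u 0)
    (huU : (extChartAt (𝓡∂ (m + 1)) c).symm u ∈ U) (ξ : M → Euc (m + 1 + 1)) :
    s * ∑ i, frameDet (ξ ((extChartAt (𝓡∂ (m + 1)) c).symm u))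
      (Function.update (partialDeriv (X ∘ (extChartAt (𝓡∂ (m + 1)) c).symm) u) i
        (partialDeriv (W ∘ (extChartAt (𝓡∂ (m + 1)) c).symm) u i)) =
      volumeDensity X c u *
        variationDensity ξ X ν W ((extChartAt (𝓡∂ (m + 1)) c).symm u) := by
  have hne := h.frameDet_ne_zero hu h0
  rw [← h.sign_mul_frameDet hU hu h0 huU]
  set p := (extChartAt (𝓡∂ (m + 1)) c).symm u with hp
  have hs : p ∈ (extChartAt (𝓡∂ (m + 1)) c).source := (extChartAt (𝓡∂ (m + 1)) c).map_target hu
  have hup : extChartAt (𝓡∂ (m + 1)) c p = u := (extChartAt (𝓡∂ (m + 1)) c).right_inv hu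
  have h1 : (fun j => dmap X p (chartBasis c p hs j)) =
      partialDeriv (X ∘ (extChartAt (𝓡∂ (m + 1)) c).symm) u := funext fun j => by
    rw [dmap_chartBasis h.contMDiff_one, hup]
  have h2 : ∀ i, dmap W p (chartBasis c p hs i) =
      partialDeriv (W ∘ (extChartAt (𝓡∂ (m + 1)) c).symm) u i := fun i => by
    rw [dmap_chartBasis hW, hup]
  have h3 := frameDet_comp_basis (chartBasis p p (mem_extChartAt_source p)) (dmap X p)
    (ν p : Euc (m + 1 + 1)) (chartBasis c p hs)
  have h4 := frameDet_deriv_comp_basis (chartBasis p p (mem_extChartAt_source p)) (dmap X p)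
    (dmap W p) (ξ p) (chartBasis c p hs)
  rw [h1] at h3
  simp only [h1, h2] at h4
  rw [h4, h3, variationDensity]
  rw [h3] at hne
  have h5 := left_ne_zero_of_mul hne
  field_simp

variable [CompactSpace M] [T2Space M] [MeasurableSpace M] [BorelSpace M]

/-- Integration by parts for a vector field supported in an oriented chart. -/
theorem integral_variationDensity (h : IsWeakImmersion o X ν)
    (hγ : ContMDiff (𝓡 (m + 1)) 𝓘(ℝ, ℝ) 2 γ)
    (hW : ContMDiff (𝓡∂ (m + 1)) 𝓘(ℝ, Euc (m + 1 + 1)) 1 W) {c : M} {s : ℝ} {U : Set M}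
    (hU : IsOrientedChart o c s U) (hWU : tsupport W ⊆ U) :
    Integrable (variationDensity (cahnHoffmanField γ ν) X ν W) (volumeMeasure X) ∧
    Integrable (fun p => ((m + 1 : ℕ) : ℝ) * anisotropicMeanCurvature γ X ν p *
      ⟪W p, (ν p : Euc (m + 1 + 1))⟫) (volumeMeasure X) ∧
    Integrable (fun p => ⟪W p, boundaryField o γ X ν p⟫) (boundaryMeasure X) ∧
    ∫ p, variationDensity (cahnHoffmanField γ ν) X ν W p ∂(volumeMeasure X) =
      -(∫ p, ((m + 1 : ℕ) : ℝ) * anisotropicMeanCurvature γ X ν p *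
        ⟪W p, (ν p : Euc (m + 1 + 1))⟫ ∂(volumeMeasure X)) -
      ∫ p, ⟪W p, boundaryField o γ X ν p⟫ ∂(boundaryMeasure X) := by
  set φ := extChartAt (𝓡∂ (m + 1)) c with hφ
  have hT := isHalfSpaceDomain_extChartAt_target (m := m) c
  have hWs : tsupport W ⊆ φ.source := hWU.trans hU.subset
  obtain ⟨K, hK, hKT, hK0⟩ := exists_isCompact_extChartAt hWs
  have hW0 : ∀ p, p ∉ φ.source → W p = 0 := fun p hp =>
    image_eq_zero_of_notMem_tsupport fun h => hp (hWs h)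
  have hξ := contMDiff_cahnHoffmanField hγ h.contMDiff_normal
  have cX := contDiffOn_comp_symm (k := 2) (by norm_cast) h.contMDiff_map c
  have cX1 := contDiffOn_comp_symm (k := 1) (by simp) h.contMDiff_one c
  have cξ := contDiffOn_comp_symm (k := 1) (by simp) hξ c
  have cW := contDiffOn_comp_symm (k := 1) (by simp) hW c
  -- In `e1`, `e2`, `e3` the integrands are written in coordinates: on the support of `W` by the
  -- formulas for oriented charts, off it because both sides vanish. The determinants on the left
  -- are continuous up to the boundary with compact support, whence the integrability of the
  -- right-hand sides.
  have e1 : ∀ u ∈ φ.target, 0 < u 0 →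
      s * ∑ i, frameDet ((cahnHoffmanField γ ν ∘ φ.symm) u)
        (Function.update (partialDeriv (X ∘ φ.symm) u) i (partialDeriv (W ∘ φ.symm) u i)) =
      volumeDensity X c u * variationDensity (cahnHoffmanField γ ν) X ν W (φ.symm u) := by
    intro u hu h0
    by_cases hs : φ.symm u ∈ tsupport W
    · exact h.variationDensity_eq hW hU hu h0 (hWU hs) _
    · rw [variationDensity_eq_zero (dmap_eq_zero_of_notMem_tsupport hs), mul_zero,
        Finset.sum_eq_zero, mul_zero]
      intro i _
      rw [partialDeriv_eq_zero_of_notMem_tsupport hW hu hs, frameDet_update_zero]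
  have e2 : ∀ u ∈ φ.target, 0 < u 0 →
      -(s * ∑ i, frameDet ((W ∘ φ.symm) u) (Function.update (partialDeriv (X ∘ φ.symm) u) i
        (partialDeriv (cahnHoffmanField γ ν ∘ φ.symm) u i))) =
      volumeDensity X c u * (((m + 1 : ℕ) : ℝ) * anisotropicMeanCurvature γ X ν (φ.symm u) *
        ⟪W (φ.symm u), (ν (φ.symm u) : Euc (m + 1 + 1))⟫) := by
    intro u hu h0
    by_cases hs : φ.symm u ∈ tsupport W
    · rw [neg_eq_iff_eq_neg]
      exact h.sum_frameDet_cahnHoffmanField hγ hU hu h0 (hWU hs) _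
    · have hz := image_eq_zero_of_notMem_tsupport hs
      simp [Function.comp_apply, hz, frameDet_zero_left]
  have e3 : ∀ v, boundaryPoint v ∈ φ.target →
      s * frameDet ((cahnHoffmanField γ ν ∘ φ.symm) (boundaryPoint v))
        (Fin.cons ((W ∘ φ.symm) (boundaryPoint v))
          fun j => partialDeriv (X ∘ φ.symm) (boundaryPoint v) j.succ) =
      boundaryDensity X c (boundaryPoint v) *
        ⟪W (φ.symm (boundaryPoint v)), boundaryField o γ X ν (φ.symm (boundaryPoint v))⟫ := by
    intro v hv
    by_cases hs : φ.symm (boundaryPoint v) ∈ tsupport W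
    · exact h.frameDet_cons_cahnHoffmanField hU hv (boundaryPoint_zero v) (hWU hs) _
    · have hz := image_eq_zero_of_notMem_tsupport hs
      rw [Function.comp_apply (f := W), hz, frameDet_cons_swap, frameDet_zero_left,
        inner_zero_left]
      simp
  have i1 : IntegrableOn (fun u => volumeDensity X c u *
      variationDensity (cahnHoffmanField γ ν) X ν W (φ.symm u)) φ.target :=
    ((integrableOn_frameDet_partialDeriv hT hK hKT cX1 cξ.continuousOn cW hK0).const_mul s).congr
      ((ae_restrict_pos hT).mono fun u hu => e1 u hu.1 hu.2)
  have i2 : IntegrableOn (fun u => volumeDensity X c u * (((m + 1 : ℕ) : ℝ) *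
      anisotropicMeanCurvature γ X ν (φ.symm u) *
        ⟪W (φ.symm u), (ν (φ.symm u) : Euc (m + 1 + 1))⟫)) φ.target :=
    ((integrableOn_frameDet_left hT hK hKT cX1 cξ cW.continuousOn hK0).const_mul s).neg.congr
      ((ae_restrict_pos hT).mono fun u hu => e2 u hu.1 hu.2)
  have i3 : IntegrableOn (fun v => boundaryDensity X c (boundaryPoint v) *
      ⟪W (φ.symm (boundaryPoint v)), boundaryField o γ X ν (φ.symm (boundaryPoint v))⟫)
      {v : Euc m | boundaryPoint v ∈ φ.target} := by
    have hc : ContinuousOn (fun v => s * frameDet ((cahnHoffmanField γ ν ∘ φ.symm) (boundaryPoint v))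
        (Fin.cons ((W ∘ φ.symm) (boundaryPoint v))
          fun j => partialDeriv (X ∘ φ.symm) (boundaryPoint v) j.succ))
        {v : Euc m | boundaryPoint v ∈ φ.target} := by
      have hb : MapsTo boundaryPoint {v : Euc m | boundaryPoint v ∈ φ.target} φ.target :=
        fun v hv => hv
      have hb' := (continuous_boundaryPoint (m := m)).continuousOn
        (s := {v : Euc m | boundaryPoint v ∈ φ.target})
      exact continuousOn_const.mul (continuousOn_frameDet
        (w := fun v => (cahnHoffmanField γ ν ∘ φ.symm) (boundaryPoint v))
        (v := fun i v => (Fin.cons ((W ∘ φ.symm) (boundaryPoint v))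
          fun j => partialDeriv (X ∘ φ.symm) (boundaryPoint v) j.succ :
          Fin (m + 1) → Euc (m + 1 + 1)) i)
        (cξ.continuousOn.comp hb' hb) (Fin.cases (cW.continuousOn.comp hb' hb) fun j =>
          (hT.continuousOn_partialDeriv cX1 j.succ).comp hb' hb))
    refine (integrableOn_of_continuousOn_of_eq_zero hT.measurableSet_boundary
      (K := boundaryProj m '' (K ∩ {u | u 0 = 0})) ?_ ?_ hc ?_).congr_fun e3
      hT.measurableSet_boundary
    · exact (hK.inter_right (isClosed_eq (by fun_prop) continuous_const)).image
        (boundaryProj m).continuous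
    · rintro _ ⟨u, ⟨huK, hu0⟩, rfl⟩
      rw [mem_ofPred_eq, boundaryPoint_boundaryProj hu0]
      exact hKT huK
    · intro v hv hvK
      have hvK' : boundaryPoint v ∉ K := fun h =>
        hvK ⟨_, ⟨h, boundaryPoint_zero v⟩, boundaryProj_boundaryPoint v⟩
      rw [Function.comp_apply (f := W), hK0 _ hv hvK', frameDet_cons_swap, frameDet_zero_left,
        neg_zero, mul_zero]
  obtain ⟨I1, E1⟩ := integral_volumeMeasure_of_source h.contMDiff_one (fun p hp =>
    variationDensity_eq_zero (dmap_eq_zero_of_notMem_tsupport fun h => hp (hWs h))) i1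
  obtain ⟨I2, E2⟩ := integral_volumeMeasure_of_source h.contMDiff_one
    (f := fun p => ((m + 1 : ℕ) : ℝ) * anisotropicMeanCurvature γ X ν p *
      ⟪W p, (ν p : Euc (m + 1 + 1))⟫)
    (fun p hp => by rw [hW0 p hp, inner_zero_left, mul_zero]) i2
  obtain ⟨I3, E3⟩ := integral_boundaryMeasure_of_source h.contMDiff_one
    (f := fun p => ⟪W p, boundaryField o γ X ν p⟫)
    (fun p hp => by rw [hW0 p hp, inner_zero_left]) i3
  refine ⟨I1, I2, I3, ?_⟩
  rw [E1, E2, E3]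
  have key := integral_frameDet_partialDeriv hT hK hKT cX cξ cW hK0
  have f1 := integral_congr_ae ((ae_restrict_pos hT).mono fun u hu => e1 u hu.1 hu.2)
  have f2 := integral_congr_ae ((ae_restrict_pos hT).mono fun u hu => e2 u hu.1 hu.2)
  have f3 := setIntegral_congr_fun (μ := volume) hT.measurableSet_boundary e3
  rw [integral_const_mul] at f1
  rw [integral_neg, integral_const_mul] at f2
  rw [integral_const_mul] at f3
  rw [← f1, ← f2, ← f3, key]
  ring

end IsWeakImmersion

end VariationDensity

/-! ### The cross product of a frame -/

section CrossProduct

/-- The vector `Z` with `⟪w, Z⟫ = det (w, v₁, …, vₙ)`. -/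
def crossVector {n : ℕ} (v : Fin n → Euc (n + 1)) : Euc (n + 1) :=
  WithLp.toLp 2 fun k => frameDet (EuclideanSpace.single k 1) v

lemma inner_crossVector {n : ℕ} (w : Euc (n + 1)) (v : Fin n → Euc (n + 1)) :
    ⟪w, crossVector v⟫ = frameDet w v := by
  have h1 : frameDet w v = ∑ k, w k * frameDet (EuclideanSpace.single k 1) v := by
    have h2 : w = ∑ k, w k • EuclideanSpace.single k (1 : ℝ) := by
      conv_lhs => rw [← (EuclideanSpace.basisFun (Fin (n + 1)) ℝ).sum_repr w]
      simp
    conv_lhs => rw [h2]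
    have h3 : ∀ t : Finset (Fin (n + 1)),
        frameDet (∑ k ∈ t, w k • EuclideanSpace.single k (1 : ℝ)) v =
        ∑ k ∈ t, w k * frameDet (EuclideanSpace.single k 1) v := by
      intro t
      induction t using Finset.induction_on with
      | empty => rw [Finset.sum_empty, Finset.sum_empty, frameDet_zero_left]
      | insert a t ha ih =>
        rw [Finset.sum_insert ha, Finset.sum_insert ha, frameDet_add_left, frameDet_smul_left, ih]
    exact h3 _
  rw [h1, PiLp.inner_apply]
  refine Finset.sum_congr rfl fun k _ => ?_
  rw [real_inner_eq_re_inner, RCLike.inner_apply]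
  simp [crossVector, mul_comm]

lemma hasDerivAt_crossVector {n : ℕ} {v : Fin n → ℝ → Euc (n + 1)} {v' : Fin n → Euc (n + 1)}
    {x : ℝ} (hv : ∀ i, HasDerivAt (v i) (v' i) x) :
    HasDerivAt (fun t => crossVector fun i => v i t)
      (∑ i, crossVector (Function.update (fun j => v j x) i (v' i))) x := by
  have h1 : HasDerivAt (fun t (k : Fin (n + 1)) =>
      frameDet (EuclideanSpace.single k (1 : ℝ) : Euc (n + 1)) fun i => v i t)
      (fun k => ∑ i, frameDet (EuclideanSpace.single k (1 : ℝ) : Euc (n + 1))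
        (Function.update (fun j => v j x) i (v' i))) x :=
    hasDerivAt_pi.mpr fun k => by
      have h2 := hasDerivAt_frameDet
        (hasDerivAt_const x (EuclideanSpace.single k (1 : ℝ) : Euc (n + 1))) hv
      rwa [frameDet_zero_left, zero_add] at h2
  have h3 := (PiLp.continuousLinearEquiv 2 ℝ
    (fun _ : Fin (n + 1) => ℝ)).symm.toContinuousLinearMap.hasFDerivAt.comp_hasDerivAt x h1
  refine h3.congr_deriv ?_
  ext k
  rw [WithLp.ofLp_sum, Finset.sum_apply]
  rfl

lemma continuousOn_crossVector {G : Type*} [TopologicalSpace G] {n : ℕ}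
    {s : Set G} {v : Fin n → G → Euc (n + 1)} (hv : ∀ i, ContinuousOn (v i) s) :
    ContinuousOn (fun t => crossVector fun i => v i t) s := by
  refine (PiLp.continuous_toLp 2 _).comp_continuousOn (continuousOn_pi.mpr fun k => ?_)
  exact continuousOn_frameDet continuousOn_const hv

end CrossProduct

/-! ### Variations in a chart -/

section Variation

variable {m : ℕ} {T : Set (Euc (m + 1))} {F : Type*} [NormedAddCommGroup F] [NormedSpace ℝ F]
  {a : ℝ} {Y : ℝ × Euc (m + 1) → F}

/-- The partial derivative in the space direction `eᵢ` of a map on `[-a, a] × T`. -/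
def spaceDeriv (a : ℝ) (T : Set (Euc (m + 1))) (Y : ℝ × Euc (m + 1) → F) (i : Fin (m + 1))
    (q : ℝ × Euc (m + 1)) : F :=
  fderivWithin ℝ Y (Icc (-a) a ×ˢ T) q (0, EuclideanSpace.single i 1)

/-- The partial derivative in the time direction of a map on `[-a, a] × T`. -/
def timeDeriv (a : ℝ) (T : Set (Euc (m + 1))) (Y : ℝ × Euc (m + 1) → F)
    (q : ℝ × Euc (m + 1)) : F :=
  fderivWithin ℝ Y (Icc (-a) a ×ˢ T) q (1, 0)

namespace IsHalfSpaceDomain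

lemma uniqueDiffOn_prod (hT : IsHalfSpaceDomain T) (ha : 0 < a) :
    UniqueDiffOn ℝ (Icc (-a) a ×ˢ T) :=
  (uniqueDiffOn_Icc (by linarith)).prod hT.uniqueDiffOn

lemma contDiffOn_spaceDeriv (hT : IsHalfSpaceDomain T) (ha : 0 < a) {k l : WithTop ℕ∞}
    (hl : l + 1 ≤ k) (hY : ContDiffOn ℝ k Y (Icc (-a) a ×ˢ T)) (i : Fin (m + 1)) :
    ContDiffOn ℝ l (spaceDeriv a T Y i) (Icc (-a) a ×ˢ T) :=
  (hY.fderivWithin (hT.uniqueDiffOn_prod ha) hl).clm_apply contDiffOn_const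

lemma contDiffOn_timeDeriv (hT : IsHalfSpaceDomain T) (ha : 0 < a) {k l : WithTop ℕ∞}
    (hl : l + 1 ≤ k) (hY : ContDiffOn ℝ k Y (Icc (-a) a ×ˢ T)) :
    ContDiffOn ℝ l (timeDeriv a T Y) (Icc (-a) a ×ˢ T) :=
  (hY.fderivWithin (hT.uniqueDiffOn_prod ha) hl).clm_apply contDiffOn_const

lemma spaceDeriv_eq (hT : IsHalfSpaceDomain T) (hY : ContDiffOn ℝ 1 Y (Icc (-a) a ×ˢ T))
    {ε : ℝ} (hε : ε ∈ Icc (-a) a) {u : Euc (m + 1)} (hu : u ∈ T) (i : Fin (m + 1)) :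
    spaceDeriv a T Y i (ε, u) = partialDeriv (fun u => Y (ε, u)) u i := by
  have h1 := (hY.differentiableOn one_ne_zero (ε, u) ⟨hε, hu⟩).hasFDerivWithinAt
  have h2 : HasFDerivWithinAt (fun u : Euc (m + 1) => (ε, u))
      (ContinuousLinearMap.inr ℝ ℝ (Euc (m + 1))) T u :=
    (hasFDerivAt_prodMk_right ε u).hasFDerivWithinAt
  have h3 := HasFDerivWithinAt.comp (t := Icc (-a) a ×ˢ T) u h1 h2 fun v hv => ⟨hε, hv⟩
  rw [partialDeriv, ← hT.fderivWithin_eq hu]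
  have h4 := h3.fderivWithin (hT.uniqueDiffOn u hu)
  exact (congrArg (fun L : Euc (m + 1) →L[ℝ] F => L (EuclideanSpace.single i 1)) h4).symm

lemma hasDerivAt_timeDeriv (hY : ContDiffOn ℝ 1 Y (Icc (-a) a ×ˢ T))
    {ε : ℝ} (hε : ε ∈ Ioo (-a) a) {u : Euc (m + 1)} (hu : u ∈ T) :
    HasDerivAt (fun t => Y (t, u)) (timeDeriv a T Y (ε, u)) ε := by
  have h1 := (hY.differentiableOn one_ne_zero (ε, u) ⟨Ioo_subset_Icc_self hε, hu⟩).hasFDerivWithinAt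
  have h2 : HasFDerivWithinAt (fun t : ℝ => (t, u))
      (ContinuousLinearMap.inl ℝ ℝ (Euc (m + 1))) (Icc (-a) a) ε :=
    (hasFDerivAt_prodMk_left ε u).hasFDerivWithinAt
  have h3 := HasFDerivWithinAt.comp (t := Icc (-a) a ×ˢ T) ε h1 h2 fun t ht => ⟨ht, hu⟩
  exact (h3.hasFDerivAt (Icc_mem_nhds hε.1 hε.2)).hasDerivAt

/-- The derivatives in time and in space commute. -/
lemma timeDeriv_spaceDeriv (hT : IsHalfSpaceDomain T) (ha : 0 < a)
    (hY : ContDiffOn ℝ 2 Y (Icc (-a) a ×ˢ T)) {ε : ℝ} (hε : ε ∈ Ioo (-a) a)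
    {u : Euc (m + 1)} (hu : u ∈ T) (h0 : 0 < u 0) (i : Fin (m + 1)) :
    timeDeriv a T (spaceDeriv a T Y i) (ε, u) = spaceDeriv a T (timeDeriv a T Y) i (ε, u) := by
  have hS := hT.uniqueDiffOn_prod ha
  have hmem : (ε, u) ∈ Icc (-a) a ×ˢ T := ⟨Ioo_subset_Icc_self hε, hu⟩
  have hint : (ε, u) ∈ interior (Icc (-a) a ×ˢ T) :=
    mem_interior_iff_mem_nhds.mpr (prod_mem_nhds (Icc_mem_nhds hε.1 hε.2) (hT.mem_nhds hu h0))
  have hsymm := (hY _ hmem).isSymmSndFDerivWithinAt (by simp) hS (subset_closure hint) hmem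
  have hd := (hY.fderivWithin hS (m := 1) (by norm_num)).differentiableOn one_ne_zero _ hmem
  have key : ∀ v w : ℝ × Euc (m + 1),
      fderivWithin ℝ (fun q => fderivWithin ℝ Y (Icc (-a) a ×ˢ T) q v) (Icc (-a) a ×ˢ T) (ε, u) w =
      fderivWithin ℝ (fderivWithin ℝ Y (Icc (-a) a ×ˢ T)) (Icc (-a) a ×ˢ T) (ε, u) w v := by
    intro v w
    have h1 := hd.hasFDerivWithinAt.clm_apply
      (hasFDerivWithinAt_const v (ε, u) (Icc (-a) a ×ˢ T))
    rw [h1.fderivWithin (hS _ hmem)]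
    simp
  exact (key _ _).trans ((hsymm _ _).trans (key _ _).symm)

end IsHalfSpaceDomain

variable {M : Type*} [TopologicalSpace M] [ChartedSpace (EuclideanHalfSpace (m + 1)) M]
  [IsManifold (𝓡∂ (m + 1)) ∞ M] {X : ℝ → M → Euc (m + 1 + 1)} {δX : M → Euc (m + 1 + 1)}

lemma contDiffOn_joint {f : ℝ → M → F}
    (hf : ContMDiffOn (𝓘(ℝ, ℝ).prod (𝓡∂ (m + 1))) 𝓘(ℝ, F) 2
      (fun q : ℝ × M => f q.1 q.2) (Icc (-a) a ×ˢ (univ : Set M))) (c : M) :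
    ContDiffOn ℝ 2 (fun q : ℝ × Euc (m + 1) => f q.1 ((extChartAt (𝓡∂ (m + 1)) c).symm q.2))
      (Icc (-a) a ×ˢ (extChartAt (𝓡∂ (m + 1)) c).target) := by
  rw [← contMDiffOn_iff_contDiffOn]
  have h1 : ContMDiffOn 𝓘(ℝ, ℝ × Euc (m + 1)) 𝓘(ℝ, ℝ) 2 (fun q : ℝ × Euc (m + 1) => q.1)
      (Icc (-a) a ×ˢ (extChartAt (𝓡∂ (m + 1)) c).target) :=
    contDiff_fst.contMDiff.contMDiffOn
  have h2 : ContMDiffOn 𝓘(ℝ, ℝ × Euc (m + 1)) 𝓘(ℝ, Euc (m + 1)) 2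
      (fun q : ℝ × Euc (m + 1) => q.2)
      (Icc (-a) a ×ˢ (extChartAt (𝓡∂ (m + 1)) c).target) :=
    contDiff_snd.contMDiff.contMDiffOn
  have h3 : ContMDiffOn 𝓘(ℝ, Euc (m + 1)) (𝓡∂ (m + 1)) 2 (extChartAt (𝓡∂ (m + 1)) c).symm
      (extChartAt (𝓡∂ (m + 1)) c).target :=
    (contMDiffOn_extChartAt_symm (n := ∞) c).of_le (by norm_cast)
  exact hf.comp (h1.prodMk (h3.comp h2 fun q hq => hq.2)) fun q hq => ⟨hq.1, mem_univ _⟩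

/-- The variation vector field in a chart. -/
lemma variationField_comp_symm (ha : 0 < a)
    (hX : ContMDiffOn (𝓘(ℝ, ℝ).prod (𝓡∂ (m + 1))) 𝓘(ℝ, Euc (m + 1 + 1)) 2
      (fun q : ℝ × M => X q.1 q.2) (Icc (-a) a ×ˢ (univ : Set M)))
    (hδX : ∀ p, δX p = deriv (fun ε => X ε p) 0) (c : M) :
    EqOn (δX ∘ (extChartAt (𝓡∂ (m + 1)) c).symm)
      (fun u => timeDeriv a (extChartAt (𝓡∂ (m + 1)) c).target
        (fun q => X q.1 ((extChartAt (𝓡∂ (m + 1)) c).symm q.2)) (0, u))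
      (extChartAt (𝓡∂ (m + 1)) c).target := fun u hu => by
  rw [Function.comp_apply, hδX]
  exact (IsHalfSpaceDomain.hasDerivAt_timeDeriv ((contDiffOn_joint hX c).of_le (by norm_num))
    (show (0 : ℝ) ∈ Ioo (-a) a from ⟨by linarith, ha⟩) hu).deriv

/-- In a chart the field is the time derivative, at `ε = 0`, of a jointly `C²` map. -/
lemma contMDiff_variationField (ha : 0 < a)
    (hX : ContMDiffOn (𝓘(ℝ, ℝ).prod (𝓡∂ (m + 1))) 𝓘(ℝ, Euc (m + 1 + 1)) 2
      (fun q : ℝ × M => X q.1 q.2) (Icc (-a) a ×ˢ (univ : Set M)))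
    (hδX : ∀ p, δX p = deriv (fun ε => X ε p) 0) :
    ContMDiff (𝓡∂ (m + 1)) 𝓘(ℝ, Euc (m + 1 + 1)) 1 δX := by
  intro c
  have hT := isHalfSpaceDomain_extChartAt_target (m := m) c
  have h1 : ContDiffOn ℝ 1 (δX ∘ (extChartAt (𝓡∂ (m + 1)) c).symm)
      (extChartAt (𝓡∂ (m + 1)) c).target := by
    refine ContDiffOn.congr ?_ (variationField_comp_symm ha hX hδX c)
    exact (hT.contDiffOn_timeDeriv ha (l := 1) (by norm_num) (contDiffOn_joint hX c)).comp
      (contDiff_prodMk_right 0).contDiffOn fun u hu => ⟨⟨by linarith, ha.le⟩, hu⟩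
  have h2 : ContMDiffOn (𝓡∂ (m + 1)) 𝓘(ℝ, Euc (m + 1 + 1)) 1
      ((δX ∘ (extChartAt (𝓡∂ (m + 1)) c).symm) ∘ extChartAt (𝓡∂ (m + 1)) c)
      (extChartAt (𝓡∂ (m + 1)) c).source := by
    refine (contMDiffOn_iff_contDiffOn.mpr h1).comp (t := (extChartAt (𝓡∂ (m + 1)) c).target) ?_ ?_
    · rw [extChartAt_source]
      exact contMDiffOn_extChartAt
    · exact fun p hp => (extChartAt (𝓡∂ (m + 1)) c).map_source hp
  have h3 : ContMDiffOn (𝓡∂ (m + 1)) 𝓘(ℝ, Euc (m + 1 + 1)) 1 δX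
      (extChartAt (𝓡∂ (m + 1)) c).source :=
    h2.congr fun p hp => by
      rw [Function.comp_apply, Function.comp_apply, (extChartAt (𝓡∂ (m + 1)) c).left_inv hp]
  exact h3.contMDiffAt (extChartAt_source_mem_nhds c)

end Variation

/-! ### The derivative of the localized energy -/

section LocalizedEnergy

variable {m : ℕ} {M : Type*} [TopologicalSpace M] [ChartedSpace (EuclideanHalfSpace (m + 1)) M]
  [IsManifold (𝓡∂ (m + 1)) ∞ M] {o : ManifoldOrientation m M} {γ : Sph (m + 1) → ℝ}

namespace IsWeakImmersion

variable {X : M → Euc (m + 1 + 1)} {ν : M → Sph (m + 1)} {c : M} {s : ℝ} {U : Set M}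
  {u : Euc (m + 1)}

lemma volumeDensity_pos (h : IsWeakImmersion o X ν)
    (hu : u ∈ (extChartAt (𝓡∂ (m + 1)) c).target) (h0 : 0 < u 0) : 0 < volumeDensity X c u := by
  rw [h.volumeDensity_eq_abs hu]
  exact abs_pos.mpr (h.frameDet_ne_zero hu h0)

/-- Both sides have the same inner product with every `w`, because `det (w, ∂X)` sees only the
normal component of `w`. -/
lemma smul_crossVector (h : IsWeakImmersion o X ν) (hU : IsOrientedChart o c s U)
    (hu : u ∈ (extChartAt (𝓡∂ (m + 1)) c).target) (h0 : 0 < u 0)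
    (huU : (extChartAt (𝓡∂ (m + 1)) c).symm u ∈ U) :
    s • crossVector (partialDeriv (X ∘ (extChartAt (𝓡∂ (m + 1)) c).symm) u) =
      volumeDensity X c u •
        (ν ((extChartAt (𝓡∂ (m + 1)) c).symm u) : Euc (m + 1 + 1)) := by
  refine ext_inner_left ℝ fun w => ?_
  rw [real_inner_smul_right, real_inner_smul_right, inner_crossVector,
    ← h.sign_mul_frameDet hU hu h0 huU,
    frameDet_eq_inner_mul (norm_coe_sph (ν ((extChartAt (𝓡∂ (m + 1)) c).symm u)))
      (h.inner_normal_eq_zero hu) w]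
  ring

/-- The energy density is the homogeneous extension of `γ` at the cross product of the coordinate
vector fields. -/
lemma homExt_smul_crossVector (h : IsWeakImmersion o X ν) (hU : IsOrientedChart o c s U)
    (hu : u ∈ (extChartAt (𝓡∂ (m + 1)) c).target) (h0 : 0 < u 0)
    (huU : (extChartAt (𝓡∂ (m + 1)) c).symm u ∈ U) :
    homExt γ (s • crossVector (partialDeriv (X ∘ (extChartAt (𝓡∂ (m + 1)) c).symm) u)) =
      volumeDensity X c u * γ (ν ((extChartAt (𝓡∂ (m + 1)) c).symm u)) := by
  rw [h.smul_crossVector hU hu h0 huU, homExt_smul γ (h.volumeDensity_pos hu h0), homExt_coe]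

end IsWeakImmersion

variable [CompactSpace M] [T2Space M] [MeasurableSpace M] [BorelSpace M]

/-- In coordinates the energy density is `homExt γ` at the cross product of the coordinate vectors,
an expression free of `ν ε`; so no regularity of `ν ε` in `ε` is needed. The chain rule gives the
density of the first variation, and the cut-off `ρ` supplies the compact support for dominated
convergence. -/
theorem hasDerivAt_localizedEnergy (hγ : ContMDiff (𝓡 (m + 1)) 𝓘(ℝ, ℝ) 2 γ) {a : ℝ} (ha : 0 < a)
    {X : ℝ → M → Euc (m + 1 + 1)} {ν : ℝ → M → Sph (m + 1)}
    (hX : ContMDiffOn (𝓘(ℝ, ℝ).prod (𝓡∂ (m + 1))) 𝓘(ℝ, Euc (m + 1 + 1)) 2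
      (fun q : ℝ × M => X q.1 q.2) (Icc (-a) a ×ˢ (univ : Set M)))
    (hweak : ∀ ε ∈ Icc (-a) a, IsWeakImmersion o (X ε) (ν ε))
    {δX : M → Euc (m + 1 + 1)} (hδX : ∀ p, δX p = deriv (fun ε => X ε p) 0)
    {c : M} {s : ℝ} {U : Set M} (hU : IsOrientedChart o c s U) {ρ : M → ℝ} (hρ : Continuous ρ)
    (hρU : tsupport ρ ⊆ U) :
    (∀ ε ∈ Icc (-a) a, Integrable (fun p => ρ p * γ (ν ε p)) (volumeMeasure (X ε))) ∧
    Integrable (fun p => ρ p * variationDensity (cahnHoffmanField γ (ν 0)) (X 0) (ν 0) δX p)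
      (volumeMeasure (X 0)) ∧
    HasDerivAt (fun ε => ∫ p, ρ p * γ (ν ε p) ∂(volumeMeasure (X ε)))
      (∫ p, ρ p * variationDensity (cahnHoffmanField γ (ν 0)) (X 0) (ν 0) δX p
        ∂(volumeMeasure (X 0))) 0 := by
  set φ := extChartAt (𝓡∂ (m + 1)) c with hφ
  have hT : IsHalfSpaceDomain φ.target := isHalfSpaceDomain_extChartAt_target (m := m) c
  have hρs : tsupport ρ ⊆ φ.source := hρU.trans hU.subset
  obtain ⟨K, hK, hKT, hK0⟩ : ∃ K, IsCompact K ∧ K ⊆ φ.target ∧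
      ∀ u ∈ φ.target, u ∉ K → ρ (φ.symm u) = 0 := exists_isCompact_extChartAt hρs
  have hρ0 : ∀ p, p ∉ U → ρ p = 0 := fun p hp =>
    image_eq_zero_of_notMem_tsupport fun h => hp (hρU h)
  have hρ0' : ∀ p, p ∉ φ.source → ρ p = 0 := fun p hp => hρ0 p fun h => hp (hU.subset h)
  have h0mem : (0 : ℝ) ∈ Icc (-a) a := ⟨by linarith, ha.le⟩
  have h0mem' : (0 : ℝ) ∈ Ioo (-a) a := ⟨by linarith, ha⟩
  have cφ : ContinuousOn φ.symm φ.target := continuousOn_extChartAt_symm c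
  have cρ : ContinuousOn (fun u => ρ (φ.symm u)) φ.target := hρ.comp_continuousOn cφ
  set Y : ℝ × Euc (m + 1) → Euc (m + 1 + 1) := fun q => X q.1 (φ.symm q.2) with hY
  have cY : ContDiffOn ℝ 2 Y (Icc (-a) a ×ˢ φ.target) := contDiffOn_joint hX c
  have cY1 : ContDiffOn ℝ 1 Y (Icc (-a) a ×ˢ φ.target) := cY.of_le (by norm_num)
  have cS : ∀ i, ContDiffOn ℝ 1 (spaceDeriv a φ.target Y i) (Icc (-a) a ×ˢ φ.target) :=
    hT.contDiffOn_spaceDeriv ha (by norm_num) cY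
  have cV : ∀ i, ContinuousOn (timeDeriv a φ.target (spaceDeriv a φ.target Y i))
      (Icc (-a) a ×ˢ φ.target) := fun i =>
    (hT.contDiffOn_timeDeriv ha (l := 0) (by norm_num) (cS i)).continuousOn
  have hS : ∀ ε ∈ Icc (-a) a, ∀ u ∈ φ.target, (fun i => spaceDeriv a φ.target Y i (ε, u)) =
      partialDeriv (X ε ∘ φ.symm) u := fun ε hε u hu =>
    funext fun i => hT.spaceDeriv_eq cY1 hε hu i
  -- The `ε`-derivative of the cross product, continuous up to the boundary. It determines `F'`, the
  -- candidate for the `ε`-derivative of the energy density `F`.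
  set Z' : ℝ × Euc (m + 1) → Euc (m + 1 + 1) := fun q => ∑ i, crossVector
    (Function.update (fun j => spaceDeriv a φ.target Y j q) i
      (timeDeriv a φ.target (spaceDeriv a φ.target Y i) q)) with hZ'
  have cZ' : ContinuousOn Z' (Icc (-a) a ×ˢ φ.target) := by
    refine continuousOn_finsetSum _ fun i _ => continuousOn_crossVector (v := fun k q =>
      Function.update (fun j => spaceDeriv a φ.target Y j q) i
        (timeDeriv a φ.target (spaceDeriv a φ.target Y i) q) k) fun k => ?_
    by_cases hk : k = i
    · subst hk
      simpa using cV k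
    · simpa [hk] using (cS k).continuousOn
  set F : ℝ → Euc (m + 1) → ℝ := fun ε u =>
    volumeDensity (X ε) c u * (ρ (φ.symm u) * γ (ν ε (φ.symm u))) with hF
  set F' : ℝ → Euc (m + 1) → ℝ := fun ε u =>
    ρ (φ.symm u) * (s * ⟪cahnHoffmanField γ (ν ε) (φ.symm u), Z' (ε, u)⟫) with hF'
  have iF : ∀ ε ∈ Icc (-a) a, IntegrableOn (F ε) φ.target := fun ε hε => by
    refine integrableOn_of_continuousOn_of_eq_zero hT.measurableSet hK hKT
      ((continuousOn_volumeDensity (hweak ε hε).contMDiff_one c).mul (cρ.mul ?_))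
      fun u hu huK => by rw [hF]; simp only [hK0 u hu huK, zero_mul, mul_zero]
    exact (hγ.continuous.comp (hweak ε hε).contMDiff_normal.continuous).comp_continuousOn cφ
  have EF := fun ε hε => integral_volumeMeasure_of_source (hweak ε hε).contMDiff_one (c := c)
    (f := fun p => ρ p * γ (ν ε p)) (fun p hp => by rw [hρ0' p hp, zero_mul]) (iF ε hε)
  have hFZ : ∀ ε ∈ Icc (-a) a, ∀ u ∈ φ.target, 0 < u 0 → F ε u = ρ (φ.symm u) *
      homExt γ (s • crossVector fun i => spaceDeriv a φ.target Y i (ε, u)) := by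
    intro ε hε u hu h0
    by_cases huU : φ.symm u ∈ U
    · rw [hS ε hε u hu, (hweak ε hε).homExt_smul_crossVector hU hu h0 huU, hF]
      ring
    · rw [hF]
      simp only [hρ0 _ huU, zero_mul, mul_zero]
  have hdiff : ∀ u ∈ φ.target, 0 < u 0 → ∀ ε ∈ Ioo (-a) a,
      HasDerivAt (fun t => F t u) (F' ε u) ε := by
    intro u hu h0 ε hε
    have hε' := Ioo_subset_Icc_self hε
    have hev : (fun t => F t u) =ᶠ[𝓝 ε] fun t => ρ (φ.symm u) *
        homExt γ (s • crossVector fun i => spaceDeriv a φ.target Y i (t, u)) := by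
      filter_upwards [Icc_mem_nhds hε.1 hε.2] with t ht using hFZ t ht u hu h0
    refine HasDerivAt.congr_of_eventuallyEq ?_ hev
    -- Off `U`, where the sign `s` carries no information, the cut-off `ρ` vanishes.
    by_cases huU : φ.symm u ∈ U
    · refine HasDerivAt.const_mul _ ?_
      have h1 : HasDerivAt (fun t => s • crossVector fun i => spaceDeriv a φ.target Y i (t, u))
          (s • Z' (ε, u)) ε :=
        (hasDerivAt_crossVector fun i =>
          IsHalfSpaceDomain.hasDerivAt_timeDeriv (cS i) hε hu).const_smul s
      have h2 : s • crossVector (fun i => spaceDeriv a φ.target Y i (ε, u)) =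
          volumeDensity (X ε) c u • (ν ε (φ.symm u) : Euc (m + 1 + 1)) := by
        rw [hS ε hε' u hu]
        exact (hweak ε hε').smul_crossVector hU hu h0 huU
      have hpos := (hweak ε hε').volumeDensity_pos hu h0
      have hγ1 : ContMDiff (𝓡 (m + 1)) 𝓘(ℝ, ℝ) 1 γ := hγ.of_le (by norm_num)
      have h3 : DifferentiableAt ℝ (homExt γ)
          (s • crossVector (fun i => spaceDeriv a φ.target Y i (ε, u))) := by
        rw [h2]
        exact (contDiffAt_homExt hγ1
          (smul_ne_zero hpos.ne' (coe_sph_ne_zero _))).differentiableAt one_ne_zero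
      have h4 := h3.hasFDerivAt.comp_hasDerivAt ε h1
      rw [h2, fderiv_homExt_smul hγ1 _ hpos, real_inner_smul_right] at h4
      exact h4
    · rw [hF']
      simp only [hρ0 _ huU, zero_mul]
      exact hasDerivAt_const _ _
  -- Domination uniform in `ε`: `ξ̃` is bounded because the sphere is compact, whatever the
  -- dependence of `ν ε` on `ε`, and `Z'` is continuous on the compact set `[-a, a] × K`.
  obtain ⟨C₁, hC₁, hC₁'⟩ := norm_cahnHoffman_bdd hγ
  obtain ⟨C₂, hC₂⟩ := (isCompact_Icc.prod hK).exists_bound_of_continuousOn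
    (cZ'.mono (prod_mono_right hKT))
  have hs1 : |s| = 1 := by rcases hU.sign with rfl | rfl <;> norm_num
  have hbound : ∀ u ∈ φ.target, ∀ ε ∈ Ioo (-a) a, ‖F' ε u‖ ≤ ‖ρ (φ.symm u)‖ * (C₁ * C₂) := by
    intro u hu ε hε
    by_cases huK : u ∈ K
    · rw [hF', norm_mul, norm_mul, Real.norm_eq_abs s, hs1, one_mul]
      refine mul_le_mul_of_nonneg_left ?_ (norm_nonneg _)
      exact (norm_inner_le_norm _ _).trans (mul_le_mul (hC₁' _)
        (hC₂ _ ⟨Ioo_subset_Icc_self hε, huK⟩) (norm_nonneg _) hC₁)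
    · rw [hF']
      simp only [hK0 u hu huK, zero_mul, norm_zero, le_refl]
  have hbi : IntegrableOn (fun u => ‖ρ (φ.symm u)‖ * (C₁ * C₂)) φ.target :=
    integrableOn_of_continuousOn_of_eq_zero hT.measurableSet hK hKT
      (cρ.norm.mul continuousOn_const) fun u hu huK => by
        rw [hK0 u hu huK, norm_zero, zero_mul]
  have cF' : ContinuousOn (F' 0) φ.target := by
    have c1 : ContinuousOn (fun u => cahnHoffmanField γ (ν 0) (φ.symm u)) φ.target :=
      (contMDiff_cahnHoffmanField hγ
        (hweak 0 h0mem).contMDiff_normal).continuous.comp_continuousOn cφ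
    have c2 : ContinuousOn (fun u => Z' (0, u)) φ.target :=
      cZ'.comp (by fun_prop) fun u hu => ⟨h0mem, hu⟩
    exact cρ.mul (continuousOn_const.mul (c1.inner (𝕜 := ℝ) c2))
  have hder := hasDerivAt_integral_of_dominated_loc_of_deriv_le
    (μ := volume.restrict φ.target) (F := F) (F' := F') (x₀ := (0 : ℝ)) (s := Ioo (-a) a)
    (Ioo_mem_nhds h0mem'.1 h0mem'.2)
    (by
      filter_upwards [Icc_mem_nhds h0mem'.1 h0mem'.2] with t ht
      exact (iF t ht).aestronglyMeasurable)
    (iF 0 h0mem) (cF'.aestronglyMeasurable hT.measurableSet)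
    ((ae_restrict_mem hT.measurableSet).mono hbound) hbi
    ((ae_restrict_pos hT).mono fun u hu => hdiff u hu.1 hu.2)
  have hδ := variationField_comp_symm ha hX hδX c
  have hF'0 : ∀ u ∈ φ.target, 0 < u 0 → F' 0 u = volumeDensity (X 0) c u * (ρ (φ.symm u) *
      variationDensity (cahnHoffmanField γ (ν 0)) (X 0) (ν 0) δX (φ.symm u)) := by
    intro u hu h0
    by_cases huU : φ.symm u ∈ U
    -- Time and space derivatives commute, so the `ε`-derivative of `∂ᵢX` is `∂ᵢδX`.
    · have h1 : ∀ i, timeDeriv a φ.target (spaceDeriv a φ.target Y i) (0, u) =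
          partialDeriv (δX ∘ φ.symm) u i := fun i => by
        rw [hT.timeDeriv_spaceDeriv ha cY h0mem' hu h0, hT.spaceDeriv_eq
          (hT.contDiffOn_timeDeriv ha (by norm_num) cY) h0mem hu, partialDeriv, partialDeriv,
          ← hT.fderivWithin_eq hu, ← hT.fderivWithin_eq hu, fderivWithin_congr hδ (hδ hu)]
      have h2 := (hweak 0 h0mem).variationDensity_eq (contMDiff_variationField ha hX hδX) hU hu h0
        huU (cahnHoffmanField γ (ν 0))
      rw [mul_left_comm, ← h2, hF', hZ']
      simp only [inner_sum, inner_crossVector, hS 0 h0mem u hu, h1]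
      rfl
    · rw [hF']
      simp only [hρ0 _ huU, zero_mul, mul_zero]
  have hae : F' 0 =ᵐ[volume.restrict φ.target] fun u => volumeDensity (X 0) c u *
      (ρ (φ.symm u) *
        variationDensity (cahnHoffmanField γ (ν 0)) (X 0) (ν 0) δX (φ.symm u)) :=
    (ae_restrict_pos hT).mono fun u hu => hF'0 u hu.1 hu.2
  obtain ⟨I0, E0⟩ := integral_volumeMeasure_of_source (hweak 0 h0mem).contMDiff_one (c := c)
    (f := fun p => ρ p * variationDensity (cahnHoffmanField γ (ν 0)) (X 0) (ν 0) δX p)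
    (fun p hp => by rw [hρ0' p hp, zero_mul]) (hder.1.congr hae)
  refine ⟨fun ε hε => (EF ε hε).1, I0, ?_⟩
  rw [E0, ← integral_congr_ae hae]
  refine hder.2.congr_of_eventuallyEq ?_
  filter_upwards [Icc_mem_nhds h0mem'.1 h0mem'.2] with t ht using (EF t ht).2

end LocalizedEnergy

/-! ### Partitions of unity subordinate to oriented charts -/

section PartitionOfUnity

variable {m : ℕ} {M : Type*} [TopologicalSpace M] [ChartedSpace (EuclideanHalfSpace (m + 1)) M]
  [IsManifold (𝓡∂ (m + 1)) ∞ M] [CompactSpace M] [T2Space M]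

/-- A finite smooth partition of unity subordinate to oriented charts. -/
lemma exists_partition_isOrientedChart (o : ManifoldOrientation m M) :
    ∃ (t : Finset M) (s : M → ℝ) (U : M → Set M) (ρ : M → M → ℝ),
      (∀ c, IsOrientedChart o c (s c) (U c)) ∧
      (∀ c, ContMDiff (𝓡∂ (m + 1)) 𝓘(ℝ, ℝ) ∞ (ρ c)) ∧
      (∀ c ∈ t, tsupport (ρ c) ⊆ U c) ∧ ∀ p, ∑ c ∈ t, ρ c p = 1 := by
  choose s U hU using fun c => exists_isOrientedChart o c
  obtain ⟨t, ht⟩ := isCompact_univ.elim_finite_subcover U (fun c => (hU c).isOpen)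
    fun p _ => mem_iUnion.mpr ⟨p, (hU p).mem⟩
  obtain ⟨f, hf⟩ := SmoothPartitionOfUnity.exists_isSubordinate (𝓡∂ (m + 1)) isClosed_univ
    (fun c : t => U c) (fun c => (hU c).isOpen) (fun p hp => by
      obtain ⟨c, hc, hpc⟩ := mem_iUnion₂.mp (ht hp)
      exact mem_iUnion.mpr ⟨⟨c, hc⟩, hpc⟩)
  classical
  refine ⟨t, s, U, fun c => if hc : c ∈ t then f ⟨c, hc⟩ else 0, hU, fun c => ?_, fun c hc => ?_,
    fun p => ?_⟩
  · by_cases hc : c ∈ t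
    · simp only [hc, dif_pos]
      exact (f ⟨c, hc⟩).contMDiff
    · simp only [hc, dif_neg, not_false_eq_true]
      exact contMDiff_const
  · simp only [hc, dif_pos]
    exact hf ⟨c, hc⟩
  · have h1 := f.sum_eq_one (mem_univ p)
    rw [finsum_eq_sum_of_fintype] at h1
    rw [← h1, ← Finset.sum_coe_sort]
    refine Finset.sum_congr rfl fun c _ => ?_
    simp

end PartitionOfUnity

end AnisotropicEnergy

end

/-! ### The first variation formula -/

open AnisotropicEnergy in
theorem proposition9p2 {m : ℕ} {M : Type*} [TopologicalSpace M] [T2Space M] [CompactSpace M]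
    [ConnectedSpace M] [ChartedSpace (EuclideanHalfSpace (m + 1)) M]
    [IsManifold (𝓡∂ (m + 1)) ∞ M] [MeasurableSpace M] [BorelSpace M]
    (o : ManifoldOrientation m M)
    (γ : Sph (m + 1) → ℝ) (hγ : ContMDiff (𝓡 (m + 1)) 𝓘(ℝ, ℝ) 2 γ) (hγpos : ∀ x, 0 < γ x)
    (ε₀ : ℝ) (hε₀ : 0 < ε₀)
    (X : ℝ → M → Euc (m + 1 + 1)) (ν : ℝ → M → Sph (m + 1))
    (hX : ContMDiffOn (𝓘(ℝ, ℝ).prod (𝓡∂ (m + 1))) 𝓘(ℝ, Euc (m + 1 + 1)) 2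
      (fun q : ℝ × M => X q.1 q.2) (Icc (-ε₀) ε₀ ×ˢ (univ : Set M)))
    (hweak : ∀ ε ∈ Icc (-ε₀) ε₀, IsWeakImmersion o (X ε) (ν ε))
    (hΛ : ∀ ε ∈ Icc (-ε₀) ε₀, ∃ C : ℝ, ∀ p ∈ (𝓡∂ (m + 1)).interior M,
      |anisotropicMeanCurvature γ (X ε) (ν ε) p| ≤ C)
    (δX : M → Euc (m + 1 + 1)) (hδX : ∀ p, δX p = deriv (fun ε => X ε p) 0)
    (ψ : M → ℝ) (hψ : ∀ p, ψ p = ⟪δX p, (ν 0 p : Euc (m + 1 + 1))⟫) :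
    (∀ ε ∈ Icc (-ε₀) ε₀, Integrable (fun p => γ (ν ε p)) (volumeMeasure (X ε))) ∧
    Integrable (fun p => ((m + 1 : ℕ) : ℝ) * anisotropicMeanCurvature γ (X 0) (ν 0) p * ψ p)
      (volumeMeasure (X 0)) ∧
    Integrable (fun p => ⟪δX p, boundaryField o γ (X 0) (ν 0) p⟫) (boundaryMeasure (X 0)) ∧
    HasDerivAt (fun ε => energy γ (X ε) (ν ε))
      (-(∫ p, ((m + 1 : ℕ) : ℝ) * anisotropicMeanCurvature γ (X 0) (ν 0) p * ψ p
          ∂(volumeMeasure (X 0)))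
        - ∫ p, ⟪δX p, boundaryField o γ (X 0) (ν 0) p⟫ ∂(boundaryMeasure (X 0))) 0 := by
  have h0 : (0 : ℝ) ∈ Icc (-ε₀) ε₀ := ⟨by linarith, hε₀.le⟩
  obtain ⟨t, s, U, ρ, hU, hρ, hρU, hρ1⟩ := exists_partition_isOrientedChart o
  have hρc : ∀ c, Continuous (ρ c) := fun c => (hρ c).continuous
  have hδ := contMDiff_variationField hε₀ hX hδX
  -- The energy is localized by the factor `ρ c`, the integration by parts by the field `ρ c • δX`.
  -- The two localizations agree only after summation (`e4`), since the differential of `ρ c • δX`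
  -- contains an extra term in `dρ c`, and these terms sum to zero.
  set V : M → M → Euc (m + 1 + 1) := fun c p => ρ c p • δX p with hV
  have cV : ∀ c, ContMDiff (𝓡∂ (m + 1)) 𝓘(ℝ, Euc (m + 1 + 1)) 1 (V c) := fun c =>
    ((hρ c).of_le (by simp)).smul hδ
  have hVU : ∀ c ∈ t, tsupport (V c) ⊆ U c := fun c hc =>
    (tsupport_smul_subset_left (ρ c) δX).trans (hρU c hc)
  have hVsum : ∀ p, δX p = ∑ c ∈ t, V c p := fun p => by
    rw [← Finset.sum_smul, hρ1, one_smul]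
  have hE := fun c hc => hasDerivAt_localizedEnergy hγ hε₀ hX hweak hδX (hU c) (hρc c) (hρU c hc)
  have hP := fun c hc => (hweak 0 h0).integral_variationDensity hγ (cV c) (hU c) (hVU c hc)
  have e1 : ∀ ε, (fun p => γ (ν ε p)) = fun p => ∑ c ∈ t, ρ c p * γ (ν ε p) := fun ε =>
    funext fun p => by rw [← Finset.sum_mul, hρ1, one_mul]
  have e2 : (fun p => ((m + 1 : ℕ) : ℝ) * anisotropicMeanCurvature γ (X 0) (ν 0) p * ψ p) =
      fun p => ∑ c ∈ t, ((m + 1 : ℕ) : ℝ) * anisotropicMeanCurvature γ (X 0) (ν 0) p *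
        ⟪V c p, (ν 0 p : Euc (m + 1 + 1))⟫ := funext fun p => by
    rw [← Finset.mul_sum, ← sum_inner, ← hVsum, hψ]
  have e3 : (fun p => ⟪δX p, boundaryField o γ (X 0) (ν 0) p⟫) =
      fun p => ∑ c ∈ t, ⟪V c p, boundaryField o γ (X 0) (ν 0) p⟫ := funext fun p => by
    rw [← sum_inner, ← hVsum]
  have e4 : ∀ p, ∑ c ∈ t,
      ρ c p * variationDensity (cahnHoffmanField γ (ν 0)) (X 0) (ν 0) δX p =
      ∑ c ∈ t, variationDensity (cahnHoffmanField γ (ν 0)) (X 0) (ν 0) (V c) p := fun p => by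
    rw [← Finset.sum_mul, hρ1, one_mul]
    exact variationDensity_finsetSum t V (dmap_sum t (fun c _ => cV c) hVsum p)
  refine ⟨fun ε hε => ?_, ?_, ?_, ?_⟩
  · rw [e1]
    exact integrable_finsetSum t fun c hc => (hE c hc).1 ε hε
  · rw [e2]
    exact integrable_finsetSum t fun c hc => (hP c hc).2.1
  · rw [e3]
    exact integrable_finsetSum t fun c hc => (hP c hc).2.2.1
  · have hD := HasDerivAt.fun_sum fun c hc => (hE c hc).2.2
    have hval : ∑ c ∈ t, ∫ p, ρ c p *
        variationDensity (cahnHoffmanField γ (ν 0)) (X 0) (ν 0) δX p ∂(volumeMeasure (X 0)) =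
        -(∫ p, ((m + 1 : ℕ) : ℝ) * anisotropicMeanCurvature γ (X 0) (ν 0) p * ψ p
          ∂(volumeMeasure (X 0)))
        - ∫ p, ⟪δX p, boundaryField o γ (X 0) (ν 0) p⟫ ∂(boundaryMeasure (X 0)) := by
      rw [← integral_finsetSum t fun c hc => (hE c hc).2.1, integral_congr_ae (ae_of_all _ e4),
        integral_finsetSum t fun c hc => (hP c hc).1, e2, e3,
        integral_finsetSum t fun c hc => (hP c hc).2.1,
        integral_finsetSum t fun c hc => (hP c hc).2.2.1, ← Finset.sum_neg_distrib,
        ← Finset.sum_sub_distrib]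
      exact Finset.sum_congr rfl fun c hc => (hP c hc).2.2.2
    rw [← hval]
    refine hD.congr_of_eventuallyEq ?_
    filter_upwards [Icc_mem_nhds (by linarith : -ε₀ < 0) hε₀] with ε hε
    rw [energy, e1]
    exact integral_finsetSum t fun c hc => (hE c hc).1 ε hε
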